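/- Let $d\ge 1$, $\varepsilon>0$, and let $\omega:\mathbb R^d\to(0,\infty)$ be continuously differentiable with a global minimum at the origin, $\kappa:=\omega(0)$, and $|\partial\omega(q)|/\omega(q)\to 0$ as $|q|\to\infty$. Let $\lambda:\mathbb R^d\to\mathbb C$ be continuously differentiable and $h:\mathbb R^d\to(0,1]$ square integrable with $|\lambda|\le h$ and $|\partial\lambda|\le C h$ for some $C>0$. Let $\mathcal C_n$ be the set of $n$-point subsets of $\mathbb R^d$ and $\mathcal C=\bigcup_{n\ge0}\mathcal C_n$, with the Lebesgue–Poisson measure $d\mu(Q)=(1/|Q|!)\prod_{q\in Q}dq$, let $\omega(Q)=\sum_{q\in Q}\omega(q)$ and $\mathcal H=L^2(\mathcal C,\mathbb C^2;d\mu)$, and let $\mathcal H_n$, $\mathcal H_{>n}$ be the subspaces of functions supported on $\{|Q|=n\}$, $\{|Q|>n\}$. Write $\sigma_1,\sigma_3$ for the Pauli matrices and, for $\alpha\ge 0$, $$(HF)(Q)=[\varepsilon\sigma_3+\omega(Q)]F(Q)+\alpha\sigma_1\Big[\sum_{q\in Q}\lambda(q)F(Q\setminus q)+\int\overline{\lambda(k)}F(Q\cup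 k)\,dk\Big].$$ Let $B_n=P_{\mathcal H_{>n}}HP_{\mathcal H_{>n}}$ on $\mathcal H_{>n}$, with domain $\{F:\omega(\cdot)F\in L^2\}$, let $(C_nF)(Q)=\delta_{|Q|,n}\,\alpha\sigma_1\int\overline{\lambda(k)}F(Q\cup k)\,dk$ from $\mathcal H_{>n}$ to $\mathcal H_n$, and let $(C_n^*f)(Q)=\delta_{|Q|,n+1}\,\alpha\sigma_1\sum_{k\in Q}\lambda(k)f(Q\setminus k)$ from $\mathcal H_n$ to $\mathcal H_{>n}$. For $\eta>0$ put $D_{n,\eta}=\{z\in\mathbb C:\operatorname{Re}z<-\varepsilon+(n+1)\kappa-\eta\}$. Let $|\cdot|$ be the norm $\max_{i,j}|n_{ij}|$ on the space $\mathcal M_2$ of complex $2\times2$ matrices. For every $\eta_1>0$ there is a constant $C'>0$ (depending only on $\eta_1$ and on $d,\varepsilon,\omega,\lambda,h$) such that for every $\eta\in(0,\eta_1]$ there are numbers $\alpha_0(\eta,0)\ge\alpha_0(\eta,1)\ge\dots$, all positive, with the following property. For every $\alpha\ge0$ there are $\mathcal M_2$-valued functions $m_n(z;Q)$ and $\hat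 D_{n,m}(z;Q_1;Q_2;k_1,\dots,k_m)$ such that, for every $n\ge0$ with $\alpha<\alpha_0(\eta,n)$: 0. For all $z\in D_{n,\eta}$, the operators $C_n$ and $C_n^*$ are bounded, the bounded inverse $(B_n-z)^{-1}$ exists on $\mathcal H_{>n}$, and for all $f\in\mathcal H_n$ and almost all $Q\in\mathcal C_n$ $$[C_n(B_n-z)^{-1}C_n^*f](Q)=m_n(z;Q)f(Q)+\sum_{m=1}^n\ \sum_{Q_1\subset Q,\,|Q_1|=m}\int\hat D_{n,m}(z;Q_1;Q\setminus Q_1;k_1,\dots,k_m)\,f\big((Q\setminus Q_1)\cup\{k_1,\dots,k_m\}\big)\,dk_1\cdots dk_m ,$$ where the integrals converge absolutely. 1. For $Q\in\mathcal C_n$, $z\mapsto m_n(z;Q)$ is analytic in $D_{n,\eta}$, and for $z\in D_{n,\eta}$ $$m_n(z;Q)=m_0(z-\omega(Q);\emptyset),\qquad |m_n(z;Q)|\le 2C'\frac{\alpha^2}{\eta}\|\lambda\|^2_{L^2(\mathbb R^d)};$$ moreover $m_n(z;\cdot)$ is continuously differentiable on $\mathcal C_n$. 2. For $1\le m\le n$,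 $\hat D_{n,m}(z;Q_1;Q_2;k_1,\dots,k_m)=\hat D_{m,m}(z-\omega(Q_2);Q_1;\emptyset;k_1,\dots,k_m)$ for $z\in D_{n,\eta}$; this is analytic in $z\in D_{n,\eta}$, continuously differentiable in $(Q_1,Q_2,k)\in\mathcal C_m\times\mathcal C_{n-m}\times(\mathbb R^d)^m$, and $$\max_{|\beta|\le1}\big|\partial^\beta\hat D_{n,m}(z;Q_1;Q_2;k_1,\dots,k_m)\big|\le C'\Big(\frac{2\alpha}{\eta}\Big)^{m+1}\prod_{q\in Q_1}h(q)\prod_{i=1}^m h(k_i),$$ where $\partial^\beta$ ranges over the partial derivatives of order at most one in all coordinates of $Q_1$, $Q_2$ and $k_1,\dots,k_m$. -/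

import Mathlib

open MeasureTheory Filter Topology
open scoped ENNReal Nat ComplexConjugate

/-- Momentum space `ℝ^d`. -/
abbrev Mom (d : ℕ) : Type := EuclideanSpace ℝ (Fin d)

/-- The spin space `ℂ²`. -/
abbrev Spin : Type := EuclideanSpace ℂ (Fin 2)

/-- Complex `2 × 2` matrices; the norm in use is `max_{i,j} |n_{ij}|`. -/
abbrev SpinMat : Type := Matrix (Fin 2) (Fin 2) ℂ

attribute [local instance] Matrix.normedAddCommGroup Matrix.normedSpace

/-- The Pauli matrix `σ₃`. -/
noncomputable def sigma3 : SpinMat := !![1, 0; 0, -1]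

/-- The Pauli matrix `σ₁`. -/
noncomputable def sigma1 : SpinMat := !![0, 1; 1, 0]

/-- Action of a matrix on a spin vector. -/
noncomputable def matAct (A : SpinMat) (v : Spin) : Spin := WithLp.toLp 2 (A.mulVec v.ofLp)

/-- Configurations: finite subsets of `ℝ^d`. -/
abbrev Config (d : ℕ) : Type := Finset (Mom d)

open scoped Classical in
/-- The finite set `{x₁, …, xₙ}` of the entries of a tuple. -/
noncomputable def ofTuple {d n : ℕ} (x : Fin n → Mom d) : Config d := Finset.univ.image x

open scoped Classical in
/-- `Q ∪ k`. -/
noncomputable def addPoint {d : ℕ} (Q : Config d) (k : Mom d) : Config d := insert k Q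

open scoped Classical in
/-- `Q ∖ q`. -/
noncomputable def removePoint {d : ℕ} (Q : Config d) (q : Mom d) : Config d := Q.erase q

open scoped Classical in
/-- `Q ∖ Q₁`. -/
noncomputable def remove {d : ℕ} (Q Q₁ : Config d) : Config d := Q \ Q₁

open scoped Classical in
/-- `Q ∪ {k₁, …, kₘ}`. -/
noncomputable def addTuple {d m : ℕ} (Q : Config d) (k : Fin m → Mom d) : Config d :=
  Q ∪ ofTuple k

/-- A set of configurations is measurable iff, for every `n`, the set of `n`-tuples whose entries
form a configuration in it is a Borel set. -/
noncomputable instance configMeasurableSpace (d : ℕ) : MeasurableSpace (Config d) :=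
  ⨅ n : ℕ, MeasurableSpace.map (fun x : Fin n → Mom d => ofTuple x) inferInstance

theorem measurable_ofTuple (d n : ℕ) : Measurable (fun x : Fin n → Mom d => ofTuple x) :=
  fun _ hs => (MeasurableSpace.measurableSet_iInf.1 hs) n

/-- The Lebesgue–Poisson measure `dμ(Q) = (1/|Q|!) ∏_{q ∈ Q} dq`. -/
noncomputable def lebesguePoisson (d : ℕ) : Measure (Config d) :=
  Measure.sum fun n : ℕ =>
    ((n ! : ℝ≥0∞)⁻¹) • Measure.map (fun x : Fin n → Mom d => ofTuple x) volume

/-- The Hilbert space `L²(𝒞, ℂ²; dμ)`. -/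
abbrev SBSpace (d : ℕ) : Type := Lp Spin 2 (lebesguePoisson d)

/-- The vectors vanishing (almost everywhere) on all configurations whose number of points
fails `p`. -/
noncomputable def sector (d : ℕ) (p : ℕ → Prop) : Submodule ℂ (SBSpace d) where
  carrier := {F | ∀ᵐ Q ∂(lebesguePoisson d), ¬ p Q.card → F Q = 0}
  zero_mem' := by
    filter_upwards [Lp.coeFn_zero Spin 2 (lebesguePoisson d)] with Q h _
    exact h
  add_mem' := by
    intro F G hF hG
    filter_upwards [hF, hG, Lp.coeFn_add F G] with Q h1 h2 h3 hQ
    rw [h3, Pi.add_apply, h1 hQ, h2 hQ, add_zero]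
  smul_mem' := by
    intro c F hF
    filter_upwards [hF, Lp.coeFn_smul c F] with Q h1 h2 hQ
    rw [h2, Pi.smul_apply, h1 hQ, smul_zero]

/-- The `n`-boson sector `ℋₙ`. -/
noncomputable abbrev sectorEq (d n : ℕ) : Submodule ℂ (SBSpace d) := sector d (fun j => j = n)

/-- The subspace `ℋ_{>n}` of vectors with more than `n` bosons. -/
noncomputable abbrev sectorGt (d n : ℕ) : Submodule ℂ (SBSpace d) := sector d (fun j => n < j)

/-- `ω(Q) = ∑_{q ∈ Q} ω(q)`. -/
noncomputable def energy {d : ℕ} (ω : Mom d → ℝ) (Q : Config d) : ℝ := ∑ q ∈ Q, ω q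

/-- `Q ↦ ∑_{q ∈ Q} λ(q) F(Q ∖ q)`. -/
noncomputable def createAct {d : ℕ} (lam : Mom d → ℂ) (F : Config d → Spin) (Q : Config d) : Spin :=
  ∑ q ∈ Q, lam q • F (removePoint Q q)

/-- `Q ↦ ∫ conj (λ(k)) F(Q ∪ k) dk`. -/
noncomputable def annihilateAct {d : ℕ} (lam : Mom d → ℂ) (F : Config d → Spin) (Q : Config d) :
    Spin :=
  ∫ k : Mom d, conj (lam k) • F (addPoint Q k)

/-- The action of the spin-boson Hamiltonian `H = H₀ + H_int`. -/
noncomputable def hamiltonianAct {d : ℕ} (ε α : ℝ) (ω : Mom d → ℝ) (lam : Mom d → ℂ)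
    (F : Config d → Spin) (Q : Config d) : Spin :=
  (matAct ((ε : ℂ) • sigma3) (F Q) + (energy ω Q : ℂ) • F Q)
    + (α : ℂ) • matAct sigma1 (createAct lam F Q + annihilateAct lam F Q)

/-- The graph of the unbounded operator `Bₙ = P_{>n} H P_{>n}` in `ℋ_{>n}`, with the domain
`{F : ω(·) F ∈ L²}` of its free part: `IsB … F G` says that `F` is in the domain and `Bₙ F = G`. -/
def IsB {d : ℕ} (ε α : ℝ) (ω : Mom d → ℝ) (lam : Mom d → ℂ) (n : ℕ)
    (F G : sectorGt d n) : Prop :=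
  MemLp (fun Q => (energy ω Q : ℂ) • (F : SBSpace d) Q) 2 (lebesguePoisson d) ∧
  ∀ᵐ Q ∂(lebesguePoisson d), (G : SBSpace d) Q =
    if n < Q.card then hamiltonianAct ε α ω lam (F : SBSpace d) Q else 0

/-- `R` is the bounded operator `(Bₙ - z)⁻¹` on `ℋ_{>n}`: for all `F` and `G`, `R G = F` iff
`F` is in the domain of `Bₙ` and `Bₙ F - z F = G`. -/
def IsResolventB {d : ℕ} (ε α : ℝ) (ω : Mom d → ℝ) (lam : Mom d → ℂ) (n : ℕ) (z : ℂ)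
    (R : sectorGt d n →L[ℂ] sectorGt d n) : Prop :=
  ∀ F G : sectorGt d n, R G = F ↔ IsB ε α ω lam n F (G + z • F)

/-- `T` is the coupling operator `Cₙ : ℋ_{>n} → ℋₙ`,
`(Cₙ F)(Q) = δ_{|Q|,n} α σ₁ ∫ conj (λ(k)) F(Q ∪ k) dk`. -/
def IsC {d : ℕ} (α : ℝ) (lam : Mom d → ℂ) (n : ℕ)
    (T : sectorGt d n →L[ℂ] sectorEq d n) : Prop :=
  ∀ F : sectorGt d n, ∀ᵐ Q ∂(lebesguePoisson d), (T F : SBSpace d) Q =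
    if Q.card = n then (α : ℂ) • matAct sigma1 (annihilateAct lam (F : SBSpace d) Q) else 0

/-- `T` is the adjoint coupling operator `Cₙ* : ℋₙ → ℋ_{>n}`,
`(Cₙ* F)(Q) = δ_{|Q|,n+1} α σ₁ ∑_{k ∈ Q} λ(k) F(Q ∖ k)`. -/
def IsCStar {d : ℕ} (α : ℝ) (lam : Mom d → ℂ) (n : ℕ)
    (T : sectorEq d n →L[ℂ] sectorGt d n) : Prop :=
  ∀ f : sectorEq d n, ∀ᵐ Q ∂(lebesguePoisson d), (T f : SBSpace d) Q =
    if Q.card = n + 1 then (α : ℂ) • matAct sigma1 (createAct lam (f : SBSpace d) Q) else 0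

/-- The half-plane `D_{n,η} = {z : Re z < λ⁰_{0,n+1} - η}` with `λ⁰_{0,n+1} = -ε + (n+1) κ`. -/
def halfPlane (ε κ η : ℝ) (n : ℕ) : Set ℂ := {z | z.re < -ε + (n + 1) * κ - η}

/-- The kernel `D(Q₁; Q₂; k₁, …, kₘ)` in the coordinates of the points of `Q₁` and `Q₂`. -/
noncomputable def inCoordinates {d m : ℕ} (l : ℕ)
    (D : Config d → Config d → (Fin m → Mom d) → SpinMat)
    (p : (Fin m → Mom d) × (Fin l → Mom d) × (Fin m → Mom d)) : SpinMat :=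
  D (ofTuple p.1) (ofTuple p.2.1) p.2.2

/-- `max_{|β| ≤ 1} |∂^β Φ(p)| ≤ b`, where `∂^β` runs over the partial derivatives of order at
most one in all scalar coordinates of the three groups of variables. -/
def FirstOrderBound {d m l : ℕ}
    (Φ : (Fin m → Mom d) × (Fin l → Mom d) × (Fin m → Mom d) → SpinMat)
    (p : (Fin m → Mom d) × (Fin l → Mom d) × (Fin m → Mom d)) (b : ℝ) : Prop :=
  ‖Φ p‖ ≤ b ∧
  (∀ (i : Fin m) (j : Fin d),
    ‖fderiv ℝ Φ p (Pi.single i (EuclideanSpace.single j (1 : ℝ)), 0, 0)‖ ≤ b) ∧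
  (∀ (i : Fin l) (j : Fin d),
    ‖fderiv ℝ Φ p (0, Pi.single i (EuclideanSpace.single j (1 : ℝ)), 0)‖ ≤ b) ∧
  (∀ (i : Fin m) (j : Fin d),
    ‖fderiv ℝ Φ p (0, 0, Pi.single i (EuclideanSpace.single j (1 : ℝ)))‖ ≤ b)

/-!
The resolvent of `Bₙ` is expanded in a Neumann series in the interaction. With `R₀` the free
resolvent on the sectors with more than `n` bosons, `(Bₙ - z)⁻¹ Cₙ* = ∑ⱼ R₀ (-α V)ʲ Cₙ*`, where `V`
is the field operator (multiplied by `σ₁`) applied after `R₀`. Since `R₀` decays like the inverse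
of the boson number, `V` is bounded, and the series converges for small `α`, uniformly in the half
plane (`exists_operators`, `exists_resolvent`).

Each term is brought into normal order. For a configuration `Q` one sums over the set `T ⊆ Q` of
spectators, which are momenta that the vector `f` sees unchanged; the points of `Q ∖ T` have been
created, and `n - |T|` points of the argument of `f` have been annihilated. The spectators enter
only through the shift `z - ω(T)` of the spectral parameter. The factors `λ` of the external
momenta are split off, so that the remaining kernels `ker` depend on the momenta through the free
energy alone; the factor `|λ|²` of a contracted momentum is absorbed in the finite measure
`coupling`. A further application of the field operator creates a point, contracts an outgoing
momentum with the annihilated one, or annihilates a spectator. This gives a recursion for the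
kernels, `fieldPart`, which is verified in `field_normalAct` and leads to `neumann_term`.

The kernel of the `j`-th term is bounded by `(α ρ)ʲ⁺¹` with a constant `ρ` depending on the number
`m` of incoming momenta and on `η`, because the sum of a number of terms growing with `|Q|` is
compensated by the free resolvent (`inv_level_mul_le`). The same holds for the derivatives: the
gradient of `ω` is bounded by a multiple of `ω - κ + η`, hence by the denominators
(`norm_excessCLM_le`), and a spectator shifts the spectral parameter away from the threshold by its
excess energy `ω - κ` (`dirNorm_spectatorArg_le`). Since `D_{n,m}` contains `2m` external momenta
and every vertex carries at most one of them, only terms of order at least `2m` in `α` contribute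
(`effKer_of_lt`). These are of higher order than `α^{m+1}`, except for the leading term in the case
`m = 1`, which is bounded by `α²/η`; so for `α` small depending on `m` and `η` the kernels have the
size claimed, with a constant independent of `m` and `η`.
-/

/-! ### Matrices -/

/-- Complex `2 × 2` matrices as doubly indexed families. The kernels take values in this type, whose
topology is the one of its norm by definition. -/
abbrev SpinKer : Type := Fin 2 → Fin 2 → ℂ

theorem SpinKer.norm_entry_le (A : SpinKer) (i j : Fin 2) : ‖A i j‖ ≤ ‖A‖ :=
  (norm_le_pi_norm (A i) j).trans (norm_le_pi_norm A i)

theorem SpinKer.norm_le_iff {A : SpinKer} {b : ℝ} (hb : 0 ≤ b) :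
    ‖A‖ ≤ b ↔ ∀ i j, ‖A i j‖ ≤ b := by
  rw [pi_norm_le_iff_of_nonneg hb]
  exact forall_congr' fun i => pi_norm_le_iff_of_nonneg hb

/-- Left multiplication by `σ₁`: the interchange of the two rows. -/
noncomputable def spinFlip : SpinKer →L[ℂ] SpinKer :=
  ContinuousLinearMap.pi fun i => ContinuousLinearMap.proj (Equiv.swap 0 1 i)

theorem spinFlip_apply (A : SpinKer) (i j : Fin 2) :
    spinFlip A i j = A (Equiv.swap 0 1 i) j := rfl

theorem norm_spinFlip (A : SpinKer) : ‖spinFlip A‖ = ‖A‖ := by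
  have key : ∀ B : SpinKer, ‖spinFlip B‖ ≤ ‖B‖ := fun B =>
    (SpinKer.norm_le_iff (norm_nonneg B)).2 fun i j => B.norm_entry_le _ j
  refine le_antisymm (key A) ?_
  have h := key (spinFlip A)
  rwa [show spinFlip (spinFlip A) = A from
    funext fun i => funext fun j => by simp [spinFlip_apply]] at h

/-- The projection of a matrix to its `i`-th row. -/
noncomputable def spinRow (i : Fin 2) : SpinKer →L[ℂ] SpinKer :=
  (ContinuousLinearMap.single ℂ (fun _ : Fin 2 => Fin 2 → ℂ) i).comp
    (ContinuousLinearMap.proj i)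

theorem sum_smul_spinRow_apply (a : Fin 2 → ℂ) (A : SpinKer) (i j : Fin 2) :
    (∑ i, a i • spinRow i A) i j = a i * A i j := by
  fin_cases i <;> simp [spinRow, Fin.sum_univ_two]

theorem norm_sum_spinRow_le {a : Fin 2 → ℂ} {b : ℝ} (hb : ∀ i, ‖a i‖ ≤ b) (A : SpinKer) :
    ‖∑ i, a i • spinRow i A‖ ≤ b * ‖A‖ := by
  have hb0 : 0 ≤ b := (norm_nonneg _).trans (hb 0)
  rw [SpinKer.norm_le_iff (by positivity)]
  intro i j
  rw [sum_smul_spinRow_apply, norm_mul]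
  exact mul_le_mul (hb i) (A.norm_entry_le i j) (norm_nonneg _) hb0

/-- The two eigenvalues `ε`, `-ε` of `ε σ₃`. -/
noncomputable def spinLevel (ε : ℝ) : Fin 2 → ℂ := ![(ε : ℂ), -(ε : ℂ)]

/-- Left multiplication by the matrix `(ε σ₃ + w)⁻¹`. -/
noncomputable def spinResolvent (ε : ℝ) (w : ℂ) (A : SpinKer) : SpinKer :=
  ∑ i, (spinLevel ε i + w)⁻¹ • spinRow i A

theorem spinResolvent_apply (ε : ℝ) (w : ℂ) (A : SpinKer) (i j : Fin 2) :
    spinResolvent ε w A i j = (spinLevel ε i + w)⁻¹ * A i j :=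
  sum_smul_spinRow_apply _ A i j

theorem le_norm_spinLevel_add {ε : ℝ} (hε : 0 < ε) (w : ℂ) (i : Fin 2) :
    w.re - ε ≤ ‖spinLevel ε i + w‖ := by
  refine le_trans ?_ ((le_abs_self _).trans (Complex.abs_re_le_norm _))
  fin_cases i
  · simp [spinLevel]; linarith
  · simp [spinLevel]

theorem norm_inv_spinLevel_add_le {ε : ℝ} (hε : 0 < ε) {w : ℂ} {b : ℝ} (hb : 0 < b)
    (hw : b ≤ w.re - ε) (i : Fin 2) : ‖(spinLevel ε i + w)⁻¹‖ ≤ b⁻¹ := by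
  rw [norm_inv]
  exact inv_anti₀ hb (hw.trans (le_norm_spinLevel_add hε w i))

theorem norm_spinResolvent_le {ε : ℝ} (hε : 0 < ε) {w : ℂ} {b : ℝ} (hb : 0 < b)
    (hw : b ≤ w.re - ε) (A : SpinKer) : ‖spinResolvent ε w A‖ ≤ b⁻¹ * ‖A‖ :=
  norm_sum_spinRow_le (norm_inv_spinLevel_add_le hε hb hw) A

/-! ### Differentiable kernels -/

/-- The data of the model together with a cutoff `η` and a constant `c` controlling the gradient
of the dispersion relation. -/
structure Model (d : ℕ) where
  /-- half the level splitting -/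
  ε : ℝ
  /-- the coupling constant -/
  α : ℝ
  /-- the minimal boson energy -/
  κ : ℝ
  /-- the distance to the threshold -/
  η : ℝ
  /-- a bound for the relative gradient of the dispersion relation -/
  c : ℝ
  /-- the dispersion relation -/
  ω : Mom d → ℝ
  /-- the form factor -/
  lam : Mom d → ℂ
  ε_pos : 0 < ε
  α_nonneg : 0 ≤ α
  κ_pos : 0 < κ
  η_pos : 0 < η
  c_nonneg : 0 ≤ c
  ω_contDiff : ContDiff ℝ 1 ω
  κ_le : ∀ q, κ ≤ ω q
  fderiv_ω_le : ∀ q, ‖fderiv ℝ ω q‖ ≤ c * (ω q - κ + η)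
  lam_continuous : Continuous lam
  lam_memLp : MemLp lam 2 volume

/-- The arguments `(z, x, k)` of a kernel with `l` outgoing momenta `x` and `m` incoming momenta
`k`. -/
abbrev KerArg (d l m : ℕ) : Type := ℂ × (Fin l → Mom d) × (Fin m → Mom d)

namespace Model

variable {d : ℕ} (K : Model d)

/-- The distance of `Re z` to the threshold `-ε + (m + 1) κ`. -/
noncomputable def gap (m : ℕ) (z : ℂ) : ℝ := (m + 1) * K.κ - K.ε - z.re

/-- The domain of the kernels. -/
def dom (l m : ℕ) : Set (KerArg d l m) := {p | p.1 ∈ halfPlane K.ε K.κ K.η m}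

/-- The size of a tangent vector at `p`; the spectral direction is measured relative to the gap. -/
noncomputable def dirNorm {l m : ℕ} (p v : KerArg d l m) : ℝ :=
  ‖v.1‖ / K.gap m p.1 + K.c * (∑ i, ‖v.2.1 i‖ + ∑ i, ‖v.2.2 i‖)

variable {K} in
theorem mem_halfPlane_iff {m : ℕ} {z : ℂ} :
    z ∈ halfPlane K.ε K.κ K.η m ↔ K.η < K.gap m z := by
  simp only [halfPlane, gap, Set.mem_ofPred_eq]
  constructor <;> intro h <;> linarith

variable {K} in
theorem mem_dom_iff {l m : ℕ} {p : KerArg d l m} : p ∈ K.dom l m ↔ K.η < K.gap m p.1 :=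
  mem_halfPlane_iff

theorem isOpen_halfPlane (ε κ η : ℝ) (m : ℕ) : IsOpen (halfPlane ε κ η m) :=
  isOpen_lt Complex.continuous_re continuous_const

theorem isOpen_dom (l m : ℕ) : IsOpen (K.dom l m) :=
  (isOpen_halfPlane _ _ _ _).preimage continuous_fst

theorem convex_dom (l m : ℕ) : Convex ℝ (K.dom l m) := by
  have h : Convex ℝ (halfPlane K.ε K.κ K.η m) := convex_halfSpace_re_lt _
  exact h.linear_preimage (LinearMap.fst ℝ ℂ ((Fin l → Mom d) × (Fin m → Mom d)))

variable {K} in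
theorem gap_pos {l m : ℕ} {p : KerArg d l m} (hp : p ∈ K.dom l m) : 0 < K.gap m p.1 :=
  K.η_pos.trans (mem_dom_iff.1 hp)

variable {K} in
theorem dirNorm_nonneg {l m : ℕ} {p : KerArg d l m} (hp : p ∈ K.dom l m) (v : KerArg d l m) :
    0 ≤ K.dirNorm p v := by
  have := gap_pos hp
  have := K.c_nonneg
  unfold dirNorm
  positivity

/-- A bound for the direction norm in terms of the norm of the tangent vector. -/
noncomputable def dirConst (l m : ℕ) : ℝ := K.η⁻¹ + K.c * (l + m)

variable {K} in
theorem dirNorm_le {l m : ℕ} {p : KerArg d l m} (hp : p ∈ K.dom l m) (v : KerArg d l m) :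
    K.dirNorm p v ≤ K.dirConst l m * ‖v‖ := by
  have h0 := K.η_pos
  have hc := K.c_nonneg
  have h1 : ‖v.1‖ ≤ ‖v‖ := norm_fst_le v
  have h2 : ‖v.2.1‖ ≤ ‖v‖ := (norm_fst_le v.2).trans (norm_snd_le v)
  have h3 : ‖v.2.2‖ ≤ ‖v‖ := (norm_snd_le v.2).trans (norm_snd_le v)
  have h4 : ∑ i, ‖v.2.1 i‖ ≤ l * ‖v‖ := by
    simpa using Finset.sum_le_card_nsmul Finset.univ (fun i => ‖v.2.1 i‖) ‖v‖
      fun i _ => (norm_le_pi_norm v.2.1 i).trans h2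
  have h5 : ∑ i, ‖v.2.2 i‖ ≤ m * ‖v‖ := by
    simpa using Finset.sum_le_card_nsmul Finset.univ (fun i => ‖v.2.2 i‖) ‖v‖
      fun i _ => (norm_le_pi_norm v.2.2 i).trans h3
  have h6 : ‖v.1‖ / K.gap m p.1 ≤ ‖v‖ / K.η :=
    div_le_div₀ (norm_nonneg _) h1 h0 (mem_dom_iff.1 hp).le
  have h7 : K.c * (∑ i, ‖v.2.1 i‖ + ∑ i, ‖v.2.2 i‖) ≤ K.c * (l * ‖v‖ + m * ‖v‖) := by gcongr
  unfold dirNorm dirConst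
  calc _ ≤ ‖v‖ / K.η + K.c * (l * ‖v‖ + m * ‖v‖) := add_le_add h6 h7
    _ = _ := by rw [div_eq_mul_inv]; ring

theorem dirConst_nonneg (l m : ℕ) : 0 ≤ K.dirConst l m := by
  have := K.η_pos
  have := K.c_nonneg
  unfold dirConst
  positivity

/-- `G` is continuously differentiable on the domain with derivative `G'`, which is complex linear
in the spectral parameter; `G` is bounded by `A`, and `G'` is bounded by `B` relative to the
direction norm. -/
structure HasKernelDeriv {l m : ℕ} (G : KerArg d l m → SpinKer)
    (G' : KerArg d l m → KerArg d l m →L[ℝ] SpinKer) (A B : ℝ) : Prop where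
  hasFDerivAt : ∀ p ∈ K.dom l m, HasFDerivAt G (G' p) p
  continuousOn : ContinuousOn G' (K.dom l m)
  norm_le : ∀ p ∈ K.dom l m, ‖G p‖ ≤ A
  deriv_le : ∀ p ∈ K.dom l m, ∀ v, ‖G' p v‖ ≤ B * K.dirNorm p v
  complex : ∀ p ∈ K.dom l m, ∀ ζ : ℂ, G' p (ζ, 0, 0) = ζ • G' p (1, 0, 0)

/-- Bounds for a kernel and its first derivatives. -/
def KernelBound {l m : ℕ} (G : KerArg d l m → SpinKer) (A B : ℝ) : Prop :=
  ∃ G', K.HasKernelDeriv G G' A B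

variable {K} {l m : ℕ}

theorem HasKernelDeriv.opNorm_le {G : KerArg d l m → SpinKer}
    {G' : KerArg d l m → KerArg d l m →L[ℝ] SpinKer} {A B : ℝ} (h : K.HasKernelDeriv G G' A B)
    (hB : 0 ≤ B) {p : KerArg d l m} (hp : p ∈ K.dom l m) : ‖G' p‖ ≤ B * K.dirConst l m := by
  refine ContinuousLinearMap.opNorm_le_bound _ (mul_nonneg hB (K.dirConst_nonneg l m)) fun v => ?_
  rw [mul_assoc]
  exact (h.deriv_le p hp v).trans (mul_le_mul_of_nonneg_left (dirNorm_le hp v) hB)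

theorem KernelBound.continuousOn {G : KerArg d l m → SpinKer} {A B : ℝ}
    (h : K.KernelBound G A B) : ContinuousOn G (K.dom l m) := by
  obtain ⟨G', hG⟩ := h
  exact fun p hp => (hG.hasFDerivAt p hp).continuousAt.continuousWithinAt

theorem KernelBound.norm_le {G : KerArg d l m → SpinKer} {A B : ℝ}
    (h : K.KernelBound G A B) {p : KerArg d l m} (hp : p ∈ K.dom l m) : ‖G p‖ ≤ A := by
  obtain ⟨G', hG⟩ := h
  exact hG.norm_le p hp

theorem KernelBound.contDiffOn {G : KerArg d l m → SpinKer} {A B : ℝ}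
    (h : K.KernelBound G A B) : ContDiffOn ℝ 1 G (K.dom l m) := by
  obtain ⟨G', hG⟩ := h
  have h1 : (1 : WithTop ℕ∞) = 0 + 1 := by simp
  rw [h1, contDiffOn_succ_iff_fderiv_of_isOpen (K.isOpen_dom l m)]
  refine ⟨fun p hp => (hG.hasFDerivAt p hp).differentiableAt.differentiableWithinAt, by simp, ?_⟩
  rw [contDiffOn_zero]
  exact hG.continuousOn.congr fun p hp => (hG.hasFDerivAt p hp).fderiv

theorem KernelBound.mono {G : KerArg d l m → SpinKer} {A B A₁ B₁ : ℝ}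
    (h : K.KernelBound G A B) (hA : A ≤ A₁) (hB : B ≤ B₁) : K.KernelBound G A₁ B₁ := by
  obtain ⟨G', hG⟩ := h
  exact ⟨G', hG.1, hG.2, fun p hp => (hG.norm_le p hp).trans hA, fun p hp v =>
    (hG.deriv_le p hp v).trans (mul_le_mul_of_nonneg_right hB (dirNorm_nonneg hp v)), hG.complex⟩

theorem kernelBound_const (A : SpinKer) : K.KernelBound (fun _ : KerArg d l m => A) ‖A‖ 0 :=
  ⟨fun _ => 0, fun _ _ => hasFDerivAt_const _ _, continuousOn_const, fun _ _ => le_rfl,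
    fun p hp v => by simp, fun p hp ζ => by simp⟩

theorem KernelBound.add {G H : KerArg d l m → SpinKer} {A B A₁ B₁ : ℝ}
    (hG : K.KernelBound G A B) (hH : K.KernelBound H A₁ B₁) :
    K.KernelBound (fun p => G p + H p) (A + A₁) (B + B₁) := by
  obtain ⟨G', hG⟩ := hG
  obtain ⟨H', hH⟩ := hH
  refine ⟨fun p => G' p + H' p, fun p hp => (hG.hasFDerivAt p hp).add (hH.hasFDerivAt p hp),
    hG.continuousOn.add hH.continuousOn, fun p hp => norm_add_le_of_le (hG.norm_le p hp)
    (hH.norm_le p hp), fun p hp v => ?_, fun p hp ζ => ?_⟩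
  · rw [add_mul]
    exact norm_add_le_of_le (hG.deriv_le p hp v) (hH.deriv_le p hp v)
  · simp only [add_apply, hG.complex p hp ζ, hH.complex p hp ζ, smul_add]

theorem kernelBound_sum {ι : Type*} (s : Finset ι) {G : ι → KerArg d l m → SpinKer} {A B : ℝ}
    (hG : ∀ i ∈ s, K.KernelBound (G i) A B) :
    K.KernelBound (fun p => ∑ i ∈ s, G i p) (s.card * A) (s.card * B) := by
  classical
  induction s using Finset.induction_on with
  | empty => simpa using kernelBound_const (K := K) (l := l) (m := m) (0 : SpinKer)
  | insert a s ha ih =>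
    simp only [Finset.sum_insert ha, Finset.card_insert_of_notMem ha]
    convert (hG a (Finset.mem_insert_self a s)).add
      (ih fun i hi => hG i (Finset.mem_insert_of_mem hi)) using 1 <;> push_cast <;> ring

theorem KernelBound.flip {G : KerArg d l m → SpinKer} {A B : ℝ}
    (h : K.KernelBound G A B) : K.KernelBound (fun p => spinFlip (G p)) A B := by
  obtain ⟨G', hG⟩ := h
  refine ⟨fun p => (spinFlip.restrictScalars ℝ).comp (G' p),
    fun p hp => (spinFlip.restrictScalars ℝ).hasFDerivAt.comp p (hG.hasFDerivAt p hp),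
    continuousOn_const.clm_comp hG.continuousOn, fun p hp => ?_, fun p hp v => ?_, fun p hp ζ => ?_⟩
  · rw [norm_spinFlip]; exact hG.norm_le p hp
  · simp only [ContinuousLinearMap.comp_apply, ContinuousLinearMap.coe_restrictScalars',
      norm_spinFlip]
    exact hG.deriv_le p hp v
  · simp [hG.complex p hp ζ]

theorem KernelBound.real_smul {G : KerArg d l m → SpinKer} {A B : ℝ}
    (h : K.KernelBound G A B) (a : ℝ) :
    K.KernelBound (fun p => a • G p) (|a| * A) (|a| * B) := by
  obtain ⟨G', hG⟩ := h
  refine ⟨fun p => a • G' p, fun p hp => (hG.hasFDerivAt p hp).const_smul a,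
    hG.continuousOn.const_smul a, fun p hp => ?_, fun p hp v => ?_, fun p hp ζ => ?_⟩
  · rw [norm_smul, Real.norm_eq_abs]
    exact mul_le_mul_of_nonneg_left (hG.norm_le p hp) (abs_nonneg a)
  · rw [smul_apply, norm_smul, Real.norm_eq_abs, mul_assoc]
    exact mul_le_mul_of_nonneg_left (hG.deriv_le p hp v) (abs_nonneg a)
  · simp only [smul_apply, hG.complex p hp ζ]
    rw [smul_comm]

end Model

/-! ### Operations on kernels -/

namespace Model

variable {d : ℕ} (K : Model d)

/-- The finite measure `|λ(q)|² dq`. -/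
noncomputable def coupling : Measure (Mom d) :=
  volume.withDensity fun q => ((‖K.lam q‖₊ ^ 2 : NNReal) : ℝ≥0∞)

/-- The squared `L²` norm of the form factor. -/
noncomputable def mass : ℝ := ∫ q, ‖K.lam q‖ ^ 2

theorem mass_nonneg : 0 ≤ K.mass := integral_nonneg fun _ => by positivity

theorem integrable_norm_lam_sq : Integrable (fun q => ‖K.lam q‖ ^ 2) volume :=
  (memLp_two_iff_integrable_sq_norm K.lam_memLp.1).1 K.lam_memLp

theorem measurable_nnnorm_lam_sq : Measurable fun q => ‖K.lam q‖₊ ^ 2 :=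
  (K.lam_continuous.nnnorm.pow 2).measurable

theorem coupling_univ : K.coupling Set.univ = ENNReal.ofReal K.mass := by
  rw [coupling, withDensity_apply _ MeasurableSet.univ, Measure.restrict_univ, mass,
    ofReal_integral_eq_lintegral_ofReal K.integrable_norm_lam_sq
      (Eventually.of_forall fun _ => by positivity)]
  refine lintegral_congr fun q => ?_
  rw [ENNReal.ofReal_pow (norm_nonneg _), ofReal_norm, ENNReal.coe_pow]
  rfl

instance : IsFiniteMeasure K.coupling :=
  ⟨by rw [coupling_univ]; exact ENNReal.ofReal_lt_top⟩

theorem coupling_real_univ : K.coupling.real Set.univ = K.mass := by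
  rw [Measure.real, coupling_univ, ENNReal.toReal_ofReal K.mass_nonneg]

theorem integral_coupling {E : Type*} [NormedAddCommGroup E] [NormedSpace ℝ E] (f : Mom d → E) :
    ∫ q, f q ∂K.coupling = ∫ q, (‖K.lam q‖ ^ 2 : ℝ) • f q := by
  rw [coupling, integral_withDensity_eq_integral_smul K.measurable_nnnorm_lam_sq]
  rfl

variable {K} {l m : ℕ}

/-- The linear map that omits the `i`-th outgoing momentum. -/
noncomputable def dropCLM (i : Fin (l + 1)) : KerArg d (l + 1) m →L[ℝ] KerArg d l m :=
  (ContinuousLinearMap.fst ℝ _ _).prod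
    (((ContinuousLinearMap.pi fun j => ContinuousLinearMap.proj (i.succAbove j)).comp
      ((ContinuousLinearMap.fst ℝ _ _).comp (ContinuousLinearMap.snd ℝ _ _))).prod
      ((ContinuousLinearMap.snd ℝ _ _).comp (ContinuousLinearMap.snd ℝ _ _)))

theorem dropCLM_apply (i : Fin (l + 1)) (p : KerArg d (l + 1) m) :
    dropCLM i p = (p.1, i.removeNth p.2.1, p.2.2) := rfl

theorem KernelBound.drop {G : KerArg d l m → SpinKer} {A B : ℝ} (h : K.KernelBound G A B)
    (hB : 0 ≤ B) (i : Fin (l + 1)) :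
    K.KernelBound (fun p : KerArg d (l + 1) m => G (p.1, i.removeNth p.2.1, p.2.2)) A B := by
  obtain ⟨G', hG⟩ := h
  have hmem : ∀ p ∈ K.dom (l + 1) m, dropCLM i p ∈ K.dom l m := fun p hp => hp
  refine ⟨fun p => (G' (dropCLM i p)).comp (dropCLM i),
    fun p hp => (hG.hasFDerivAt _ (hmem p hp)).comp p (dropCLM i).hasFDerivAt,
    (hG.continuousOn.comp (dropCLM i).continuous.continuousOn hmem).clm_comp continuousOn_const,
    fun p hp => hG.norm_le _ (hmem p hp), fun p hp v => ?_, fun p hp ζ => ?_⟩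
  · refine (hG.deriv_le _ (hmem p hp) (dropCLM i v)).trans (mul_le_mul_of_nonneg_left ?_ hB)
    have hc := K.c_nonneg
    have hs : ∑ j, ‖v.2.1 j‖ = ‖v.2.1 i‖ + ∑ j, ‖v.2.1 (i.succAbove j)‖ :=
      Fin.sum_univ_succAbove _ i
    simp only [dirNorm, dropCLM_apply, Fin.removeNth_apply, hs]
    have := norm_nonneg (v.2.1 i)
    gcongr
    linarith
  · have h1 := hG.complex _ (hmem p hp) ζ
    have h0 : i.removeNth (0 : Fin (l + 1) → Mom d) = 0 := rfl
    simpa [dropCLM_apply, ContinuousLinearMap.comp_apply, h0] using h1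

/-- The linear part of the insertion of an outgoing momentum. -/
noncomputable def consCLM : KerArg d l m →L[ℝ] KerArg d (l + 1) m :=
  (ContinuousLinearMap.fst ℝ _ _).prod
    (((ContinuousLinearMap.pi fun j => Fin.cases 0 (fun j => ContinuousLinearMap.proj j) j).comp
      ((ContinuousLinearMap.fst ℝ _ _).comp (ContinuousLinearMap.snd ℝ _ _))).prod
      ((ContinuousLinearMap.snd ℝ _ _).comp (ContinuousLinearMap.snd ℝ _ _)))

theorem consCLM_apply (p : KerArg d l m) :
    consCLM p = (p.1, (Fin.cons 0 p.2.1 : Fin (l + 1) → Mom d), p.2.2) := by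
  refine Prod.ext rfl (Prod.ext (funext fun j => ?_) rfl)
  refine Fin.cases ?_ (fun j => ?_) j <;> rfl

/-- The insertion of an outgoing momentum. -/
def consArg (q : Mom d) (p : KerArg d l m) : KerArg d (l + 1) m :=
  (p.1, Fin.cons q p.2.1, p.2.2)

theorem consArg_eq (q : Mom d) (p : KerArg d l m) :
    consArg q p = consCLM p + ((0 : ℂ), (Fin.cons q 0 : Fin (l + 1) → Mom d), 0) := by
  rw [consCLM_apply]
  refine Prod.ext (by simp [consArg]) (Prod.ext (funext fun j => ?_) (by simp [consArg]))
  refine Fin.cases ?_ (fun j => ?_) j <;> simp [consArg]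

theorem continuous_consArg : Continuous fun r : Mom d × KerArg d l m => consArg r.1 r.2 := by
  unfold consArg
  refine (continuous_fst.comp continuous_snd).prodMk (Continuous.prodMk ?_ ?_)
  · refine continuous_pi fun j => ?_
    refine Fin.cases ?_ (fun j => ?_) j
    · simpa using continuous_fst
    · simp only [Fin.cons_succ]; fun_prop
  · fun_prop

theorem hasFDerivAt_consArg (q : Mom d) (p : KerArg d l m) :
    HasFDerivAt (consArg q) (consCLM : KerArg d l m →L[ℝ] KerArg d (l + 1) m) p := by
  have h : consArg q = fun p : KerArg d l m =>
      consCLM p + ((0 : ℂ), (Fin.cons q 0 : Fin (l + 1) → Mom d), 0) := funext (consArg_eq q)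
  rw [h]
  exact consCLM.hasFDerivAt.add_const _

theorem dirNorm_consArg (q : Mom d) (p v : KerArg d l m) :
    K.dirNorm (consArg q p) (consCLM v) = K.dirNorm p v := by
  simp [dirNorm, consCLM_apply, consArg, Fin.sum_univ_succ]

/-- Contracting an outgoing momentum costs a factor `mass` in both bounds: the gap does not depend
on the outgoing momenta, so the bounds for `G` are uniform in the contracted one. -/
theorem KernelBound.integral {G : KerArg d (l + 1) m → SpinKer} {A B : ℝ}
    (h : K.KernelBound G A B) (hB : 0 ≤ B) :
    K.KernelBound (fun p : KerArg d l m => ∫ q, G (consArg q p) ∂K.coupling)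
      (A * K.mass) (B * K.mass) := by
  obtain ⟨G', hG⟩ := h
  have hmem : ∀ q, ∀ p ∈ K.dom l m, consArg q p ∈ K.dom (l + 1) m := fun q p hp => hp
  have hcq : ∀ p : KerArg d l m, Continuous fun q => consArg q p := fun p =>
    continuous_consArg.comp (continuous_id.prodMk continuous_const)
  have hcp : ∀ q, Continuous fun p : KerArg d l m => consArg q p := fun q =>
    continuous_consArg.comp (continuous_const.prodMk continuous_id)
  have hcont : ContinuousOn G (K.dom (l + 1) m) :=
    fun p hp => (hG.hasFDerivAt p hp).continuousAt.continuousWithinAt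
  have hm1 : ∀ p ∈ K.dom l m, AEStronglyMeasurable (fun q => G (consArg q p)) K.coupling :=
    fun p hp => (hcont.comp_continuous (hcq p) fun q => hmem q p hp).aestronglyMeasurable
  set D : KerArg d l m → Mom d → KerArg d l m →L[ℝ] SpinKer :=
    fun p q => (G' (consArg q p)).comp consCLM with hD
  have hm2 : ∀ p ∈ K.dom l m, AEStronglyMeasurable (D p) K.coupling := fun p hp =>
    ((hG.continuousOn.comp_continuous (hcq p) fun q => hmem q p hp).clm_comp
      continuous_const).aestronglyMeasurable
  have hDv : ∀ p ∈ K.dom l m, ∀ q v, ‖D p q v‖ ≤ B * K.dirNorm p v := fun p hp q v => by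
    rw [← dirNorm_consArg q p v]
    exact hG.deriv_le _ (hmem q p hp) _
  have hDb : ∀ p ∈ K.dom l m, ∀ q, ‖D p q‖ ≤ B * K.dirConst l m := fun p hp q => by
    refine ContinuousLinearMap.opNorm_le_bound _ (mul_nonneg hB (K.dirConst_nonneg l m))
      fun v => ?_
    rw [mul_assoc]
    exact (hDv p hp q v).trans (mul_le_mul_of_nonneg_left (dirNorm_le hp v) hB)
  have hi : ∀ p ∈ K.dom l m, Integrable (D p) K.coupling := fun p hp =>
    (integrable_const (B * K.dirConst l m)).mono' (hm2 p hp) (Eventually.of_forall (hDb p hp))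
  refine ⟨fun p => ∫ q, D p q ∂K.coupling, fun p hp => ?_, ?_, fun p hp => ?_, fun p hp v => ?_,
    fun p hp ζ => ?_⟩
  · refine hasFDerivAt_integral_of_dominated_of_fderiv_le (F := fun p q => G (consArg q p))
      (bound := fun _ => B * K.dirConst l m)
      ((K.isOpen_dom l m).mem_nhds hp) ?_ ?_ (hm2 p hp) ?_ (integrable_const _) ?_
    · filter_upwards [(K.isOpen_dom l m).mem_nhds hp] with p' hp' using hm1 p' hp'
    · exact (integrable_const A).mono' (hm1 p hp)
        (Eventually.of_forall fun q => hG.norm_le _ (hmem q p hp))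
    · exact Eventually.of_forall fun q p' hp' => hDb p' hp' q
    · exact Eventually.of_forall fun q p' hp' =>
        (hG.hasFDerivAt _ (hmem q p' hp')).comp p' (hasFDerivAt_consArg q p')
  · refine continuousOn_of_dominated (bound := fun _ => B * K.dirConst l m) hm2
      (fun p hp => Eventually.of_forall (hDb p hp)) (integrable_const _)
      (Eventually.of_forall fun q => ?_)
    exact (hG.continuousOn.comp (hcp q).continuousOn (hmem q)).clm_comp continuousOn_const
  · have := norm_integral_le_of_norm_le_const (μ := K.coupling) (f := fun q => G (consArg q p))
      (Eventually.of_forall fun q => hG.norm_le _ (hmem q p hp))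
    rwa [coupling_real_univ] at this
  · rw [ContinuousLinearMap.integral_apply (hi p hp)]
    have := norm_integral_le_of_norm_le_const (μ := K.coupling) (f := fun q => D p q v)
      (Eventually.of_forall fun q => hDv p hp q v)
    rw [coupling_real_univ] at this
    linarith
  · rw [ContinuousLinearMap.integral_apply (hi p hp), ContinuousLinearMap.integral_apply (hi p hp),
      ← integral_smul]
    refine integral_congr_ae (Eventually.of_forall fun q => ?_)
    have h0 : (Fin.cons 0 0 : Fin (l + 1) → Mom d) = 0 := by
      ext1 j; refine Fin.cases ?_ (fun j => ?_) j <;> simp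
    simpa [hD, ContinuousLinearMap.comp_apply, consCLM_apply, h0] using
      hG.complex _ (hmem q p hp) ζ

/-- The arguments of a kernel when the first incoming momentum is treated as a spectator. -/
def tailArg (K : Model d) (p : KerArg d l (m + 1)) : KerArg d l m :=
  (p.1 - (K.ω (p.2.2 0) : ℂ), p.2.1, Fin.tail p.2.2)

/-- The linear map that omits the first incoming momentum. -/
noncomputable def dropInCLM : KerArg d l (m + 1) →L[ℝ] KerArg d l m :=
  (ContinuousLinearMap.fst ℝ _ _).prod
    (((ContinuousLinearMap.fst ℝ _ _).comp (ContinuousLinearMap.snd ℝ _ _)).prod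
      ((ContinuousLinearMap.pi fun j => ContinuousLinearMap.proj (Fin.succ j)).comp
        ((ContinuousLinearMap.snd ℝ _ _).comp (ContinuousLinearMap.snd ℝ _ _))))

/-- The first incoming momentum. -/
noncomputable def inMomCLM : KerArg d l (m + 1) →L[ℝ] Mom d :=
  (ContinuousLinearMap.proj (0 : Fin (m + 1))).comp
    ((ContinuousLinearMap.snd ℝ (Fin l → Mom d) (Fin (m + 1) → Mom d)).comp
      (ContinuousLinearMap.snd ℝ ℂ ((Fin l → Mom d) × (Fin (m + 1) → Mom d))))

/-- The derivative of `tailArg`. -/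
noncomputable def tailCLM (K : Model d) (p : KerArg d l (m + 1)) :
    KerArg d l (m + 1) →L[ℝ] KerArg d l m :=
  dropInCLM - (ContinuousLinearMap.inl ℝ ℂ ((Fin l → Mom d) × (Fin m → Mom d))).comp
    (Complex.ofRealCLM.comp ((fderiv ℝ K.ω (p.2.2 0)).comp inMomCLM))

theorem tailCLM_apply (p v : KerArg d l (m + 1)) :
    K.tailCLM p v =
      (v.1 - (fderiv ℝ K.ω (p.2.2 0) (v.2.2 0) : ℂ), v.2.1, Fin.tail v.2.2) := by
  have h : K.tailCLM p v =
    (v.1 - (fderiv ℝ K.ω (p.2.2 0) (v.2.2 0) : ℂ), v.2.1 - 0, Fin.tail v.2.2 - 0) := rfl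
  rw [h, sub_zero, sub_zero]

theorem hasFDerivAt_tailArg (p : KerArg d l (m + 1)) :
    HasFDerivAt K.tailArg (K.tailCLM p) p := by
  have hω : HasFDerivAt K.ω (fderiv ℝ K.ω (inMomCLM p)) (inMomCLM p) :=
    (K.ω_contDiff.differentiable one_ne_zero _).hasFDerivAt
  have h : K.tailArg = fun p : KerArg d l (m + 1) => dropInCLM p -
      ContinuousLinearMap.inl ℝ ℂ ((Fin l → Mom d) × (Fin m → Mom d))
        (Complex.ofRealCLM (K.ω (inMomCLM p))) := by
    funext p
    refine Prod.ext rfl (Prod.ext ?_ ?_)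
    · exact (sub_zero p.2.1).symm
    · exact (sub_zero (Fin.tail p.2.2)).symm
  rw [h]
  exact dropInCLM.hasFDerivAt.sub ((ContinuousLinearMap.hasFDerivAt _).comp p
    (Complex.ofRealCLM.hasFDerivAt.comp p (hω.comp p inMomCLM.hasFDerivAt)))

theorem continuous_fderiv_ω : Continuous (fderiv ℝ K.ω) :=
  K.ω_contDiff.continuous_fderiv one_ne_zero

theorem continuous_tailCLM :
    Continuous (K.tailCLM : KerArg d l (m + 1) → KerArg d l (m + 1) →L[ℝ] KerArg d l m) := by
  have h1 : Continuous fun p : KerArg d l (m + 1) => fderiv ℝ K.ω (p.2.2 0) :=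
    continuous_fderiv_ω.comp (by fun_prop)
  exact continuous_const.sub (continuous_const.clm_comp (continuous_const.clm_comp
    (h1.clm_comp continuous_const)))

theorem gap_tailArg (p : KerArg d l (m + 1)) :
    K.gap m (K.tailArg p).1 = K.gap (m + 1) p.1 + (K.ω (p.2.2 0) - K.κ) := by
  simp [gap, tailArg]; ring

theorem tailArg_mem {p : KerArg d l (m + 1)} (hp : p ∈ K.dom l (m + 1)) :
    K.tailArg p ∈ K.dom l m := by
  rw [mem_dom_iff] at hp ⊢
  rw [gap_tailArg]
  linarith [K.κ_le (p.2.2 0)]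

/-- Turning the first incoming momentum `k` into a spectator adds `c ‖dk‖` times the new gap to the
variation of the spectral parameter, since the gradient of `ω` at `k` is at most `c` times that gap.
This is the contribution of `dk` that `dirNorm` already contains. -/
theorem dirNorm_tailArg_le {p : KerArg d l (m + 1)} (hp : p ∈ K.dom l (m + 1))
    (v : KerArg d l (m + 1)) : K.dirNorm (K.tailArg p) (K.tailCLM p v) ≤ K.dirNorm p v := by
  have hg := gap_pos hp
  have hg1 := mem_dom_iff.1 hp
  have hκ := K.κ_le (p.2.2 0)
  have hc := K.c_nonneg
  have hgt := gap_tailArg (K := K) p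
  set g := K.gap m (K.tailArg p).1
  have hgpos : 0 < g := by linarith
  have hω : ‖fderiv ℝ K.ω (p.2.2 0) (v.2.2 0)‖ ≤ K.c * g * ‖v.2.2 0‖ := by
    refine (ContinuousLinearMap.le_opNorm _ _).trans ?_
    refine mul_le_mul_of_nonneg_right ((K.fderiv_ω_le _).trans ?_) (norm_nonneg _)
    exact mul_le_mul_of_nonneg_left (by linarith) hc
  have h1 : ‖(K.tailCLM p v).1‖ / g ≤ ‖v.1‖ / K.gap (m + 1) p.1 + K.c * ‖v.2.2 0‖ := by
    rw [tailCLM_apply]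
    have h2 : ‖v.1 - (fderiv ℝ K.ω (p.2.2 0) (v.2.2 0) : ℂ)‖ ≤ ‖v.1‖ + K.c * g * ‖v.2.2 0‖ := by
      refine (norm_sub_le _ _).trans (add_le_add le_rfl ?_)
      rwa [Complex.norm_real]
    have h3 : ‖v.1‖ / g ≤ ‖v.1‖ / K.gap (m + 1) p.1 :=
      div_le_div_of_nonneg_left (norm_nonneg _) hg (by linarith)
    calc _ ≤ (‖v.1‖ + K.c * g * ‖v.2.2 0‖) / g := div_le_div_of_nonneg_right h2 hgpos.le
      _ = ‖v.1‖ / g + K.c * ‖v.2.2 0‖ := by field_simp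
      _ ≤ _ := by linarith
  have h4 : ∑ i, ‖v.2.2 i‖ = ‖v.2.2 0‖ + ∑ i, ‖(K.tailCLM p v).2.2 i‖ := by
    rw [tailCLM_apply]; exact Fin.sum_univ_succ _
  have h5 : ∑ i, ‖v.2.1 i‖ = ∑ i, ‖(K.tailCLM p v).2.1 i‖ := by rw [tailCLM_apply]
  unfold dirNorm
  rw [h4, h5]
  linarith

theorem KernelBound.tail {G : KerArg d l m → SpinKer} {A B : ℝ} (h : K.KernelBound G A B)
    (hB : 0 ≤ B) : K.KernelBound (fun p : KerArg d l (m + 1) => G (K.tailArg p)) A B := by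
  obtain ⟨G', hG⟩ := h
  have hct : ContinuousOn K.tailArg (K.dom l (m + 1)) :=
    fun p _ => (hasFDerivAt_tailArg p).continuousAt.continuousWithinAt
  refine ⟨fun p => (G' (K.tailArg p)).comp (K.tailCLM p),
    fun p hp => (hG.hasFDerivAt _ (tailArg_mem hp)).comp p (hasFDerivAt_tailArg p),
    (hG.continuousOn.comp hct fun p hp => tailArg_mem hp).clm_comp continuous_tailCLM.continuousOn,
    fun p hp => hG.norm_le _ (tailArg_mem hp), fun p hp v => ?_, fun p hp ζ => ?_⟩
  · exact (hG.deriv_le _ (tailArg_mem hp) _).trans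
      (mul_le_mul_of_nonneg_left (dirNorm_tailArg_le hp v) hB)
  · have h1 := hG.complex _ (tailArg_mem hp) ζ
    have h0 : Fin.tail (0 : Fin (m + 1) → Mom d) = 0 := rfl
    simpa [ContinuousLinearMap.comp_apply, tailCLM_apply, h0] using h1

end Model

/-! ### The free resolvent of a kernel -/

namespace Model

variable {d : ℕ} {K : Model d} {l m : ℕ}

/-- The free energy of the outgoing momenta relative to the spectral parameter. -/
noncomputable def excess (K : Model d) (p : KerArg d l m) : ℂ :=
  ((∑ i, K.ω (p.2.1 i) : ℝ) : ℂ) - p.1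

/-- The `i`-th outgoing momentum. -/
noncomputable def outMomCLM (i : Fin l) : KerArg d l m →L[ℝ] Mom d :=
  (ContinuousLinearMap.proj i).comp
    ((ContinuousLinearMap.fst ℝ (Fin l → Mom d) (Fin m → Mom d)).comp
      (ContinuousLinearMap.snd ℝ ℂ ((Fin l → Mom d) × (Fin m → Mom d))))

/-- The derivative of `excess`. -/
noncomputable def excessCLM (K : Model d) (p : KerArg d l m) : KerArg d l m →L[ℝ] ℂ :=
  Complex.ofRealCLM.comp (∑ i, (fderiv ℝ K.ω (p.2.1 i)).comp (outMomCLM i)) -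
    ContinuousLinearMap.fst ℝ ℂ _

theorem excessCLM_apply (p v : KerArg d l m) :
    K.excessCLM p v = ((∑ i, fderiv ℝ K.ω (p.2.1 i) (v.2.1 i) : ℝ) : ℂ) - v.1 := by
  simp [excessCLM, outMomCLM]

theorem hasFDerivAt_excess (p : KerArg d l m) : HasFDerivAt K.excess (K.excessCLM p) p := by
  have hω : ∀ i, HasFDerivAt K.ω (fderiv ℝ K.ω (p.2.1 i)) (outMomCLM i p) := fun i =>
    (K.ω_contDiff.differentiable one_ne_zero _).hasFDerivAt
  have h := HasFDerivAt.fun_sum (u := Finset.univ) fun i _ =>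
    (hω i).comp p (outMomCLM (m := m) i).hasFDerivAt
  exact (Complex.ofRealCLM.hasFDerivAt.comp p h).sub
    (ContinuousLinearMap.fst ℝ ℂ ((Fin l → Mom d) × (Fin m → Mom d))).hasFDerivAt

theorem continuous_excessCLM :
    Continuous (K.excessCLM : KerArg d l m → KerArg d l m →L[ℝ] ℂ) := by
  have h1 : ∀ i, Continuous fun p : KerArg d l m => fderiv ℝ K.ω (p.2.1 i) := fun i =>
    continuous_fderiv_ω.comp (by fun_prop)
  exact (continuous_const.clm_comp
    (continuous_finsetSum _ fun i _ => (h1 i).clm_comp continuous_const)).sub continuous_const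

theorem excess_re_sub (p : KerArg d l m) : (K.excess p).re - K.ε =
    ∑ i, (K.ω (p.2.1 i) - K.κ) + ((l : ℝ) - m - 1) * K.κ + K.gap m p.1 := by
  simp only [excess, Complex.sub_re, Complex.ofReal_re, gap, Finset.sum_sub_distrib,
    Finset.sum_const, Finset.card_univ, Fintype.card_fin, nsmul_eq_mul]
  ring

/-- A lower bound for the free resolvent denominators with `l` outgoing and `m` incoming momenta. -/
noncomputable def level (K : Model d) (l m : ℕ) : ℝ := ((l : ℝ) - m - 1) * K.κ + K.η

theorem level_pos (h : m < l) : 0 < K.level l m := by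
  have h1 : (m : ℝ) + 1 ≤ l := by exact_mod_cast h
  have := K.η_pos
  have : 0 ≤ ((l : ℝ) - m - 1) * K.κ := mul_nonneg (by linarith) K.κ_pos.le
  unfold level
  linarith

theorem sum_excess_nonneg (x : Fin l → Mom d) : 0 ≤ ∑ i, (K.ω (x i) - K.κ) :=
  Finset.sum_nonneg fun _ _ => sub_nonneg.2 (K.κ_le _)

theorem level_le {p : KerArg d l m} (hp : p ∈ K.dom l m) :
    K.level l m ≤ (K.excess p).re - K.ε := by
  rw [excess_re_sub, level]
  have := sum_excess_nonneg (K := K) p.2.1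
  have := mem_dom_iff.1 hp
  linarith

/-- The derivative of the free energy is controlled by the denominator of the free resolvent. -/
theorem norm_excessCLM_le (h : m < l) {p : KerArg d l m} (hp : p ∈ K.dom l m)
    (v : KerArg d l m) :
    ‖K.excessCLM p v‖ ≤ ((K.excess p).re - K.ε) * K.dirNorm p v := by
  set β := (K.excess p).re - K.ε with hβ
  have h1 : (m : ℝ) + 1 ≤ l := by exact_mod_cast h
  have h2 : 0 ≤ ((l : ℝ) - m - 1) * K.κ := mul_nonneg (by linarith) K.κ_pos.le
  have hg := mem_dom_iff.1 hp
  have hgp := gap_pos hp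
  have hc := K.c_nonneg
  have hβ0 : 0 < β := (level_pos h).trans_le (level_le hp)
  have hβg : K.gap m p.1 ≤ β := by
    have := sum_excess_nonneg (K := K) p.2.1
    rw [hβ, excess_re_sub]; linarith
  have hβi : ∀ i, K.ω (p.2.1 i) - K.κ + K.η ≤ β := fun i => by
    have := Finset.single_le_sum (f := fun i => K.ω (p.2.1 i) - K.κ)
      (fun i _ => sub_nonneg.2 (K.κ_le _)) (Finset.mem_univ i)
    rw [hβ, excess_re_sub]
    linarith
  have h3 : ‖((∑ i, fderiv ℝ K.ω (p.2.1 i) (v.2.1 i) : ℝ) : ℂ)‖ ≤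
      β * (K.c * ∑ i, ‖v.2.1 i‖) := by
    rw [Complex.norm_real, Finset.mul_sum, Finset.mul_sum]
    refine norm_sum_le_of_le _ fun i _ => (ContinuousLinearMap.le_opNorm _ _).trans ?_
    calc _ ≤ (K.c * β) * ‖v.2.1 i‖ := mul_le_mul_of_nonneg_right
          ((K.fderiv_ω_le _).trans (mul_le_mul_of_nonneg_left (hβi i) hc)) (norm_nonneg _)
      _ = _ := by ring
  have h4 : ‖v.1‖ ≤ β * (‖v.1‖ / K.gap m p.1) := by
    rw [mul_div_assoc', le_div_iff₀ hgp, mul_comm]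
    exact mul_le_mul_of_nonneg_right hβg (norm_nonneg _)
  have h5 : 0 ≤ β * (K.c * ∑ i, ‖v.2.2 i‖) := by positivity
  rw [excessCLM_apply]
  refine (norm_sub_le _ _).trans ((add_le_add h3 h4).trans ?_)
  unfold dirNorm
  linarith

theorem KernelBound.resolvent {G : KerArg d l m → SpinKer} {A B : ℝ} (h : K.KernelBound G A B)
    (hlm : m < l) :
    K.KernelBound (fun p => spinResolvent K.ε (K.excess p) (G p)) ((K.level l m)⁻¹ * A)
      ((K.level l m)⁻¹ * (A + B)) := by
  obtain ⟨G', hG⟩ := h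
  have hb := level_pos (K := K) hlm
  set L : ℂ →L[ℝ] SpinKer →L[ℝ] SpinKer := ContinuousLinearMap.lsmul ℝ ℂ
  set a : Fin 2 → KerArg d l m → ℂ := fun i p => (spinLevel K.ε i + K.excess p)⁻¹ with ha
  set a' : Fin 2 → KerArg d l m → KerArg d l m →L[ℝ] ℂ := fun i p =>
    (-ContinuousLinearMap.mulLeftRight ℝ ℂ (a i p) (a i p)).comp (K.excessCLM p) with ha'
  set row : Fin 2 → SpinKer →L[ℝ] SpinKer := fun i => (spinRow i).restrictScalars ℝ with hrow
  have hre : ∀ p ∈ K.dom l m, 0 < (K.excess p).re - K.ε := fun p hp => hb.trans_le (level_le hp)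
  have hne : ∀ p ∈ K.dom l m, ∀ i, spinLevel K.ε i + K.excess p ≠ 0 := fun p hp i =>
    norm_pos_iff.1 ((hre p hp).trans_le (le_norm_spinLevel_add K.ε_pos _ i))
  have hda : ∀ p ∈ K.dom l m, ∀ i, HasFDerivAt (a i) (a' i p) p := fun p hp i =>
    (hasFDerivAt_inv' (𝕜 := ℝ) (hne p hp i)).comp p ((hasFDerivAt_excess p).const_add _)
  have hca : ∀ i, ContinuousOn (a i) (K.dom l m) := fun i p hp =>
    (hda p hp i).continuousAt.continuousWithinAt
  have hcG : ContinuousOn G (K.dom l m) := fun p hp =>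
    (hG.hasFDerivAt p hp).continuousAt.continuousWithinAt
  have hca' : ∀ i, ContinuousOn (a' i) (K.dom l m) := fun i =>
    ((((ContinuousLinearMap.mulLeftRight ℝ ℂ).continuous.comp_continuousOn (hca i)).clm_apply
      (hca i)).neg).clm_comp continuous_excessCLM.continuousOn
  have ha'v : ∀ p v i, a' i p v = -(a i p * K.excessCLM p v * a i p) := fun p v i => rfl
  set D : KerArg d l m → KerArg d l m →L[ℝ] SpinKer := fun p =>
    ∑ i, (L.precompR (KerArg d l m) (a i p) ((row i).comp (G' p)) +
      L.precompL (KerArg d l m) (a' i p) (row i (G p))) with hD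
  have hDv : ∀ p v, D p v = ∑ i, a i p • spinRow i (G' p v) + ∑ i, a' i p v • spinRow i (G p) := by
    intro p v
    rw [← Finset.sum_add_distrib]
    simp [hD, L, hrow]
  refine ⟨D, fun p hp => ?_, ?_, fun p hp => ?_, fun p hp v => ?_, fun p hp ζ => ?_⟩
  · exact HasFDerivAt.fun_sum fun i _ => L.hasFDerivAt_of_bilinear (hda p hp i)
      ((row i).hasFDerivAt.comp p (hG.hasFDerivAt p hp))
  · refine continuousOn_finsetSum _ fun i _ => ContinuousOn.add ?_ ?_
    · exact ((L.precompR (KerArg d l m)).continuous.comp_continuousOn (hca i)).clm_apply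
        (continuousOn_const.clm_comp hG.continuousOn)
    · exact ((L.precompL (KerArg d l m)).continuous.comp_continuousOn (hca' i)).clm_apply
        ((row i).continuous.comp_continuousOn hcG)
  · exact (norm_spinResolvent_le K.ε_pos hb (level_le hp) _).trans
      (mul_le_mul_of_nonneg_left (hG.norm_le p hp) (inv_nonneg.2 hb.le))
  · have hN := dirNorm_nonneg hp v
    set β := (K.excess p).re - K.ε with hβ
    have hβ0 : 0 < β := hre p hp
    have hab : ∀ i, ‖a i p‖ ≤ β⁻¹ := norm_inv_spinLevel_add_le K.ε_pos hβ0 le_rfl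
    have hββ : β⁻¹ ≤ (K.level l m)⁻¹ := inv_anti₀ hb (level_le hp)
    have h1 : ∀ i, ‖a' i p v‖ ≤ (K.level l m)⁻¹ * K.dirNorm p v := fun i => by
      rw [ha'v, norm_neg, norm_mul, norm_mul]
      calc ‖a i p‖ * ‖K.excessCLM p v‖ * ‖a i p‖ ≤ β⁻¹ * (β * K.dirNorm p v) * β⁻¹ := by
            gcongr
            · exact hab i
            · exact norm_excessCLM_le hlm hp v
            · exact hab i
        _ = β⁻¹ * K.dirNorm p v := by field_simp
        _ ≤ _ := mul_le_mul_of_nonneg_right hββ hN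
    rw [hDv]
    refine (norm_add_le_of_le (norm_sum_spinRow_le (fun i => (hab i).trans hββ) _)
      (norm_sum_spinRow_le h1 _)).trans ?_
    have h2 := hG.deriv_le p hp v
    have h3 := hG.norm_le p hp
    have hb' : 0 ≤ (K.level l m)⁻¹ := inv_nonneg.2 hb.le
    calc _ ≤ (K.level l m)⁻¹ * (B * K.dirNorm p v) + (K.level l m)⁻¹ * K.dirNorm p v * A := by
          gcongr
      _ = _ := by ring
  · have h1 : ∀ i, a' i p (ζ, 0, 0) = ζ * a' i p (1, 0, 0) := fun i => by
      simp only [ha'v, excessCLM_apply]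
      simp
      ring
    rw [hDv, hDv, smul_add, Finset.smul_sum, Finset.smul_sum]
    congr 1
    · refine Finset.sum_congr rfl fun i _ => ?_
      rw [hG.complex p hp ζ, map_smul, smul_comm]
    · refine Finset.sum_congr rfl fun i _ => ?_
      rw [h1, mul_smul]

theorem kernelBound_tsum {G : ℕ → KerArg d l m → SpinKer} {A B : ℕ → ℝ}
    (h : ∀ j, K.KernelBound (G j) (A j) (B j)) (hA : Summable A)
    (hB0 : ∀ j, 0 ≤ B j) (hB : Summable B) :
    K.KernelBound (fun p => ∑' j, G j p) (∑' j, A j) (∑' j, B j) := by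
  choose G' hG using h
  have hop : ∀ j, ∀ p ∈ K.dom l m, ‖G' j p‖ ≤ B j * K.dirConst l m := fun j p hp =>
    (hG j).opNorm_le (hB0 j) hp
  have hs : Summable fun j => B j * K.dirConst l m := hB.mul_right _
  have hsum : ∀ p ∈ K.dom l m, Summable fun j => G j p := fun p hp =>
    Summable.of_norm_bounded hA fun j => (hG j).norm_le p hp
  have hsum' : ∀ p ∈ K.dom l m, Summable fun j => G' j p := fun p hp =>
    Summable.of_norm_bounded hs fun j => hop j p hp
  have hap : ∀ p ∈ K.dom l m, ∀ v, (∑' j, G' j p) v = ∑' j, G' j p v := fun p hp v =>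
    (ContinuousLinearMap.apply ℝ SpinKer v).map_tsum (hsum' p hp)
  refine ⟨fun p => ∑' j, G' j p, fun p hp => ?_, continuousOn_tsum (fun j => (hG j).continuousOn)
    hs hop, fun p hp => ?_, fun p hp v => ?_, fun p hp ζ => ?_⟩
  · exact hasFDerivAt_tsum_of_isPreconnected hs (K.isOpen_dom l m) (K.convex_dom l m).isPreconnected
      (fun j p hp => (hG j).hasFDerivAt p hp) hop hp (hsum p hp) hp
  · exact tsum_of_norm_bounded hA.hasSum fun j => (hG j).norm_le p hp
  · rw [hap p hp, ← tsum_mul_right]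
    exact tsum_of_norm_bounded (hB.mul_right _).hasSum fun j => (hG j).deriv_le p hp v
  · rw [hap p hp, hap p hp, ← tsum_const_smul'']
    exact tsum_congr fun j => (hG j).complex p hp ζ

/-! ### The kernels of the Neumann series -/

/-- The kernel resulting from the creation of one of the outgoing momenta. -/
noncomputable def createPart (G : (l m : ℕ) → KerArg d l m → SpinKer) :
    (l m : ℕ) → KerArg d l m → SpinKer
  | 0, _, _ => 0
  | l + 1, m, p => ∑ i : Fin (l + 1), G l m (p.1, i.removeNth p.2.1, p.2.2)

/-- The kernel resulting from the annihilation of a spectator, which becomes the first incoming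
momentum. -/
noncomputable def tailPart (K : Model d) (G : (l m : ℕ) → KerArg d l m → SpinKer) :
    (l m : ℕ) → KerArg d l m → SpinKer
  | _, 0, _ => 0
  | l, m + 1, p => G l m (K.tailArg p)

/-- The kernel of the field operator composed with the operator of kernel `G`; the integral is the
contribution of the contractions. -/
noncomputable def fieldPart (K : Model d) (G : (l m : ℕ) → KerArg d l m → SpinKer)
    (l m : ℕ) (p : KerArg d l m) : SpinKer :=
  createPart G l m p + ∫ q, G (l + 1) m (consArg q p) ∂K.coupling + K.tailPart G l m p

/-- The unit matrix. -/
def spinOne : SpinKer := fun i j => if i = j then 1 else 0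

/-- The kernel of the `j`-th term of the Neumann series of the resolvent applied to the creation
part of the coupling, after removal of the factors `λ`. -/
noncomputable def ker (K : Model d) : ℕ → (l m : ℕ) → KerArg d l m → SpinKer
  | 0 => fun l m p =>
      if l = 1 ∧ m = 0 then K.α • spinResolvent K.ε (K.excess p) (spinFlip spinOne) else 0
  | j + 1 => fun l m p =>
      if l ≤ m then 0 else
        -K.α • spinResolvent K.ε (K.excess p) (spinFlip (K.fieldPart (K.ker j) l m p))

/-- The kernel of the `j`-th term of the effective operator, without the factors `λ`. -/
noncomputable def effKer (K : Model d) (j m : ℕ) (p : KerArg d m m) : SpinKer :=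
  K.α • spinFlip (K.fieldPart (K.ker j) m m p)

theorem ker_of_le (j : ℕ) (h : l ≤ m) (p : KerArg d l m) : K.ker j l m p = 0 := by
  cases j with
  | zero => rw [ker]; exact if_neg (by omega)
  | succ j => rw [ker]; exact if_pos h

/-- Every external momentum stems from a separate interaction vertex. -/
theorem ker_of_lt (j : ℕ) : ∀ (l m : ℕ) (p : KerArg d l m), j + 1 < l + m → K.ker j l m p = 0 := by
  induction j with
  | zero => intro l m p h; rw [ker]; exact if_neg (by omega)
  | succ j ih =>
    intro l m p h
    have h1 : createPart (K.ker j) l m p = 0 := by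
      cases l with
      | zero => rfl
      | succ l => exact Finset.sum_eq_zero fun i _ => ih _ _ _ (by omega)
    have h2 : K.tailPart (K.ker j) l m p = 0 := by
      cases m with
      | zero => rfl
      | succ m => exact ih _ _ _ (by omega)
    have h3 : ∀ q, K.ker j (l + 1) m (consArg q p) = 0 := fun q => ih _ _ _ (by omega)
    rw [ker]
    simp [fieldPart, h1, h2, h3, spinResolvent]

theorem createPart_ker_self (j : ℕ) (p : KerArg d m m) : createPart (K.ker j) m m p = 0 := by
  cases m with
  | zero => rfl
  | succ m => exact Finset.sum_eq_zero fun i _ => ker_of_le _ (by omega) _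

theorem effKer_of_lt (j : ℕ) (p : KerArg d m m) (h : j + 2 < 2 * m) : K.effKer j m p = 0 := by
  have h2 : K.tailPart (K.ker j) m m p = 0 := by
    cases m with
    | zero => rfl
    | succ m => exact ker_of_lt _ _ _ _ (by omega)
  have h3 : ∀ q, K.ker j (m + 1) m (consArg q p) = 0 := fun q => ker_of_lt _ _ _ _ (by omega)
  simp [effKer, fieldPart, createPart_ker_self, h2, h3]

/-- The rate of the geometric decay of the Neumann series is `α * rate m`. -/
noncomputable def rate (K : Model d) (m : ℕ) : ℝ := (m + 2 + K.mass) / K.η + 1 / K.κ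

theorem rate_pos (m : ℕ) : 0 < K.rate m := by
  have := K.mass_nonneg
  have := K.η_pos
  have := K.κ_pos
  unfold rate
  positivity

theorem rate_mono : Monotone K.rate := by
  intro a b hab
  have := K.η_pos
  have : (a : ℝ) ≤ b := by exact_mod_cast hab
  unfold rate
  gcongr

/-- The number of terms produced by one application of the field operator grows linearly in `l`, and
so does the lower bound for the denominators, since each boson has energy at least `κ`. -/
theorem inv_level_mul_le (h : m < l) : (K.level l m)⁻¹ * (l + 1 + K.mass) ≤ K.rate m := by
  have hb := level_pos (K := K) h
  have hM := K.mass_nonneg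
  have hη := K.η_pos
  have hκ := K.κ_pos
  have h1 : (m : ℝ) + 1 ≤ l := by exact_mod_cast h
  have h1' : 0 ≤ (l : ℝ) - m - 1 := by linarith
  rw [inv_mul_le_iff₀ hb]
  have e : K.level l m * K.rate m = ((l : ℝ) - m - 1) + (m + 2 + K.mass) +
      (((l : ℝ) - m - 1) * K.κ * ((m + 2 + K.mass) / K.η) + K.η / K.κ) := by
    unfold level rate; field_simp; ring
  have : 0 ≤ ((l : ℝ) - m - 1) * K.κ * ((m + 2 + K.mass) / K.η) + K.η / K.κ := by positivity
  rw [e]; linarith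

theorem KernelBound.fieldPart {G : (l m : ℕ) → KerArg d l m → SpinKer} {A B : ℝ} {m : ℕ}
    (h : ∀ m' ≤ m, ∀ l, K.KernelBound (G l m') A B) (hA : 0 ≤ A) (hB : 0 ≤ B) (l : ℕ) :
    K.KernelBound (K.fieldPart G l m) ((l + 1 + K.mass) * A) ((l + 1 + K.mass) * B) := by
  have h1 : K.KernelBound (createPart G l m) (l * A) (l * B) := by
    cases l with
    | zero =>
      have e : createPart G 0 m = fun _ => 0 := rfl
      rw [e]
      simpa using kernelBound_const (K := K) (l := 0) (m := m) (0 : SpinKer)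
    | succ l =>
      have e : createPart G (l + 1) m =
        fun p => ∑ i : Fin (l + 1), G l m (p.1, i.removeNth p.2.1, p.2.2) := rfl
      rw [e]
      simpa using kernelBound_sum Finset.univ fun (i : Fin (l + 1)) _ => (h m le_rfl l).drop hB i
  have h2 : K.KernelBound (K.tailPart G l m) A B := by
    cases m with
    | zero => exact (kernelBound_const (K := K) (l := l) (m := 0) (0 : SpinKer)).mono (by simpa) hB
    | succ m => exact (h m (Nat.le_succ m) l).tail hB
  exact ((h1.add ((h m le_rfl (l + 1)).integral hB)).add h2).mono (by linarith) (by linarith)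

theorem norm_spinOne_le : ‖spinOne‖ ≤ 1 := by
  rw [SpinKer.norm_le_iff zero_le_one]
  intro i j
  unfold spinOne
  split_ifs <;> simp

theorem kernelBound_ker_zero :
    K.KernelBound (K.ker 0 1 0) (K.α / K.η) (K.α / K.η) := by
  have h1 := ((kernelBound_const (K := K) (l := 1) (m := 0) spinOne).mono norm_spinOne_le
    le_rfl).flip.resolvent zero_lt_one
  convert h1.real_smul K.α using 1
  · funext p; simp [ker]
  · simp [level, abs_of_nonneg K.α_nonneg, div_eq_mul_inv]
  · simp [level, abs_of_nonneg K.α_nonneg, div_eq_mul_inv]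

theorem alpha_div_le (m : ℕ) : K.α / K.η ≤ K.α * K.rate m := by
  have := K.mass_nonneg
  have := K.η_pos
  have := K.κ_pos
  have h : 1 / K.η ≤ K.rate m := by
    unfold rate
    have h1 : 1 / K.η ≤ (m + 2 + K.mass) / K.η := by
      gcongr; have : (0 : ℝ) ≤ m := m.cast_nonneg; linarith
    have : 0 < 1 / K.κ := by positivity
    linarith
  calc K.α / K.η = K.α * (1 / K.η) := by ring
    _ ≤ _ := mul_le_mul_of_nonneg_left h K.α_nonneg

theorem kernelBound_ker (j : ℕ) : ∀ l m : ℕ, K.KernelBound (K.ker j l m)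
    ((K.α * K.rate m) ^ (j + 1)) ((j + 1) * (K.α * K.rate m) ^ (j + 1)) := by
  have hα := K.α_nonneg
  have ht : ∀ m, 0 ≤ K.α * K.rate m := fun m => mul_nonneg hα (rate_pos m).le
  induction j with
  | zero =>
    intro l m
    by_cases h : l = 1 ∧ m = 0
    · obtain ⟨rfl, rfl⟩ := h
      exact kernelBound_ker_zero.mono (by simpa using alpha_div_le 0)
        (by simpa using alpha_div_le 0)
    · have : K.ker 0 l m = fun _ => 0 := by funext p; simp [ker, h]
      rw [this]
      exact (kernelBound_const 0).mono (by simpa using ht m) (by simpa using ht m)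
  | succ j ih =>
    intro l m
    have ht' := ht m
    by_cases h : l ≤ m
    · have : K.ker (j + 1) l m = fun _ => 0 := by funext p; simp [ker, h]
      rw [this]
      exact (kernelBound_const 0).mono (by simpa using by positivity) (by positivity)
    · have hlm : m < l := not_le.1 h
      set T := (K.α * K.rate m) ^ (j + 1) with hT
      have hT0 : 0 ≤ T := by positivity
      have hM := K.mass_nonneg
      have h1 : ∀ m' ≤ m, ∀ l, K.KernelBound (K.ker j l m') T ((j + 1) * T) := by
        intro m' hm' l
        have : (K.α * K.rate m') ^ (j + 1) ≤ T :=
          pow_le_pow_left₀ (ht m') (mul_le_mul_of_nonneg_left (rate_mono hm') hα) _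
        exact (ih l m').mono this (by gcongr)
      have h2 := ((KernelBound.fieldPart h1 hT0 (by positivity) l).flip.resolvent hlm).real_smul
        (-K.α)
      have hker : K.ker (j + 1) l m = fun p => -K.α • spinResolvent K.ε (K.excess p)
          (spinFlip (K.fieldPart (K.ker j) l m p)) := by funext p; simp [ker, h]
      have hr := inv_level_mul_le (K := K) hlm
      rw [hker]
      refine h2.mono ?_ ?_
      · rw [abs_neg, abs_of_nonneg hα, pow_succ' _ (j + 1), ← hT]
        calc _ = K.α * ((K.level l m)⁻¹ * (l + 1 + K.mass)) * T := by ring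
          _ ≤ _ := by gcongr
      · rw [abs_neg, abs_of_nonneg hα, pow_succ' _ (j + 1), ← hT]
        calc _ = K.α * ((K.level l m)⁻¹ * (l + 1 + K.mass)) * ((j + 2) * T) := by ring
          _ ≤ K.α * K.rate m * ((j + 2) * T) := by gcongr
          _ = _ := by push_cast; ring

theorem kernelBound_effKer (j m : ℕ) : K.KernelBound (K.effKer j m)
    (K.η * (K.α * K.rate m) ^ (j + 2)) (K.η * ((j + 1) * (K.α * K.rate m) ^ (j + 2))) := by
  have hα := K.α_nonneg
  have hη := K.η_pos
  have hM := K.mass_nonneg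
  have ht : ∀ m, 0 ≤ K.α * K.rate m := fun m => mul_nonneg hα (rate_pos m).le
  have ht' := ht m
  set T := (K.α * K.rate m) ^ (j + 1) with hT
  have hT0 : 0 ≤ T := by positivity
  have h1 : ∀ m' ≤ m, ∀ l, K.KernelBound (K.ker j l m') T ((j + 1) * T) := by
    intro m' hm' l
    have : (K.α * K.rate m') ^ (j + 1) ≤ T :=
      pow_le_pow_left₀ (ht m') (mul_le_mul_of_nonneg_left (rate_mono hm') hα) _
    exact (kernelBound_ker j l m').mono this (by gcongr)
  have hr : (m + 1 + K.mass) ≤ K.η * K.rate m := by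
    have hκ := K.κ_pos
    have e : K.η * K.rate m = m + 2 + K.mass + K.η / K.κ := by unfold rate; field_simp
    have : 0 < K.η / K.κ := by positivity
    linarith
  refine ((KernelBound.fieldPart h1 hT0 (by positivity) m).flip.real_smul K.α).mono ?_ ?_
  · rw [abs_of_nonneg hα, pow_succ' _ (j + 1), ← hT]
    calc _ = K.α * (m + 1 + K.mass) * T := by ring
      _ ≤ K.α * (K.η * K.rate m) * T := by gcongr
      _ = _ := by ring
  · rw [abs_of_nonneg hα, pow_succ' _ (j + 1), ← hT]
    calc _ = K.α * (m + 1 + K.mass) * ((j + 1) * T) := by ring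
      _ ≤ K.α * (K.η * K.rate m) * ((j + 1) * T) := by gcongr
      _ = _ := by ring

/-- The lowest order contribution to the one-boson exchange kernel. -/
theorem kernelBound_effKer_zero_one :
    K.KernelBound (K.effKer 0 1) (K.α ^ 2 / K.η) (K.α ^ 2 / K.η) := by
  have h0 : 0 ≤ K.α / K.η := div_nonneg K.α_nonneg K.η_pos.le
  have h1 := ((kernelBound_ker_zero (K := K)).tail h0).flip.real_smul K.α
  rw [abs_of_nonneg K.α_nonneg, show K.α * (K.α / K.η) = K.α ^ 2 / K.η by ring] at h1
  convert h1 using 1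
  funext p
  have h3 : ∀ q, K.ker 0 2 1 (consArg q p) = 0 := fun q => ker_of_lt _ _ _ _ (by omega)
  simp [effKer, fieldPart, createPart_ker_self, h3, tailPart]

end Model

/-! ### Configurations and tuples -/

section Config

variable {d n : ℕ}

theorem mem_ofTuple {x : Fin n → Mom d} {q : Mom d} : q ∈ ofTuple x ↔ ∃ i, x i = q := by
  simp [ofTuple]

theorem ofTuple_cons (p : Mom d) (x : Fin n → Mom d) :
    ofTuple (Fin.cons p x : Fin (n + 1) → Mom d) = addPoint (ofTuple x) p := by
  ext q
  simp [addPoint, mem_ofTuple, Fin.exists_fin_succ, eq_comm]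

theorem card_ofTuple {x : Fin n → Mom d} (hx : Function.Injective x) : (ofTuple x).card = n := by
  simp [ofTuple, Finset.card_image_of_injective _ hx]

theorem removePoint_ofTuple {x : Fin (n + 1) → Mom d} (hx : Function.Injective x)
    (i : Fin (n + 1)) : removePoint (ofTuple x) (x i) = ofTuple (i.removeNth x) := by
  ext q
  simp only [removePoint, Finset.mem_erase, mem_ofTuple, Fin.removeNth_apply]
  constructor
  · rintro ⟨hq, j, rfl⟩
    obtain ⟨k, rfl⟩ := Fin.exists_succAbove_eq (fun h : j = i => hq (h ▸ rfl))
    exact ⟨k, rfl⟩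
  · rintro ⟨k, rfl⟩
    exact ⟨fun h => Fin.succAbove_ne i k (hx h), _, rfl⟩

theorem exists_ofTuple_eq (Q : Config d) :
    ∃ x : Fin Q.card → Mom d, Function.Injective x ∧ ofTuple x = Q := by
  refine ⟨fun i => (Q.equivFin.symm i : Mom d), fun i j h => ?_, ?_⟩
  · exact Q.equivFin.symm.injective (Subtype.ext h)
  · ext q
    rw [mem_ofTuple]
    constructor
    · rintro ⟨i, rfl⟩
      exact (Q.equivFin.symm i).2
    · intro hq
      exact ⟨Q.equivFin ⟨q, hq⟩, by simp⟩

theorem addTuple_ofTuple {m : ℕ} (x : Fin n → Mom d) (k : Fin m → Mom d) :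
    addTuple (ofTuple x) k = ofTuple (Fin.append x k) := by
  ext q
  simp only [addTuple, Finset.mem_union, mem_ofTuple]
  constructor
  · rintro (⟨i, rfl⟩ | ⟨i, rfl⟩)
    · exact ⟨Fin.castAdd m i, by simp⟩
    · exact ⟨Fin.natAdd n i, by simp⟩
  · rintro ⟨i, rfl⟩
    refine Fin.addCases (fun i => ?_) (fun i => ?_) i
    · exact Or.inl ⟨i, by simp⟩
    · exact Or.inr ⟨i, by simp⟩

theorem sum_ofTuple {E : Type*} [AddCommMonoid E] {x : Fin n → Mom d}
    (hx : Function.Injective x) (f : Mom d → E) : ∑ q ∈ ofTuple x, f q = ∑ i, f (x i) := by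
  classical
  unfold ofTuple
  convert Finset.sum_image (f := f) fun i _ j _ h => hx h

theorem prod_ofTuple {E : Type*} [CommMonoid E] {x : Fin n → Mom d}
    (hx : Function.Injective x) (f : Mom d → E) : ∏ q ∈ ofTuple x, f q = ∏ i, f (x i) := by
  classical
  unfold ofTuple
  convert Finset.prod_image (f := f) fun i _ j _ h => hx h

/-! ### Measure theory of configurations -/

/-- A measurable family of sets of tuples induces a measurable set of configurations. -/
theorem measurableSet_orderings {A : (n : ℕ) → Set (Fin n → Mom d)}
    (hA : ∀ n, MeasurableSet (A n)) :
    MeasurableSet {Q : Config d | ∃ n, ∃ x : Fin n → Mom d,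
      Function.Injective x ∧ ofTuple x = Q ∧ x ∈ A n} := by
  refine MeasurableSpace.measurableSet_iInf.2 fun N => ?_
  have h : (fun y : Fin N → Mom d => ofTuple y) ⁻¹' {Q : Config d | ∃ n, ∃ x : Fin n → Mom d,
      Function.Injective x ∧ ofTuple x = Q ∧ x ∈ A n} = ⋃ n : ℕ, ⋃ s : Fin n → Fin N,
        ({y | ∀ a b, y (s a) = y (s b) → a = b} ∩ {y | ∀ i, ∃ a, y i = y (s a)} ∩
          (fun y => y ∘ s) ⁻¹' A n) := by
    ext y
    simp only [Set.mem_preimage, Set.mem_ofPred_eq, Set.mem_iUnion, Set.mem_inter_iff]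
    constructor
    · rintro ⟨n, x, hx, hxy, hxA⟩
      have h1 : ∀ a, ∃ i, y i = x a := fun a => by
        rw [← mem_ofTuple, ← hxy, mem_ofTuple]
        exact ⟨a, rfl⟩
      choose s hs using h1
      refine ⟨n, s, ⟨fun a b hab => hx (by rw [← hs, ← hs, hab]), fun i => ?_⟩, ?_⟩
      · have : y i ∈ ofTuple x := by rw [hxy, mem_ofTuple]; exact ⟨i, rfl⟩
        obtain ⟨a, ha⟩ := mem_ofTuple.1 this
        exact ⟨a, by rw [hs, ha]⟩
      · rwa [show y ∘ s = x from funext hs]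
    · rintro ⟨n, s, ⟨h1, h2⟩, h3⟩
      refine ⟨n, y ∘ s, fun a b hab => h1 a b hab, ?_, h3⟩
      ext q
      rw [mem_ofTuple, mem_ofTuple]
      constructor
      · rintro ⟨a, rfl⟩
        exact ⟨s a, rfl⟩
      · rintro ⟨i, rfl⟩
        obtain ⟨a, ha⟩ := h2 i
        exact ⟨a, ha.symm⟩
  change MeasurableSet ((fun y : Fin N → Mom d => ofTuple y) ⁻¹' _)
  rw [h]
  refine MeasurableSet.iUnion fun n => MeasurableSet.iUnion fun s =>
    (MeasurableSet.inter ?_ ?_).inter ?_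
  · refine measurableSet_setOfPred.2 (Measurable.forall fun a => Measurable.forall fun b => ?_)
    refine Measurable.imp (measurableSet_setOfPred.1 ?_) measurable_const
    exact measurableSet_eq_fun (measurable_pi_apply _) (measurable_pi_apply _)
  · refine measurableSet_setOfPred.2 (Measurable.forall fun a => Measurable.exists fun b => ?_)
    exact measurableSet_setOfPred.1
      (measurableSet_eq_fun (measurable_pi_apply _) (measurable_pi_apply _))
  · exact (hA n).preimage (measurable_pi_lambda _ fun a => measurable_pi_apply _)

theorem measurePreserving_comp_perm (σ : Equiv.Perm (Fin n)) :
    MeasurePreserving (fun x : Fin n → Mom d => x ∘ σ) volume volume := by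
  have h := volume_measurePreserving_piCongrLeft (fun _ : Fin n => Mom d) σ.symm
  convert h using 1
  funext x i
  have := Equiv.piCongrLeft_apply_apply (fun _ : Fin n => Mom d) σ.symm x (σ i)
  exact (by simpa using this.symm :
    x (σ i) = (Equiv.piCongrLeft (fun _ : Fin n => Mom d) σ.symm) x i)

theorem ae_of_ae_lebesguePoisson {P : Config d → Prop} (h : ∀ᵐ Q ∂(lebesguePoisson d), P Q)
    (n : ℕ) : ∀ᵐ x : Fin n → Mom d, P (ofTuple x) := by
  have h1 := Measure.ae_sum_iff.1 h n
  rw [Measure.ae_ennreal_smul_measure_iff (by simp)] at h1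
  exact ae_of_ae_map (measurable_ofTuple d n).aemeasurable h1

theorem nontrivial_mom (hd : 0 < d) : Nontrivial (Mom d) :=
  ⟨⟨EuclideanSpace.single ⟨0, hd⟩ 1, 0, fun h => by
    simpa using congrArg (fun v : Mom d => v ⟨0, hd⟩) h⟩⟩

/-- Almost every tuple has pairwise distinct entries. -/
theorem ae_injective (hd : 0 < d) (n : ℕ) :
    ∀ᵐ x : Fin n → Mom d, Function.Injective x := by
  have key : ∀ i j : Fin n, i ≠ j → ∀ᵐ x : Fin n → Mom d, x i ≠ x j := by
    intro i j hij
    let S : Submodule ℝ (Fin n → Mom d) :=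
      LinearMap.ker ((LinearMap.proj i : (Fin n → Mom d) →ₗ[ℝ] Mom d) - LinearMap.proj j)
    have hS : S ≠ ⊤ := by
      intro h
      have h1 : (Pi.single i (EuclideanSpace.single ⟨0, hd⟩ (1 : ℝ)) : Fin n → Mom d) ∈ S := by
        rw [h]; trivial
      have h2 := LinearMap.mem_ker.1 h1
      simp [Pi.single_eq_of_ne hij.symm] at h2
    have := Measure.addHaar_submodule (volume : Measure (Fin n → Mom d)) S hS
    rw [ae_iff]
    refine measure_mono_null (fun x hx => ?_) this
    simp only [Set.mem_ofPred_eq, not_not] at hx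
    exact LinearMap.mem_ker.2 (by simp [hx])
  have h2 : ∀ᵐ x : Fin n → Mom d, ∀ i j, i ≠ j → x i ≠ x j := by
    simp only [ae_all_iff]
    exact key
  filter_upwards [h2] with x hx i j hij
  by_contra h
  exact hx i j h hij

/-- The set of configurations with an ordering in a family of null sets is a null set. -/
theorem lebesguePoisson_orderings_eq_zero (hd : 0 < d) {A : (n : ℕ) → Set (Fin n → Mom d)}
    (hA : ∀ n, MeasurableSet (A n)) (h0 : ∀ n, volume (A n) = 0) :
    lebesguePoisson d {Q : Config d | ∃ n, ∃ x : Fin n → Mom d,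
      Function.Injective x ∧ ofTuple x = Q ∧ x ∈ A n} = 0 := by
  have hm := measurableSet_orderings hA
  rw [lebesguePoisson, Measure.sum_apply _ hm, ENNReal.tsum_eq_zero]
  intro n
  rw [Measure.smul_apply, Measure.map_apply (measurable_ofTuple d n) hm]
  refine smul_eq_zero_of_right _ ?_
  have h1 : ∀ᵐ x : Fin n → Mom d, ∀ σ : Equiv.Perm (Fin n), x ∘ σ ∉ A n := by
    rw [ae_all_iff]
    intro σ
    exact (measurePreserving_comp_perm (d := d) σ).quasiMeasurePreserving.ae
      (compl_mem_ae_iff.2 (h0 n))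
  have h2 : ∀ᵐ x : Fin n → Mom d, ¬ ∃ n', ∃ y : Fin n' → Mom d,
      Function.Injective y ∧ ofTuple y = ofTuple x ∧ y ∈ A n' := by
    filter_upwards [h1, ae_injective hd n] with x hx hxi
    rintro ⟨n', y, hy, hyx, hyA⟩
    obtain rfl : n = n' := by rw [← card_ofTuple hxi, ← hyx, card_ofTuple hy]
    have h3 : ∀ a, ∃ i, x i = y a := fun a => by
      rw [← mem_ofTuple, ← hyx, mem_ofTuple]
      exact ⟨a, rfl⟩
    choose s hs using h3
    have hsi : Function.Injective s := fun a b hab => hy (by rw [← hs, ← hs, hab])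
    have hsb : Function.Bijective s := Finite.injective_iff_bijective.1 hsi
    refine hx (Equiv.ofBijective s hsb) ?_
    rwa [show x ∘ (Equiv.ofBijective s hsb) = y from funext hs]
  exact measure_mono_null (fun x hx => by simpa using hx) (ae_iff.1 h2)

/-- A property holds for almost every configuration iff it holds for the configuration of almost
every tuple. -/
theorem ae_lebesguePoisson_iff (hd : 0 < d) {P : Config d → Prop} :
    (∀ᵐ Q ∂(lebesguePoisson d), P Q) ↔ ∀ n, ∀ᵐ x : Fin n → Mom d, P (ofTuple x) := by
  refine ⟨ae_of_ae_lebesguePoisson, fun h => ?_⟩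
  have h0 := lebesguePoisson_orderings_eq_zero hd
    (A := fun n => toMeasurable volume {x : Fin n → Mom d | ¬ P (ofTuple x)})
    (fun n => measurableSet_toMeasurable _ _)
    (fun n => by rw [measure_toMeasurable]; exact ae_iff.1 (h n))
  refine measure_mono_null (fun Q hQ => ?_) h0
  obtain ⟨x, hx, hxQ⟩ := exists_ofTuple_eq Q
  refine ⟨_, x, hx, hxQ, subset_toMeasurable _ _ ?_⟩
  simpa [hxQ] using hQ

theorem aemeasurable_lebesguePoisson (hd : 0 < d) {β : Type*} [MeasurableSpace β]
    {f : Config d → β}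
    (hf : ∀ n, AEMeasurable (fun x : Fin n → Mom d => f (ofTuple x)) volume) :
    AEMeasurable f (lebesguePoisson d) := by
  classical
  choose f' hf' hff' using hf
  set N : (n : ℕ) → Set (Fin n → Mom d) := fun n =>
    toMeasurable volume {x | ¬ f (ofTuple x) = f' n x} with hN
  have hNm : ∀ n, MeasurableSet (N n) := fun n => measurableSet_toMeasurable _ _
  set B : Set (Config d) := {Q | ∃ n, ∃ x : Fin n → Mom d,
      Function.Injective x ∧ ofTuple x = Q ∧ x ∈ N n} with hB
  have hBm : MeasurableSet B := measurableSet_orderings hNm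
  have hB0 : lebesguePoisson d B = 0 := lebesguePoisson_orderings_eq_zero hd hNm
    (fun n => by rw [hN, measure_toMeasurable]; exact ae_iff.1 (hff' n))
  have hval : ∀ n (x : Fin n → Mom d), x ∉ N n → f (ofTuple x) = f' n x := by
    intro n x hx
    by_contra h
    exact hx (subset_toMeasurable _ _ h)
  refine ⟨fun Q => if Q ∈ B then f ∅ else f Q, ?_, ?_⟩
  · intro S hS
    have h : (fun Q => if Q ∈ B then f ∅ else f Q) ⁻¹' S =
        (B ∩ {_Q | f ∅ ∈ S}) ∪ (Bᶜ ∩ {Q | ∃ n, ∃ x : Fin n → Mom d,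
          Function.Injective x ∧ ofTuple x = Q ∧ x ∈ f' n ⁻¹' S}) := by
      ext Q
      by_cases hQ : Q ∈ B
      · simp [hQ]
      · simp only [Set.mem_preimage, hQ, if_false, Set.mem_union, Set.mem_inter_iff, false_and,
          Set.mem_compl_iff, not_false_eq_true, true_and, false_or, Set.mem_ofPred_eq]
        have hx' : ∀ n (x : Fin n → Mom d), Function.Injective x → ofTuple x = Q →
            f Q = f' n x := by
          intro n x hx hxQ
          rw [← hxQ]
          exact hval n x fun hxN => hQ ⟨n, x, hx, hxQ, hxN⟩
        constructor
        · intro hQS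
          obtain ⟨x, hx, hxQ⟩ := exists_ofTuple_eq Q
          exact ⟨_, x, hx, hxQ, by rwa [← hx' _ x hx hxQ]⟩
        · rintro ⟨n, x, hx, hxQ, hxS⟩
          rwa [hx' n x hx hxQ]
    rw [h]
    exact (hBm.inter (by simp)).union
      (hBm.compl.inter (measurableSet_orderings fun n => hf' n hS))
  · have : ∀ᵐ Q ∂(lebesguePoisson d), Q ∉ B := compl_mem_ae_iff.2 hB0
    filter_upwards [this] with Q hQ
    simp [hQ]

theorem aemeasurable_comp_ofTuple {β : Type*} [MeasurableSpace β] {f : Config d → β}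
    (hf : AEMeasurable f (lebesguePoisson d)) (n : ℕ) :
    AEMeasurable (fun x : Fin n → Mom d => f (ofTuple x)) volume :=
  ⟨fun x => hf.mk f (ofTuple x), hf.measurable_mk.comp (measurable_ofTuple d n),
    ae_of_ae_lebesguePoisson hf.ae_eq_mk n⟩

theorem lintegral_lebesguePoisson {f : Config d → ℝ≥0∞}
    (hf : AEMeasurable f (lebesguePoisson d)) :
    ∫⁻ Q, f Q ∂(lebesguePoisson d) =
      ∑' n : ℕ, (n ! : ℝ≥0∞)⁻¹ * ∫⁻ x : Fin n → Mom d, f (ofTuple x) := by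
  have h1 : ∫⁻ Q, f Q ∂(lebesguePoisson d) = ∫⁻ Q, hf.mk f Q ∂(lebesguePoisson d) :=
    lintegral_congr_ae hf.ae_eq_mk
  have h2 : ∫⁻ Q, hf.mk f Q ∂(lebesguePoisson d) = ∑' n : ℕ, ∫⁻ Q, hf.mk f Q
      ∂((n ! : ℝ≥0∞)⁻¹ • Measure.map (fun x : Fin n → Mom d => ofTuple x) volume) :=
    lintegral_sum_measure _ _
  rw [h1, h2]
  refine tsum_congr fun n => ?_
  rw [lintegral_smul_measure, lintegral_map hf.measurable_mk (measurable_ofTuple d n), smul_eq_mul]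
  congr 1
  exact lintegral_congr_ae ((ae_of_ae_lebesguePoisson hf.ae_eq_mk n).mono fun x hx => hx.symm)

/-! ### Adding and removing points -/

theorem measurePreserving_removeNth (i : Fin (n + 1)) :
    MeasurePreserving (fun x : Fin (n + 1) → Mom d => (x i, i.removeNth x)) volume
      (volume.prod volume) :=
  volume_preserving_piFinSuccAbove (fun _ => Mom d) i

theorem measurePreserving_cons :
    MeasurePreserving (fun r : Mom d × (Fin n → Mom d) => (Fin.cons r.1 r.2 : Fin (n + 1) → Mom d))
      (volume.prod volume) volume := by
  have h := (volume_preserving_piFinSuccAbove (fun _ : Fin (n + 1) => Mom d) 0).symm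
  have e : (fun r : Mom d × (Fin n → Mom d) => (Fin.cons r.1 r.2 : Fin (n + 1) → Mom d)) =
      (MeasurableEquiv.piFinSuccAbove (fun _ : Fin (n + 1) => Mom d) 0).symm := by
    funext r
    simp [MeasurableEquiv.piFinSuccAbove_symm_apply, Fin.insertNthEquiv]
  rw [e]
  exact h

theorem lintegral_removeNth (i : Fin (n + 1)) {f : Mom d → (Fin n → Mom d) → ℝ≥0∞}
    (hf : AEMeasurable (Function.uncurry f) (volume.prod volume)) :
    ∫⁻ x : Fin (n + 1) → Mom d, f (x i) (i.removeNth x) = ∫⁻ p, ∫⁻ x, f p x := by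
  have h := measurePreserving_removeNth (d := d) i
  have h1 := lintegral_prod _ hf
  rw [← h.map_eq, lintegral_map' (by rw [h.map_eq]; exact hf) h.measurable.aemeasurable] at h1
  exact h1

theorem lintegral_cons {f : (Fin (n + 1) → Mom d) → ℝ≥0∞} (hf : AEMeasurable f volume) :
    ∫⁻ x : Fin n → Mom d, ∫⁻ p : Mom d, f (Fin.cons p x) = ∫⁻ x, f x := by
  have h := measurePreserving_cons (d := d) (n := n)
  rw [← h.map_eq, lintegral_map' (by rw [h.map_eq]; exact hf) h.measurable.aemeasurable,
    lintegral_prod_symm]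
  exact hf.comp_quasiMeasurePreserving h.quasiMeasurePreserving

theorem ae_notMem (hd : 0 < d) (Q : Config d) : ∀ᵐ p : Mom d, p ∉ Q := by
  have := nontrivial_mom hd
  have h : volume (Q : Set (Mom d)) = 0 := Q.finite_toSet.measure_zero _
  exact compl_mem_ae_iff.2 h

theorem ae_cons {P : (Fin (n + 1) → Mom d) → Prop} (h : ∀ᵐ x, P x) :
    ∀ᵐ x : Fin n → Mom d, ∀ᵐ p : Mom d, P (Fin.cons p x) := by
  have h1 := (measurePreserving_cons (d := d) (n := n)).quasiMeasurePreserving.ae h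
  have h2 := (Measure.measurePreserving_swap (μ := (volume : Measure (Fin n → Mom d)))
    (ν := (volume : Measure (Mom d)))).quasiMeasurePreserving.ae h1
  exact Measure.ae_ae_of_ae_prod h2

theorem ae_addPoint (hd : 0 < d) {P : Config d → Prop} (h : ∀ᵐ Q ∂(lebesguePoisson d), P Q) :
    ∀ᵐ Q ∂(lebesguePoisson d), ∀ᵐ p : Mom d, P (addPoint Q p) := by
  rw [ae_lebesguePoisson_iff hd] at h ⊢
  intro n
  filter_upwards [ae_cons (h (n + 1))] with x hx
  filter_upwards [hx] with p hp
  rwa [ofTuple_cons] at hp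

theorem ae_removeNth {P : (Fin n → Mom d) → Prop} (h : ∀ᵐ x, P x) (i : Fin (n + 1)) :
    ∀ᵐ x : Fin (n + 1) → Mom d, P (i.removeNth x) :=
  (measurePreserving_removeNth (d := d) i).quasiMeasurePreserving.ae
    (Measure.quasiMeasurePreserving_snd.ae h)

theorem ae_removePoint (hd : 0 < d) {P : Config d → Prop} (h : ∀ᵐ Q ∂(lebesguePoisson d), P Q) :
    ∀ᵐ Q ∂(lebesguePoisson d), ∀ q ∈ Q, P (removePoint Q q) := by
  rw [ae_lebesguePoisson_iff hd] at h ⊢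
  intro n
  cases n with
  | zero =>
    refine Eventually.of_forall fun x q hq => ?_
    obtain ⟨i, -⟩ := mem_ofTuple.1 hq
    exact i.elim0
  | succ n =>
    have h1 : ∀ᵐ x : Fin (n + 1) → Mom d, ∀ i : Fin (n + 1), P (ofTuple (i.removeNth x)) :=
      ae_all_iff.2 fun i => ae_removeNth (h n) i
    filter_upwards [h1, ae_injective hd (n + 1)] with x hx hxi q hq
    obtain ⟨i, rfl⟩ := mem_ofTuple.1 hq
    rw [removePoint_ofTuple hxi]
    exact hx i

theorem ae_subset (hd : 0 < d) {P : Config d → Prop} (h : ∀ᵐ Q ∂(lebesguePoisson d), P Q) :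
    ∀ᵐ Q ∂(lebesguePoisson d), ∀ T ⊆ Q, P T := by
  classical
  have h1 : ∀ r : ℕ, ∀ᵐ Q ∂(lebesguePoisson d), ∀ T ⊆ Q, (Q \ T).card = r → P T := by
    intro r
    induction r with
    | zero =>
      filter_upwards [h] with Q hQ T hT hr
      rwa [Finset.Subset.antisymm hT
        (Finset.sdiff_eq_empty_iff_subset.1 (Finset.card_eq_zero.1 hr))]
    | succ r ih =>
      filter_upwards [ae_removePoint hd ih] with Q hQ T hT hr
      obtain ⟨q, hq⟩ : (Q \ T).Nonempty := Finset.card_pos.1 (by omega)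
      rw [Finset.mem_sdiff] at hq
      have e : removePoint Q q \ T = (Q \ T).erase q := by
        ext a
        simp only [removePoint, Finset.mem_sdiff, Finset.mem_erase]
        tauto
      refine hQ q hq.1 T (fun a ha => ?_) ?_
      · exact Finset.mem_erase.2 ⟨fun h => hq.2 (h ▸ ha), hT ha⟩
      · rw [e, Finset.card_erase_of_mem (Finset.mem_sdiff.2 hq), hr]; rfl
  filter_upwards [ae_all_iff.2 h1] with Q hQ T hT using hQ _ T hT rfl

end Config

section SquareIntegrable

variable {d n : ℕ}

theorem eLpNorm_two_sq {X E : Type*} [MeasurableSpace X] [NormedAddCommGroup E] {μ : Measure X}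
    (f : X → E) : eLpNorm f 2 μ ^ 2 = ∫⁻ x, ‖f x‖ₑ ^ 2 ∂μ := by
  rw [eLpNorm_eq_lintegral_rpow_enorm_toReal (by norm_num) (by norm_num), ← ENNReal.rpow_natCast,
    ← ENNReal.rpow_mul]
  simp

theorem memLp_two_iff_lintegral {X E : Type*} [MeasurableSpace X] [NormedAddCommGroup E]
    {μ : Measure X} {f : X → E} (hf : AEStronglyMeasurable f μ) :
    MemLp f 2 μ ↔ ∫⁻ x, ‖f x‖ₑ ^ 2 ∂μ ≠ ∞ := by
  rw [← eLpNorm_two_sq, MemLp, and_iff_right hf]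
  simp [lt_top_iff_ne_top]

theorem memLp_comp_ofTuple {F : Config d → Spin} (hF : MemLp F 2 (lebesguePoisson d)) (n : ℕ) :
    MemLp (fun x : Fin n → Mom d => F (ofTuple x)) 2 volume := by
  have hm := aemeasurable_comp_ofTuple hF.1.aemeasurable n
  rw [memLp_two_iff_lintegral hm.aestronglyMeasurable]
  have h1 := (memLp_two_iff_lintegral hF.1).1 hF
  rw [lintegral_lebesguePoisson (hF.1.enorm.pow_const 2)] at h1
  have h2 := ENNReal.ne_top_of_tsum_ne_top h1 n
  intro h3
  rw [h3, ENNReal.mul_top (by simp)] at h2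
  exact h2 rfl

/-- Almost all sections of a square integrable function on a product are square integrable. -/
theorem ae_memLp_section {X Y E : Type*} [MeasurableSpace X] [MeasurableSpace Y]
    [NormedAddCommGroup E] {μ : Measure X} {ν : Measure Y} [SFinite μ] [SFinite ν] {f : X × Y → E}
    (hf : MemLp f 2 (μ.prod ν)) : ∀ᵐ x ∂μ, MemLp (fun y => f (x, y)) 2 ν := by
  have h1 := (memLp_two_iff_lintegral hf.1).1 hf
  rw [lintegral_prod _ (hf.1.enorm.pow_const 2)] at h1
  have h2 := ae_lt_top' ((hf.1.enorm.pow_const 2).lintegral_prod_right') h1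
  filter_upwards [h2, hf.1.prodMk_left] with x hx hxm
  rw [memLp_two_iff_lintegral hxm]
  exact hx.ne

theorem measurePreserving_append (m : ℕ) :
    MeasurePreserving (fun r : (Fin n → Mom d) × (Fin m → Mom d) => Fin.append r.1 r.2)
      (volume.prod volume) volume := by
  have h1 := volume_measurePreserving_sumPiEquivProdPi_symm (fun _ : Fin n ⊕ Fin m => Mom d)
  have h2 := volume_measurePreserving_piCongrLeft (fun _ : Fin (n + m) => Mom d)
    (finSumFinEquiv (m := n) (n := m))
  have e : (fun r : (Fin n → Mom d) × (Fin m → Mom d) => Fin.append r.1 r.2) =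
      (MeasurableEquiv.piCongrLeft (fun _ : Fin (n + m) => Mom d) finSumFinEquiv) ∘
        (MeasurableEquiv.sumPiEquivProdPi fun _ : Fin n ⊕ Fin m => Mom d).symm := by
    funext r i
    obtain ⟨j, rfl⟩ := (finSumFinEquiv (m := n) (n := m)).surjective i
    rw [Function.comp_apply, MeasurableEquiv.coe_piCongrLeft, Equiv.piCongrLeft_apply_apply]
    cases j with
    | inl j => simp; rfl
    | inr j => simp; rfl
  rw [e]
  exact h2.comp h1

/-- For a square integrable `F` and almost all `Q`, the function `F (Q ∪ ·)` is square
integrable. -/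
theorem ae_memLp_addTuple (hd : 0 < d) {F : Config d → Spin} (hF : MemLp F 2 (lebesguePoisson d))
    (m : ℕ) : ∀ᵐ Q ∂(lebesguePoisson d),
      MemLp (fun k : Fin m → Mom d => F (addTuple Q k)) 2 volume := by
  rw [ae_lebesguePoisson_iff hd]
  intro n
  filter_upwards [ae_memLp_section ((memLp_comp_ofTuple hF (n + m)).comp_measurePreserving
    (measurePreserving_append m))] with x hx
  simpa [addTuple_ofTuple] using hx

theorem ae_memLp_addPoint (hd : 0 < d) {F : Config d → Spin} (hF : MemLp F 2 (lebesguePoisson d)) :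
    ∀ᵐ Q ∂(lebesguePoisson d), MemLp (fun p : Mom d => F (addPoint Q p)) 2 volume := by
  rw [ae_lebesguePoisson_iff hd]
  intro n
  have h := (memLp_comp_ofTuple hF (n + 1)).comp_measurePreserving
    ((measurePreserving_cons (d := d) (n := n)).comp Measure.measurePreserving_swap)
  filter_upwards [ae_memLp_section h] with x hx
  simpa [ofTuple_cons] using hx

/-! ### Creation and annihilation -/

theorem createAct_ofTuple {x : Fin (n + 1) → Mom d} (hx : Function.Injective x) (lam : Mom d → ℂ)
    (F : Config d → Spin) :
    createAct lam F (ofTuple x) = ∑ i : Fin (n + 1), lam (x i) • F (ofTuple (i.removeNth x)) := by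
  rw [createAct, sum_ofTuple hx]
  exact Finset.sum_congr rfl fun i _ => by rw [removePoint_ofTuple hx]

theorem createAct_congr_ae (hd : 0 < d) (lam : Mom d → ℂ) {F G : Config d → Spin}
    (h : F =ᵐ[lebesguePoisson d] G) :
    createAct lam F =ᵐ[lebesguePoisson d] createAct lam G := by
  filter_upwards [ae_removePoint hd h] with Q hQ
  exact Finset.sum_congr rfl fun q hq => by rw [hQ q hq]

theorem annihilateAct_congr_ae (hd : 0 < d) (lam : Mom d → ℂ) {F G : Config d → Spin}
    (h : F =ᵐ[lebesguePoisson d] G) :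
    annihilateAct lam F =ᵐ[lebesguePoisson d] annihilateAct lam G := by
  filter_upwards [ae_addPoint hd h] with Q hQ
  exact integral_congr_ae (hQ.mono fun p hp => by simp only [hp])

theorem aestronglyMeasurable_createAct (hd : 0 < d) {lam : Mom d → ℂ}
    (hlam : Continuous lam) {F : Config d → Spin}
    (hF : AEStronglyMeasurable F (lebesguePoisson d)) :
    AEStronglyMeasurable (createAct lam F) (lebesguePoisson d) := by
  refine (aemeasurable_lebesguePoisson hd fun n => ?_).aestronglyMeasurable
  cases n with
  | zero => exact (measurable_of_finite _).aemeasurable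
  | succ n =>
    have h : AEMeasurable (fun x : Fin (n + 1) → Mom d =>
        ∑ i : Fin (n + 1), lam (x i) • F (ofTuple (i.removeNth x))) volume := by
      refine Finset.aemeasurable_fun_sum _ fun i _ => AEMeasurable.fun_smul ?_ ?_
      · exact (hlam.measurable.comp (measurable_pi_apply i)).aemeasurable
      · exact (aemeasurable_comp_ofTuple hF.aemeasurable n).comp_quasiMeasurePreserving
          (Measure.quasiMeasurePreserving_snd.comp
            (measurePreserving_removeNth (d := d) i).quasiMeasurePreserving)
    exact h.congr ((ae_injective hd (n + 1)).mono fun x hx => (createAct_ofTuple hx lam F).symm)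

theorem aestronglyMeasurable_annihilateAct (hd : 0 < d) {lam : Mom d → ℂ}
    (hlam : Continuous lam) {F : Config d → Spin}
    (hF : AEStronglyMeasurable F (lebesguePoisson d)) :
    AEStronglyMeasurable (annihilateAct lam F) (lebesguePoisson d) := by
  refine (aemeasurable_lebesguePoisson hd fun n => ?_).aestronglyMeasurable
  have h1 : AEStronglyMeasurable (fun r : (Fin n → Mom d) × Mom d =>
      conj (lam r.2) • F (addPoint (ofTuple r.1) r.2)) (volume.prod volume) := by
    refine AEStronglyMeasurable.fun_smul ?_ ?_
    · exact (Complex.continuous_conj.comp (hlam.comp continuous_snd)).aestronglyMeasurable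
    · have := (aemeasurable_comp_ofTuple hF.aemeasurable (n + 1)).comp_quasiMeasurePreserving
        ((measurePreserving_cons (d := d) (n := n)).comp
          Measure.measurePreserving_swap).quasiMeasurePreserving
      refine this.aestronglyMeasurable.congr (Eventually.of_forall fun r => ?_)
      simp [ofTuple_cons]
  exact h1.integral_prod_right'.aemeasurable

theorem enorm_sum_sq_le {E ι : Type*} [NormedAddCommGroup E] (s : Finset ι) (v : ι → E) :
    ‖∑ i ∈ s, v i‖ₑ ^ 2 ≤ s.card * ∑ i ∈ s, ‖v i‖ₑ ^ 2 := by
  have h1 : ∀ w : E, ‖w‖ₑ ^ 2 = ENNReal.ofReal (‖w‖ ^ 2) := fun w => by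
    rw [ENNReal.ofReal_pow (norm_nonneg _), ofReal_norm]
  simp only [h1]
  rw [← ENNReal.ofReal_sum_of_nonneg fun _ _ => by positivity, ← ENNReal.ofReal_natCast,
    ← ENNReal.ofReal_mul (Nat.cast_nonneg _)]
  refine ENNReal.ofReal_le_ofReal ?_
  exact (pow_le_pow_left₀ (norm_nonneg _) (norm_sum_le _ _) 2).trans sq_sum_le_card_mul_sum_sq

theorem lintegral_card_weight {F : Config d → Spin} (hd : 0 < d)
    (hF : AEStronglyMeasurable F (lebesguePoisson d)) :
    ∫⁻ Q, ((Q.card + 1 : ℕ) : ℝ≥0∞) * ‖F Q‖ₑ ^ 2 ∂(lebesguePoisson d) =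
      ∑' n : ℕ, (n ! : ℝ≥0∞)⁻¹ * (((n + 1 : ℕ) : ℝ≥0∞) *
        ∫⁻ x : Fin n → Mom d, ‖F (ofTuple x)‖ₑ ^ 2) := by
  have hc : ∀ n, ∀ᵐ x : Fin n → Mom d, (ofTuple x).card = n := fun n =>
    (ae_injective hd n).mono fun x hx => card_ofTuple hx
  have hw : AEMeasurable (fun Q : Config d => ((Q.card + 1 : ℕ) : ℝ≥0∞)) (lebesguePoisson d) :=
    aemeasurable_lebesguePoisson hd fun n => (aemeasurable_const (b := ((n + 1 : ℕ) : ℝ≥0∞))).congr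
      ((hc n).mono fun x hx => by simp only [hx])
  rw [lintegral_lebesguePoisson (f := fun Q => ((Q.card + 1 : ℕ) : ℝ≥0∞) * ‖F Q‖ₑ ^ 2)
    (hw.fun_mul (hF.enorm.pow_const 2))]
  refine tsum_congr fun n => ?_
  have h : ∫⁻ x : Fin n → Mom d, (((ofTuple x).card + 1 : ℕ) : ℝ≥0∞) * ‖F (ofTuple x)‖ₑ ^ 2 =
      ∫⁻ x : Fin n → Mom d, ((n + 1 : ℕ) : ℝ≥0∞) * ‖F (ofTuple x)‖ₑ ^ 2 :=
    lintegral_congr_ae ((hc n).mono fun x hx => by simp only [hx])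
  rw [h, lintegral_const_mul' _ _ (ENNReal.natCast_ne_top _)]

theorem lintegral_createAct_le (hd : 0 < d) {lam : Mom d → ℂ} (hlam : Continuous lam)
    {F : Config d → Spin} (hF : AEStronglyMeasurable F (lebesguePoisson d)) :
    ∫⁻ Q, ‖createAct lam F Q‖ₑ ^ 2 ∂(lebesguePoisson d) ≤
      eLpNorm lam 2 volume ^ 2 *
        ∫⁻ Q, ((Q.card + 1 : ℕ) : ℝ≥0∞) * ‖F Q‖ₑ ^ 2 ∂(lebesguePoisson d) := by
  rw [lintegral_card_weight hd hF, ← ENNReal.tsum_mul_left, lintegral_lebesguePoisson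
    ((aestronglyMeasurable_createAct hd hlam hF).enorm.pow_const 2), tsum_eq_zero_add']
  · have h0 : ∀ x : Fin 0 → Mom d, createAct lam F (ofTuple x) = 0 := fun x => by
      simp [createAct, ofTuple]
    simp only [h0, enorm_zero, ne_eq, OfNat.ofNat_ne_zero, not_false_eq_true, zero_pow,
      lintegral_zero, mul_zero, zero_add]
    refine ENNReal.tsum_le_tsum fun n => ?_
    have hFm : AEMeasurable (fun x : Fin n → Mom d => ‖F (ofTuple x)‖ₑ ^ 2) volume :=
      (aemeasurable_comp_ofTuple hF.aemeasurable n).enorm.pow_const 2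
    have hlm : Measurable fun p => ‖lam p‖ₑ ^ 2 := (hlam.measurable.enorm).pow_const 2
    have h1 : ∫⁻ x : Fin (n + 1) → Mom d, ‖createAct lam F (ofTuple x)‖ₑ ^ 2 ≤
        ∫⁻ x : Fin (n + 1) → Mom d, ((n + 1 : ℕ) : ℝ≥0∞) *
          ∑ i : Fin (n + 1), ‖lam (x i)‖ₑ ^ 2 * ‖F (ofTuple (i.removeNth x))‖ₑ ^ 2 := by
      refine lintegral_mono_ae ((ae_injective hd (n + 1)).mono fun x hx => ?_)
      rw [createAct_ofTuple hx]
      refine (enorm_sum_sq_le _ _).trans_eq ?_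
      simp [enorm_smul, mul_pow]
    have hprod : AEMeasurable (fun r : Mom d × (Fin n → Mom d) =>
        ‖lam r.1‖ₑ ^ 2 * ‖F (ofTuple r.2)‖ₑ ^ 2) (volume.prod volume) :=
      (hlm.comp measurable_fst).aemeasurable.fun_mul
        (hFm.comp_quasiMeasurePreserving Measure.quasiMeasurePreserving_snd)
    have h2 : ∀ i : Fin (n + 1), ∫⁻ x : Fin (n + 1) → Mom d,
        ‖lam (x i)‖ₑ ^ 2 * ‖F (ofTuple (i.removeNth x))‖ₑ ^ 2 =
        eLpNorm lam 2 volume ^ 2 * ∫⁻ x : Fin n → Mom d, ‖F (ofTuple x)‖ₑ ^ 2 := by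
      intro i
      rw [lintegral_removeNth (f := fun p x => ‖lam p‖ₑ ^ 2 * ‖F (ofTuple x)‖ₑ ^ 2) i hprod,
        eLpNorm_two_sq, ← lintegral_mul_const _ hlm]
      refine lintegral_congr fun p => ?_
      rw [lintegral_const_mul'' _ hFm]
    have hm : ∀ i : Fin (n + 1), AEMeasurable (fun x : Fin (n + 1) → Mom d =>
        ‖lam (x i)‖ₑ ^ 2 * ‖F (ofTuple (i.removeNth x))‖ₑ ^ 2) volume := fun i => by
      have h := (measurePreserving_removeNth (d := d) i).quasiMeasurePreserving
      have h' := AEMeasurable.comp_quasiMeasurePreserving hprod h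
      exact h'
    refine (mul_le_mul_right h1 _).trans_eq ?_
    rw [lintegral_const_mul' _ _ (ENNReal.natCast_ne_top _),
      lintegral_finsetSum' _ fun i _ => hm i]
    simp only [h2, Finset.sum_const, Finset.card_univ, Fintype.card_fin, nsmul_eq_mul]
    have hf : ((n + 1)! : ℝ≥0∞)⁻¹ * ((n + 1 : ℕ) : ℝ≥0∞) = (n ! : ℝ≥0∞)⁻¹ := by
      rw [Nat.factorial_succ, Nat.cast_mul, ENNReal.mul_inv (by simp) (by simp), mul_comm,
        ← mul_assoc, ENNReal.mul_inv_cancel (by simp) (ENNReal.natCast_ne_top _), one_mul]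
    rw [← mul_assoc, hf]
    ring
  · exact ENNReal.summable

theorem enorm_integral_smul_sq_le {X : Type*} [MeasurableSpace X] {μ : Measure X} {a : X → ℂ}
    {F : X → Spin} (ha : AEStronglyMeasurable a μ) (hF : AEStronglyMeasurable F μ) :
    ‖∫ x, a x • F x ∂μ‖ₑ ^ 2 ≤ eLpNorm a 2 μ ^ 2 * ∫⁻ x, ‖F x‖ₑ ^ 2 ∂μ := by
  rw [← eLpNorm_two_sq, ← mul_pow]
  refine pow_le_pow_left₀ zero_le ?_ 2
  refine (enorm_integral_le_lintegral_enorm _).trans ?_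
  rw [← eLpNorm_one_eq_lintegral_enorm]
  have h : eLpNorm (a • F) 1 μ ≤ eLpNorm a 2 μ * eLpNorm F 2 μ :=
    eLpNorm_smul_le_mul_eLpNorm hF ha
  exact h

theorem eLpNorm_conj (lam : Mom d → ℂ) :
    eLpNorm (fun p => conj (lam p)) 2 volume = eLpNorm lam 2 volume :=
  eLpNorm_congr_norm_ae (Eventually.of_forall fun p => by simp)

theorem lintegral_annihilateAct_le (hd : 0 < d) {lam : Mom d → ℂ} (hlam : Continuous lam)
    {F : Config d → Spin} (hF : AEStronglyMeasurable F (lebesguePoisson d)) :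
    ∫⁻ Q, ‖annihilateAct lam F Q‖ₑ ^ 2 ∂(lebesguePoisson d) ≤
      eLpNorm lam 2 volume ^ 2 *
        ∫⁻ Q, ((Q.card + 1 : ℕ) : ℝ≥0∞) * ‖F Q‖ₑ ^ 2 ∂(lebesguePoisson d) := by
  rw [lintegral_card_weight hd hF, ← ENNReal.tsum_mul_left, lintegral_lebesguePoisson
    ((aestronglyMeasurable_annihilateAct hd hlam hF).enorm.pow_const 2)]
  refine le_trans ?_ (ENNReal.tsum_comp_le_tsum_of_injective (add_left_injective 1) _)
  refine ENNReal.tsum_le_tsum fun n => ?_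
  have hFm : AEMeasurable (fun x : Fin (n + 1) → Mom d => F (ofTuple x)) volume :=
    aemeasurable_comp_ofTuple hF.aemeasurable (n + 1)
  have hsec : ∀ᵐ x : Fin n → Mom d, AEStronglyMeasurable
      (fun p : Mom d => F (addPoint (ofTuple x) p)) volume := by
    have := (hFm.comp_quasiMeasurePreserving ((measurePreserving_cons (d := d) (n := n)).comp
          Measure.measurePreserving_swap).quasiMeasurePreserving).aestronglyMeasurable.prodMk_left
    filter_upwards [this] with x hx
    simpa [ofTuple_cons] using hx
  have h1 : ∫⁻ x : Fin n → Mom d, ‖annihilateAct lam F (ofTuple x)‖ₑ ^ 2 ≤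
      ∫⁻ x : Fin n → Mom d, eLpNorm lam 2 volume ^ 2 *
        ∫⁻ p : Mom d, ‖F (ofTuple (Fin.cons p x : Fin (n + 1) → Mom d))‖ₑ ^ 2 := by
    refine lintegral_mono_ae (hsec.mono fun x hx => ?_)
    have := enorm_integral_smul_sq_le (a := fun p => conj (lam p))
      (Complex.continuous_conj.comp hlam).aestronglyMeasurable hx
    rw [eLpNorm_conj] at this
    simpa [annihilateAct, ofTuple_cons] using this
  have h2 : AEMeasurable (fun x : Fin n → Mom d =>
      ∫⁻ p : Mom d, ‖F (ofTuple (Fin.cons p x : Fin (n + 1) → Mom d))‖ₑ ^ 2) volume :=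
    (((hFm.enorm.pow_const 2).comp_quasiMeasurePreserving ((measurePreserving_cons (d := d)
      (n := n)).comp
        Measure.measurePreserving_swap).quasiMeasurePreserving).lintegral_prod_right' :)
  refine (mul_le_mul_right h1 _).trans ?_
  rw [lintegral_const_mul'' _ h2, lintegral_cons (hFm.enorm.pow_const 2)]
  have hf : (n ! : ℝ≥0∞)⁻¹ ≤ ((n + 1)! : ℝ≥0∞)⁻¹ * ((n + 1 + 1 : ℕ) : ℝ≥0∞) := by
    have e : ((n + 1)! : ℝ≥0∞)⁻¹ * ((n + 1 : ℕ) : ℝ≥0∞) = (n ! : ℝ≥0∞)⁻¹ := by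
      rw [Nat.factorial_succ, Nat.cast_mul, ENNReal.mul_inv (by simp) (by simp), mul_comm,
        ← mul_assoc, ENNReal.mul_inv_cancel (by simp) (ENNReal.natCast_ne_top _), one_mul]
    rw [← e]
    gcongr
    simp
  calc (n ! : ℝ≥0∞)⁻¹ * (eLpNorm lam 2 volume ^ 2 * _)
      ≤ (((n + 1)! : ℝ≥0∞)⁻¹ * ((n + 1 + 1 : ℕ) : ℝ≥0∞)) * (eLpNorm lam 2 volume ^ 2 * _) :=
        mul_le_mul_left hf _
    _ = _ := by ring

end SquareIntegrable

/-! ### Bounded operators on the Hilbert space -/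

section Operators

variable {d : ℕ}

theorem matAct_entry (A : SpinMat) (v : Spin) (i : Fin 2) :
    matAct A v i = A i 0 * v 0 + A i 1 * v 1 := by
  change (A.mulVec v.ofLp) i = _
  simp only [Matrix.mulVec, dotProduct, Fin.sum_univ_two]

/-- The action of a matrix on a spin vector as a continuous bilinear map. -/
noncomputable def kerAct : SpinKer →L[ℂ] Spin →L[ℂ] Spin :=
  LinearMap.toContinuousLinearMap
    ((LinearMap.toContinuousLinearMap (𝕜 := ℂ) (E := Spin) (F' := Spin)).toLinearMap ∘ₗ
      LinearMap.mk₂ ℂ (fun (A : SpinKer) (v : Spin) => matAct (Matrix.of A) v)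
        (fun A B v => by
          ext i; simp only [matAct_entry, PiLp.add_apply, Matrix.of_apply, Pi.add_apply]; ring)
        (fun c A v => by
          ext i; simp only [matAct_entry, PiLp.smul_apply, Matrix.of_apply, Pi.smul_apply,
            smul_eq_mul]; ring)
        (fun A v w => by
          ext i; simp only [matAct_entry, PiLp.add_apply, Matrix.of_apply]; ring)
        (fun c A v => by
          ext i; simp only [matAct_entry, PiLp.smul_apply, Matrix.of_apply, smul_eq_mul]; ring))

theorem kerAct_entry (A : SpinKer) (v : Spin) (i : Fin 2) :
    kerAct A v i = A i 0 * v 0 + A i 1 * v 1 := matAct_entry _ v i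

theorem norm_kerAct_le (A : SpinKer) (v : Spin) : ‖kerAct A v‖ ≤ ‖kerAct‖ * ‖A‖ * ‖v‖ :=
  kerAct.le_opNorm₂ A v

theorem kerAct_spinOne (v : Spin) : kerAct Model.spinOne v = v := by
  ext i
  rw [kerAct_entry]
  fin_cases i <;> simp [Model.spinOne]

theorem kerAct_spinFlip (A : SpinKer) (v : Spin) :
    kerAct (spinFlip A) v = matAct sigma1 (kerAct A v) := by
  ext i
  rw [kerAct_entry, matAct_entry, kerAct_entry, kerAct_entry]
  fin_cases i <;> simp [sigma1, spinFlip_apply]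

theorem matAct_sigma1 (v : Spin) : matAct sigma1 v = kerAct (spinFlip Model.spinOne) v := by
  rw [kerAct_spinFlip, kerAct_spinOne]

theorem kerAct_spinResolvent (ε : ℝ) (w : ℂ) (A : SpinKer) (v : Spin) :
    kerAct (spinResolvent ε w A) v = kerAct (spinResolvent ε w Model.spinOne) (kerAct A v) := by
  ext i
  rw [kerAct_entry, kerAct_entry, kerAct_entry, kerAct_entry]
  simp only [spinResolvent_apply]
  fin_cases i <;> simp [Model.spinOne] <;> ring

/-- A map on spin-valued functions that induces a bounded operator of norm at most `c` on the
Hilbert space. -/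
structure IsL2Bounded (Φ : (Config d → Spin) → Config d → Spin) (c : ℝ) : Prop where
  nonneg : 0 ≤ c
  meas : ∀ F, AEStronglyMeasurable F (lebesguePoisson d) →
    AEStronglyMeasurable (Φ F) (lebesguePoisson d)
  bound : ∀ F, AEStronglyMeasurable F (lebesguePoisson d) →
    ∫⁻ Q, ‖Φ F Q‖ₑ ^ 2 ∂(lebesguePoisson d) ≤
      ENNReal.ofReal c ^ 2 * ∫⁻ Q, ‖F Q‖ₑ ^ 2 ∂(lebesguePoisson d)
  congr : ∀ F G, F =ᵐ[lebesguePoisson d] G → Φ F =ᵐ[lebesguePoisson d] Φ G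
  add : ∀ F G, MemLp F 2 (lebesguePoisson d) → MemLp G 2 (lebesguePoisson d) →
    Φ (F + G) =ᵐ[lebesguePoisson d] Φ F + Φ G
  smul : ∀ (a : ℂ) (F), Φ (a • F) =ᵐ[lebesguePoisson d] a • Φ F

namespace IsL2Bounded

variable {Φ : (Config d → Spin) → Config d → Spin} {c : ℝ}

theorem eLpNorm_le (h : IsL2Bounded Φ c) {F : Config d → Spin}
    (hF : AEStronglyMeasurable F (lebesguePoisson d)) :
    eLpNorm (Φ F) 2 (lebesguePoisson d) ≤ ENNReal.ofReal c * eLpNorm F 2 (lebesguePoisson d) := by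
  have h1 := h.bound F hF
  rw [← eLpNorm_two_sq, ← eLpNorm_two_sq, ← mul_pow] at h1
  exact (ENNReal.pow_le_pow_left_iff two_ne_zero).1 h1

theorem memLp (h : IsL2Bounded Φ c) {F : Config d → Spin} (hF : MemLp F 2 (lebesguePoisson d)) :
    MemLp (Φ F) 2 (lebesguePoisson d) :=
  ⟨h.meas F hF.1, (h.eLpNorm_le hF.1).trans_lt (ENNReal.mul_lt_top ENNReal.ofReal_lt_top hF.2)⟩

/-- The bounded operator induced by a map on functions. -/
noncomputable def toCLM (h : IsL2Bounded Φ c) : SBSpace d →L[ℂ] SBSpace d :=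
  LinearMap.mkContinuous
    { toFun := fun F => (h.memLp (Lp.memLp F)).toLp
      map_add' := fun F G => by
        rw [← MemLp.toLp_add]
        refine MemLp.toLp_congr _ _ ?_
        exact (h.congr _ _ (Lp.coeFn_add F G)).trans (h.add _ _ (Lp.memLp F) (Lp.memLp G))
      map_smul' := fun a F => by
        rw [RingHom.id_apply, ← MemLp.toLp_const_smul]
        refine MemLp.toLp_congr _ _ ?_
        exact (h.congr _ _ (Lp.coeFn_smul a F)).trans (h.smul a _) } c fun F => by
      change ‖(h.memLp (Lp.memLp F)).toLp‖ ≤ c * ‖F‖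
      rw [Lp.norm_toLp, Lp.norm_def]
      refine (ENNReal.toReal_mono ?_ (h.eLpNorm_le (Lp.aestronglyMeasurable F))).trans_eq ?_
      · exact ENNReal.mul_ne_top ENNReal.ofReal_ne_top (Lp.eLpNorm_ne_top F)
      · rw [ENNReal.toReal_mul, ENNReal.toReal_ofReal h.nonneg]

theorem toCLM_ae (h : IsL2Bounded Φ c) (F : SBSpace d) :
    h.toCLM F =ᵐ[lebesguePoisson d] Φ F :=
  (h.memLp (Lp.memLp F)).coeFn_toLp

theorem norm_toCLM_le (h : IsL2Bounded Φ c) : ‖h.toCLM‖ ≤ c :=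
  LinearMap.mkContinuous_norm_le _ h.nonneg _

end IsL2Bounded

/-- Multiplication by a bounded matrix-valued function is bounded. -/
theorem isL2Bounded_mul {r : Config d → SpinKer}
    (hr : AEStronglyMeasurable r (lebesguePoisson d)) {b : ℝ} (hb : ∀ Q, ‖r Q‖ ≤ b) :
    IsL2Bounded (fun F Q => kerAct (r Q) (F Q)) (‖kerAct‖ * b) where
  nonneg := mul_nonneg (norm_nonneg kerAct) ((norm_nonneg _).trans (hb ∅))
  meas F hF := kerAct.aestronglyMeasurable_comp₂ hr hF
  bound F hF := by
    have hc : 0 ≤ ‖kerAct‖ * b := mul_nonneg (norm_nonneg kerAct) ((norm_nonneg _).trans (hb ∅))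
    rw [← lintegral_const_mul'' _ (hF.enorm.pow_const 2)]
    refine lintegral_mono fun Q => ?_
    rw [← mul_pow]
    refine pow_le_pow_left₀ zero_le ?_ 2
    rw [← ofReal_norm, ← ofReal_norm, ← ENNReal.ofReal_mul hc]
    refine ENNReal.ofReal_le_ofReal ((norm_kerAct_le _ _).trans ?_)
    gcongr
    exact hb Q
  congr F G h := h.mono fun Q hQ => by simp only [hQ]
  add F G _ _ := Eventually.of_forall fun Q => by simp
  smul a F := Eventually.of_forall fun Q => by simp

theorem aestronglyMeasurable_card_energy (hd : 0 < d) {ω : Mom d → ℝ} (hω : Continuous ω)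
    {E : Type*} [NormedAddCommGroup E] [MeasurableSpace E] [BorelSpace E]
    [SecondCountableTopology E] {g : ℕ → ℝ → E} (hg : ∀ n, Measurable (g n)) :
    AEStronglyMeasurable (fun Q : Config d => g Q.card (energy ω Q)) (lebesguePoisson d) := by
  refine (aemeasurable_lebesguePoisson hd fun n => ?_).aestronglyMeasurable
  have h : Measurable fun x : Fin n → Mom d => g n (∑ i, ω (x i)) :=
    (hg n).comp (Finset.measurable_fun_sum _ fun i _ => hω.measurable.comp (measurable_pi_apply i))
  refine h.aemeasurable.congr ((ae_injective hd n).mono fun x hx => ?_)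
  simp only [energy, sum_ofTuple hx, card_ofTuple hx]

/-- The weight that renders creation and annihilation bounded. -/
noncomputable def cardWeight (Q : Config d) : ℂ := ((Q.card + 1 : ℕ) : ℂ)⁻¹

theorem aestronglyMeasurable_cardWeight (hd : 0 < d) :
    AEStronglyMeasurable (cardWeight : Config d → ℂ) (lebesguePoisson d) :=
  aestronglyMeasurable_card_energy hd (ω := fun _ => 0) continuous_const
    (g := fun n _ => ((n + 1 : ℕ) : ℂ)⁻¹) fun _ => measurable_const

theorem norm_cardWeight_le_one (Q : Config d) : ‖cardWeight Q‖ ≤ 1 := by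
  rw [cardWeight, norm_inv, Complex.norm_natCast]
  refine inv_le_one_of_one_le₀ ?_
  exact_mod_cast Nat.succ_le_succ (Nat.zero_le _)

theorem memLp_cardWeight_smul (hd : 0 < d) {F : Config d → Spin}
    (hF : MemLp F 2 (lebesguePoisson d)) :
    MemLp (fun Q => cardWeight Q • F Q) 2 (lebesguePoisson d) := by
  refine hF.of_le ((aestronglyMeasurable_cardWeight hd).fun_smul hF.1)
    (Eventually.of_forall fun Q => ?_)
  rw [norm_smul]
  exact mul_le_of_le_one_left (norm_nonneg _) (norm_cardWeight_le_one Q)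

theorem lintegral_cardWeight_le (F : Config d → Spin) :
    ∫⁻ Q, ((Q.card + 1 : ℕ) : ℝ≥0∞) * ‖cardWeight Q • F Q‖ₑ ^ 2 ∂(lebesguePoisson d) ≤
      ∫⁻ Q, ‖F Q‖ₑ ^ 2 ∂(lebesguePoisson d) := by
  refine lintegral_mono fun Q => ?_
  rw [enorm_smul, mul_pow, ← mul_assoc]
  refine mul_le_of_le_one_left zero_le ?_
  have h1 : ((Q.card + 1 : ℕ) : ℝ≥0∞) * ‖cardWeight Q‖ₑ = 1 := by
    rw [cardWeight, enorm_inv (by exact_mod_cast Nat.succ_ne_zero Q.card), ← ofReal_norm,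
      Complex.norm_natCast, ENNReal.ofReal_natCast]
    exact ENNReal.mul_inv_cancel (by simp) (ENNReal.natCast_ne_top _)
  rw [pow_two, ← mul_assoc, h1, one_mul, ← ofReal_norm]
  exact ENNReal.ofReal_le_one.2 (norm_cardWeight_le_one Q)

theorem ofReal_l2norm {lam : Mom d → ℂ} (hlam : MemLp lam 2 volume) :
    ENNReal.ofReal (eLpNorm lam 2 volume).toReal = eLpNorm lam 2 volume :=
  ENNReal.ofReal_toReal hlam.2.ne

theorem isL2Bounded_create (hd : 0 < d) {lam : Mom d → ℂ} (hlc : Continuous lam)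
    (hlam : MemLp lam 2 volume) :
    IsL2Bounded (fun F => createAct lam fun Q : Config d => cardWeight Q • F Q)
      (eLpNorm lam 2 volume).toReal where
  nonneg := ENNReal.toReal_nonneg
  meas F hF := aestronglyMeasurable_createAct hd hlc
    ((aestronglyMeasurable_cardWeight hd).fun_smul hF)
  bound F hF := by
    rw [ofReal_l2norm hlam]
    exact (lintegral_createAct_le hd hlc ((aestronglyMeasurable_cardWeight hd).fun_smul hF)).trans
      (mul_le_mul_right (lintegral_cardWeight_le F) _)
  congr F G h := createAct_congr_ae hd lam (h.mono fun Q hQ => by simp only [hQ])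
  add F G _ _ := Eventually.of_forall fun Q => by
    simp only [createAct, Pi.add_apply, smul_add, Finset.sum_add_distrib]
  smul a F := Eventually.of_forall fun Q => by
    simp only [createAct, Pi.smul_apply, Finset.smul_sum]
    refine Finset.sum_congr rfl fun q _ => ?_
    rw [smul_comm (cardWeight _) a, smul_comm _ a]

theorem memLp_conj {lam : Mom d → ℂ} (hlc : Continuous lam) (hlam : MemLp lam 2 volume) :
    MemLp (fun p => conj (lam p)) 2 volume :=
  ⟨(Complex.continuous_conj.comp hlc).aestronglyMeasurable, by rw [eLpNorm_conj]; exact hlam.2⟩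

theorem ae_integrable_annihilate (hd : 0 < d) {lam : Mom d → ℂ} (hlc : Continuous lam)
    (hlam : MemLp lam 2 volume) {F : Config d → Spin} (hF : MemLp F 2 (lebesguePoisson d)) :
    ∀ᵐ Q ∂(lebesguePoisson d), Integrable (fun p : Mom d => conj (lam p) • F (addPoint Q p)) := by
  filter_upwards [ae_memLp_addPoint hd hF] with Q hQ
  have h : MemLp ((fun p => conj (lam p)) • fun p : Mom d => F (addPoint Q p)) 1 volume :=
    hQ.smul (memLp_conj hlc hlam)
  exact memLp_one_iff_integrable.1 h

theorem isL2Bounded_annihilate (hd : 0 < d) {lam : Mom d → ℂ} (hlc : Continuous lam)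
    (hlam : MemLp lam 2 volume) :
    IsL2Bounded (fun F => annihilateAct lam fun Q : Config d => cardWeight Q • F Q)
      (eLpNorm lam 2 volume).toReal where
  nonneg := ENNReal.toReal_nonneg
  meas F hF := aestronglyMeasurable_annihilateAct hd hlc
    ((aestronglyMeasurable_cardWeight hd).fun_smul hF)
  bound F hF := by
    rw [ofReal_l2norm hlam]
    exact (lintegral_annihilateAct_le hd hlc
      ((aestronglyMeasurable_cardWeight hd).fun_smul hF)).trans
      (mul_le_mul_right (lintegral_cardWeight_le F) _)
  congr F G h := annihilateAct_congr_ae hd lam (h.mono fun Q hQ => by simp only [hQ])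
  add F G hF hG := by
    filter_upwards [ae_integrable_annihilate hd hlc hlam (memLp_cardWeight_smul hd hF),
      ae_integrable_annihilate hd hlc hlam (memLp_cardWeight_smul hd hG)] with Q h1 h2
    simp only [annihilateAct, Pi.add_apply, smul_add]
    exact integral_add h1 h2
  smul a F := Eventually.of_forall fun Q => by
    simp only [annihilateAct, Pi.smul_apply]
    rw [← integral_smul]
    refine integral_congr_ae (Eventually.of_forall fun p => ?_)
    simp only
    rw [smul_comm (cardWeight _) a, smul_comm _ a]

end Operators

/-! ### The resolvent -/

namespace Model

variable {d : ℕ} (K : Model d)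

/-- The matrix of the free resolvent on the sectors with more than `n` bosons, as a function of the
boson number and the boson energy. -/
noncomputable def freeRes (n : ℕ) (z : ℂ) (N : ℕ) (e : ℝ) : SpinKer :=
  if n < N then spinResolvent K.ε ((e : ℂ) - z) spinOne else 0

/-- The free resolvent at a configuration. -/
noncomputable def freeResAt (n : ℕ) (z : ℂ) (Q : Config d) : SpinKer :=
  K.freeRes n z Q.card (energy K.ω Q)

theorem measurable_spinResolvent (ε : ℝ) (z : ℂ) :
    Measurable fun e : ℝ => spinResolvent ε ((e : ℂ) - z) spinOne := by
  refine measurable_pi_lambda _ fun i => measurable_pi_lambda _ fun j => ?_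
  simp only [spinResolvent_apply]
  exact (((Complex.measurable_ofReal.sub_const z).const_add _).inv).mul_const _

theorem measurable_freeRes (n : ℕ) (z : ℂ) (N : ℕ) : Measurable (K.freeRes n z N) := by
  unfold freeRes
  split_ifs
  · exact measurable_spinResolvent _ _
  · exact measurable_const

variable {K}

theorem continuous_ω : Continuous K.ω := K.ω_contDiff.continuous

/-- A lower bound for the free energy above the threshold. -/
theorem level_le_energy {n : ℕ} {z : ℂ} (hz : z ∈ halfPlane K.ε K.κ K.η n) (Q : Config d) :
    K.level Q.card n ≤ ((energy K.ω Q : ℂ) - z).re - K.ε := by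
  obtain ⟨x, hx, hxQ⟩ := exists_ofTuple_eq Q
  have h := level_le (K := K) (p := ((z, x, 0) : KerArg d Q.card n)) hz
  have e : energy K.ω Q = ∑ i, K.ω (x i) := by
    conv_lhs => rw [← hxQ]
    exact sum_ofTuple hx _
  rw [e]
  exact h

theorem norm_freeResAt_le {n : ℕ} {z : ℂ} (hz : z ∈ halfPlane K.ε K.κ K.η n) (Q : Config d) :
    (Q.card + 1) * ‖K.freeResAt n z Q‖ ≤ K.rate n := by
  unfold freeResAt freeRes
  split_ifs with h
  · have h1 := norm_spinResolvent_le K.ε_pos (level_pos h) (level_le_energy hz Q) spinOne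
    have h2 := level_pos (K := K) h
    have h3 := inv_level_mul_le (K := K) h
    have hM := K.mass_nonneg
    calc _ ≤ (Q.card + 1 : ℝ) * ((K.level Q.card n)⁻¹ * 1) := by
          gcongr
          refine h1.trans ?_
          gcongr
          exact norm_spinOne_le
      _ ≤ (K.level Q.card n)⁻¹ * (Q.card + 1 + K.mass) := by
          rw [mul_one, mul_comm]
          exact mul_le_mul_of_nonneg_left (by linarith) (inv_nonneg.2 h2.le)
      _ ≤ _ := h3
  · simpa using (rate_pos n).le

theorem norm_freeResAt_le' {n : ℕ} {z : ℂ} (hz : z ∈ halfPlane K.ε K.κ K.η n) (Q : Config d) :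
    ‖K.freeResAt n z Q‖ ≤ K.rate n := by
  refine le_trans ?_ (norm_freeResAt_le hz Q)
  exact le_mul_of_one_le_left (norm_nonneg _) (by linarith [Q.card.cast_nonneg (α := ℝ)])

/-- A bound for the operator norm of the interaction relative to the free resolvent. -/
noncomputable def fieldNorm (K : Model d) (n : ℕ) : ℝ :=
  ‖kerAct‖ * 1 * (2 * (eLpNorm K.lam 2 volume).toReal) * (‖kerAct‖ * K.rate n)

theorem norm_spinFlip_spinOne_le : ‖spinFlip spinOne‖ ≤ 1 := by
  rw [norm_spinFlip]; exact norm_spinOne_le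

theorem aestronglyMeasurable_freeResAt (hd : 0 < d) (n : ℕ) (z : ℂ) :
    AEStronglyMeasurable (K.freeResAt n z) (lebesguePoisson d) :=
  aestronglyMeasurable_card_energy hd continuous_ω (K.measurable_freeRes n z)

theorem aestronglyMeasurable_card (hd : 0 < d) (g : ℕ → SpinKer) :
    AEStronglyMeasurable (fun Q : Config d => g Q.card) (lebesguePoisson d) :=
  aestronglyMeasurable_card_energy hd (ω := fun _ => 0) continuous_const
    (g := fun n _ => g n) fun _ => measurable_const

/-- The free resolvent and the interaction applied to it, as bounded operators. -/
theorem exists_operators (K : Model d) (hd : 0 < d) {n : ℕ} {z : ℂ}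
    (hz : z ∈ halfPlane K.ε K.κ K.η n) :
    ∃ R₀ V : SBSpace d →L[ℂ] SBSpace d,
      (∀ G, R₀ G =ᵐ[lebesguePoisson d] fun Q => kerAct (K.freeResAt n z Q) (G Q)) ∧
      (∀ G, V G =ᵐ[lebesguePoisson d] fun Q => if n < Q.card then
        matAct sigma1 (createAct K.lam (R₀ G) Q + annihilateAct K.lam (R₀ G) Q) else 0) ∧
      ‖V‖ ≤ K.fieldNorm n := by
  have h0 := isL2Bounded_mul (aestronglyMeasurable_freeResAt (K := K) hd n z)
    (norm_freeResAt_le' hz)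
  have h1 := isL2Bounded_mul (d := d) (b := 1)
    (aestronglyMeasurable_card hd fun N => if n < N then spinFlip spinOne else 0)
    (fun Q => by split_ifs; exacts [norm_spinFlip_spinOne_le, by simp])
  have h2 := isL2Bounded_mul (d := d) (b := K.rate n)
    (aestronglyMeasurable_card_energy hd (K.continuous_ω)
      (g := fun N e => ((N + 1 : ℕ) : ℂ) • K.freeRes n z N e)
      fun N => (K.measurable_freeRes n z N).fun_const_smul _)
    (fun Q => by
      rw [norm_smul, Complex.norm_natCast]
      exact_mod_cast norm_freeResAt_le hz Q)
  have hc := isL2Bounded_create hd K.lam_continuous K.lam_memLp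
  have ha := isL2Bounded_annihilate hd K.lam_continuous K.lam_memLp
  refine ⟨h0.toCLM, h1.toCLM ∘L (hc.toCLM + ha.toCLM) ∘L h2.toCLM, h0.toCLM_ae, fun G => ?_, ?_⟩
  · have e1 : (fun Q => cardWeight Q • h2.toCLM G Q) =ᵐ[lebesguePoisson d] h0.toCLM G := by
      filter_upwards [h2.toCLM_ae G, h0.toCLM_ae G] with Q hQ hQ'
      rw [hQ, hQ', map_smul, smul_apply, smul_smul, cardWeight,
        inv_mul_cancel₀ (by exact_mod_cast Nat.succ_ne_zero Q.card), one_smul]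
      rfl
    filter_upwards [h1.toCLM_ae ((hc.toCLM + ha.toCLM) (h2.toCLM G)),
      Lp.coeFn_add (hc.toCLM (h2.toCLM G)) (ha.toCLM (h2.toCLM G)), hc.toCLM_ae (h2.toCLM G),
      ha.toCLM_ae (h2.toCLM G), createAct_congr_ae hd K.lam e1,
      annihilateAct_congr_ae hd K.lam e1] with Q q1 q2 q3 q4 q5 q6
    simp only [ContinuousLinearMap.comp_apply]
    rw [q1, add_apply, q2, Pi.add_apply, q3, q4, q5, q6]
    split_ifs
    · rw [matAct_sigma1]
    · simp
  · have hL : 0 ≤ (eLpNorm K.lam 2 volume).toReal := ENNReal.toReal_nonneg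
    have hr := (rate_pos (K := K) n).le
    have hk : 0 ≤ ‖kerAct‖ := norm_nonneg kerAct
    unfold fieldNorm
    refine (ContinuousLinearMap.opNorm_comp_le _ _).trans ?_
    rw [mul_assoc (‖kerAct‖ * 1)]
    refine mul_le_mul h1.norm_toCLM_le ?_ (norm_nonneg _) (by positivity)
    refine (ContinuousLinearMap.opNorm_comp_le _ _).trans ?_
    refine mul_le_mul ?_ h2.norm_toCLM_le (norm_nonneg _) (by positivity)
    refine (norm_add_le _ _).trans ?_
    linarith [hc.norm_toCLM_le, ha.norm_toCLM_le]

theorem matAct_sigma3_entry (ε : ℝ) (v : Spin) (i : Fin 2) :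
    matAct ((ε : ℂ) • sigma3) v i = spinLevel ε i * v i := by
  rw [matAct_entry]
  fin_cases i <;> simp [sigma3, spinLevel]

theorem kerAct_spinResolvent_entry (ε : ℝ) (w : ℂ) (v : Spin) (i : Fin 2) :
    kerAct (spinResolvent ε w spinOne) v i = (spinLevel ε i + w)⁻¹ * v i := by
  rw [kerAct_entry]
  simp only [spinResolvent_apply]
  fin_cases i <;> simp [spinOne]

theorem spinLevel_add_ne_zero {n : ℕ} {z : ℂ} (hz : z ∈ halfPlane K.ε K.κ K.η n) {Q : Config d}
    (h : n < Q.card) (i : Fin 2) : spinLevel K.ε i + ((energy K.ω Q : ℂ) - z) ≠ 0 :=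
  norm_pos_iff.1 (((level_pos h).trans_le (level_le_energy hz Q)).trans_le
    (le_norm_spinLevel_add K.ε_pos _ i))

/-- The free resolvent inverts the free Hamiltonian. -/
theorem kerAct_freeResAt_eq_iff {n : ℕ} {z : ℂ} (hz : z ∈ halfPlane K.ε K.κ K.η n) {Q : Config d}
    (h : n < Q.card) (v w : Spin) : v = kerAct (K.freeResAt n z Q) w ↔
      matAct ((K.ε : ℂ) • sigma3) v + (energy K.ω Q : ℂ) • v - z • v = w := by
  rw [freeResAt, freeRes, if_pos h]
  constructor
  · rintro rfl
    ext i
    have := spinLevel_add_ne_zero hz h i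
    simp only [PiLp.sub_apply, PiLp.add_apply, PiLp.smul_apply, matAct_sigma3_entry,
      kerAct_spinResolvent_entry, smul_eq_mul]
    field_simp
    ring
  · rintro rfl
    ext i
    have := spinLevel_add_ne_zero hz h i
    simp only [PiLp.sub_apply, PiLp.add_apply, PiLp.smul_apply, matAct_sigma3_entry,
      kerAct_spinResolvent_entry, smul_eq_mul]
    field_simp
    ring

theorem norm_energy_mul_freeResAt_le {n : ℕ} {z : ℂ} (hz : z ∈ halfPlane K.ε K.κ K.η n)
    (Q : Config d) : ‖(energy K.ω Q : ℂ) • K.freeResAt n z Q‖ ≤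
      1 + |K.ε + z.re| * K.rate n := by
  have hr := (rate_pos (K := K) n).le
  by_cases h : n < Q.card
  · have hb : 0 < ((energy K.ω Q : ℂ) - z).re - K.ε := (level_pos h).trans_le (level_le_energy hz Q)
    have h1 := norm_spinResolvent_le K.ε_pos hb le_rfl spinOne
    set b := ((energy K.ω Q : ℂ) - z).re - K.ε with hbdef
    have h2 : energy K.ω Q = b + (K.ε + z.re) := by
      simp only [hbdef, Complex.sub_re, Complex.ofReal_re]; ring
    have h3 : ‖K.freeResAt n z Q‖ ≤ b⁻¹ := by
      rw [freeResAt, freeRes, if_pos h]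
      refine h1.trans (mul_le_of_le_one_right (inv_nonneg.2 hb.le) norm_spinOne_le)
    rw [norm_smul, Complex.norm_real, h2]
    calc ‖b + (K.ε + z.re)‖ * ‖K.freeResAt n z Q‖
        ≤ (b + |K.ε + z.re|) * ‖K.freeResAt n z Q‖ := by
          gcongr
          refine (norm_add_le _ _).trans ?_
          rw [Real.norm_eq_abs, Real.norm_eq_abs, abs_of_pos hb]
      _ = b * ‖K.freeResAt n z Q‖ + |K.ε + z.re| * ‖K.freeResAt n z Q‖ := by ring
      _ ≤ b * b⁻¹ + |K.ε + z.re| * K.rate n := by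
          gcongr
          exact norm_freeResAt_le' hz Q
      _ = _ := by rw [mul_inv_cancel₀ hb.ne']
  · rw [freeResAt, freeRes, if_neg h, smul_zero, norm_zero]
    positivity

theorem mem_sectorGt_iff {n : ℕ} {F : SBSpace d} :
    F ∈ sectorGt d n ↔ ∀ᵐ Q ∂(lebesguePoisson d), ¬ n < Q.card → F Q = 0 := Iff.rfl

theorem mem_sectorEq_iff {n : ℕ} {F : SBSpace d} :
    F ∈ sectorEq d n ↔ ∀ᵐ Q ∂(lebesguePoisson d), Q.card ≠ n → F Q = 0 := Iff.rfl

/-- The resolvent of `Bₙ` for small coupling, given by its Neumann series. -/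
theorem exists_resolvent (hd : 0 < d) {n : ℕ} {z : ℂ}
    (hz : z ∈ halfPlane K.ε K.κ K.η n) (hα : K.α * K.fieldNorm n < 1)
    {R₀ V : SBSpace d →L[ℂ] SBSpace d}
    (hR₀ : ∀ G, R₀ G =ᵐ[lebesguePoisson d] fun Q => kerAct (K.freeResAt n z Q) (G Q))
    (hV : ∀ G, V G =ᵐ[lebesguePoisson d] fun Q => if n < Q.card then
        matAct sigma1 (createAct K.lam (R₀ G) Q + annihilateAct K.lam (R₀ G) Q) else 0)
    (hVn : ‖V‖ ≤ K.fieldNorm n) :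
    ∃ R : sectorGt d n →L[ℂ] sectorGt d n, IsResolventB K.ε K.α K.ω K.lam n z R ∧
      ∀ G : sectorGt d n,
        HasSum (fun j : ℕ => R₀ (((-(K.α : ℂ) • V) ^ j) (G : SBSpace d))) (R G : SBSpace d) := by
  set T : SBSpace d →L[ℂ] SBSpace d := -(K.α : ℂ) • V with hT
  have hTn : ‖T‖ < 1 := by
    rw [hT, norm_smul, norm_neg, Complex.norm_real, Real.norm_eq_abs, abs_of_nonneg K.α_nonneg]
    exact (mul_le_mul_of_nonneg_left hVn K.α_nonneg).trans_lt hα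
  have hsum : Summable fun j : ℕ => T ^ j := summable_geometric_of_norm_lt_one hTn
  set S := ∑' j : ℕ, T ^ j with hS
  have hS1 : ∀ G, S G = G + T (S G) := by
    intro G
    have h : (1 - T) * S = 1 := mul_neg_geom_series T hTn
    have h' := congrArg (fun A : SBSpace d →L[ℂ] SBSpace d => A G) h
    simp only [mul_apply_eq_comp, sub_apply, one_apply_eq_self] at h'
    exact eq_add_of_sub_eq h'
  have hS2 : ∀ G G' : SBSpace d, G' = G + T G' → G' = S G := by
    intro G G' hG
    have h : S * (1 - T) = 1 := geom_series_mul_neg T hTn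
    have h' := congrArg (fun A : SBSpace d →L[ℂ] SBSpace d => A G') h
    simp only [mul_apply_eq_comp, sub_apply, one_apply_eq_self] at h'
    rw [sub_eq_iff_eq_add.2 hG] at h'
    exact h'.symm
  have hR₀m : ∀ G, R₀ G ∈ sectorGt d n := fun G => by
    rw [mem_sectorGt_iff]
    filter_upwards [hR₀ G] with Q hQ hn
    rw [hQ, freeResAt, freeRes, if_neg hn]
    simp
  have hTv : ∀ G, ∀ᵐ Q ∂(lebesguePoisson d), T G Q = if n < Q.card then
      -((K.α : ℂ) • matAct sigma1 (createAct K.lam (R₀ G) Q + annihilateAct K.lam (R₀ G) Q))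
      else 0 := fun G => by
    have e : T G = -(K.α : ℂ) • V G := rfl
    rw [e]
    filter_upwards [hV G, Lp.coeFn_smul (-(K.α : ℂ)) (V G)] with Q h1 h2
    rw [h2, Pi.smul_apply, h1]
    split_ifs
    · rw [neg_smul]
    · simp
  refine ⟨((R₀ ∘L S) ∘L (sectorGt d n).subtypeL).codRestrict _ fun G => hR₀m _, ?_, fun G => ?_⟩
  · intro F G
    have hRG : (((R₀ ∘L S) ∘L (sectorGt d n).subtypeL).codRestrict (sectorGt d n)
        (fun G => hR₀m _) G = F) ↔ R₀ (S G) = (F : SBSpace d) := by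
      rw [Subtype.ext_iff]; rfl
    rw [hRG]
    have hco : ∀ᵐ Q ∂(lebesguePoisson d), ((G + z • F : sectorGt d n) : SBSpace d) Q =
        (G : SBSpace d) Q + z • (F : SBSpace d) Q := by
      filter_upwards [Lp.coeFn_add (G : SBSpace d) (z • (F : SBSpace d)),
        Lp.coeFn_smul z (F : SBSpace d)] with Q h1 h2
      have e : ((G + z • F : sectorGt d n) : SBSpace d) = (G : SBSpace d) + z • (F : SBSpace d) :=
        rfl
      rw [e, h1, Pi.add_apply, h2, Pi.smul_apply]
    have hFm := mem_sectorGt_iff.1 F.2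
    have hGm := mem_sectorGt_iff.1 G.2
    constructor
    · intro hF
      have hF' := hR₀ (S G)
      rw [hF] at hF'
      refine ⟨?_, ?_⟩
      · have hm : AEStronglyMeasurable (fun Q : Config d => (energy K.ω Q : ℂ) • (F : SBSpace d) Q)
            (lebesguePoisson d) :=
          (aestronglyMeasurable_card_energy hd (K.continuous_ω) (g := fun _ e => (e : ℂ))
            fun _ => Complex.measurable_ofReal).fun_smul (Lp.aestronglyMeasurable _)
        refine MemLp.of_le_mul (c := ‖kerAct‖ * (1 + |K.ε + z.re| * K.rate n))
          (Lp.memLp (S G)) hm ?_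
        filter_upwards [hF'] with Q hQ
        rw [hQ, ← smul_apply, ← map_smul]
        refine (norm_kerAct_le _ _).trans ?_
        gcongr
        exact norm_energy_mul_freeResAt_le hz Q
      · have hS1' := hS1 (G : SBSpace d)
        have hae : ∀ᵐ Q ∂(lebesguePoisson d), S G Q = (G : SBSpace d) Q + T (S G) Q := by
          conv =>
            enter [1, Q]
            lhs
            rw [hS1']
          filter_upwards [Lp.coeFn_add (G : SBSpace d) (T (S G))] with Q h
          rw [h, Pi.add_apply]
        have hTS := hTv (S G)
        rw [hF] at hTS
        filter_upwards [hco, hF', hae, hTS, hFm, hGm] with Q h1 h2 h3 h4 h5 h6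
        rw [h1]
        split_ifs with hn
        · have h7 := (kerAct_freeResAt_eq_iff hz hn _ _).1 h2
          rw [h3, h4, if_pos hn] at h7
          unfold hamiltonianAct
          rw [sub_eq_iff_eq_add] at h7
          rw [h7]
          abel
        · rw [h5 hn, h6 hn]; simp
    · rintro ⟨hdom, hB⟩
      have hm : MemLp (fun Q => if n < Q.card then matAct ((K.ε : ℂ) • sigma3) ((F : SBSpace d) Q) +
          (energy K.ω Q : ℂ) • (F : SBSpace d) Q - z • (F : SBSpace d) Q else 0) 2
          (lebesguePoisson d) := by
        have hs : MemLp (fun Q => matAct ((K.ε : ℂ) • sigma3) ((F : SBSpace d) Q)) 2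
            (lebesguePoisson d) := by
          refine MemLp.of_le_mul (c := ‖kerAct (fun i j => ((K.ε : ℂ) • sigma3) i j)‖)
            (Lp.memLp (F : SBSpace d)) ?_ (Eventually.of_forall fun Q =>
              (kerAct (fun i j => ((K.ε : ℂ) • sigma3) i j)).le_opNorm _)
          exact (kerAct (fun i j => ((K.ε : ℂ) • sigma3) i j)).continuous.comp_aestronglyMeasurable
            (Lp.aestronglyMeasurable _)
        have h1 := (hs.add hdom).sub ((Lp.memLp (F : SBSpace d)).const_smul z)
        refine (memLp_congr_ae ?_).1 h1
        filter_upwards [hFm] with Q hQ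
        split_ifs with hn
        · rfl
        · simp only [Pi.sub_apply, Pi.add_apply, Pi.smul_apply, hQ hn, smul_zero, add_zero,
            sub_zero]
          rw [← zero_smul ℂ (0 : Spin)]
          ext i; simp [matAct_entry]
      set G' : SBSpace d := hm.toLp with hG'
      have hG'v := hm.coeFn_toLp
      rw [← hG'] at hG'v
      have hF' : R₀ G' = (F : SBSpace d) := by
        refine Lp.ext ?_
        filter_upwards [hR₀ G', hG'v, hFm] with Q h1 h2 h3
        rw [h1]
        by_cases hn : n < Q.card
        · rw [if_pos hn] at h2
          exact ((kerAct_freeResAt_eq_iff hz hn _ _).2 h2.symm).symm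
        · rw [freeResAt, freeRes, if_neg hn, h3 hn]; simp
      rw [← hF']
      congr 1
      refine (hS2 (G : SBSpace d) G' ?_).symm
      refine Lp.ext ?_
      have hTG := hTv G'
      rw [hF'] at hTG
      filter_upwards [Lp.coeFn_add (G : SBSpace d) (T G'), hG'v, hB, hco, hTG, hGm] with Q
        h1 h2 h3 h4 h5 h6
      rw [h1, Pi.add_apply, h2, h5]
      split_ifs with hn
      · rw [if_pos hn, h4, hamiltonianAct] at h3
        rw [← sub_eq_iff_eq_add', eq_comm, ← sub_eq_zero] 
        rw [← sub_eq_zero] at h3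
        rw [← h3]
        abel
      · rw [h6 hn, add_zero]
  · have h1 : HasSum (fun j : ℕ => T ^ j) S := hsum.hasSum
    have h2 := (ContinuousLinearMap.apply ℂ (SBSpace d) (G : SBSpace d)).hasSum h1
    exact R₀.hasSum h2

end Model

/-! ### The coupling operators -/

section Couplings

variable {d : ℕ}

open scoped Classical in
theorem card_addPoint {Q : Config d} {p : Mom d} (h : p ∉ Q) :
    (addPoint Q p).card = Q.card + 1 := by
  rw [addPoint, Finset.card_insert_of_notMem h]

open scoped Classical in
theorem card_removePoint {Q : Config d} {q : Mom d} (h : q ∈ Q) :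
    (removePoint Q q).card + 1 = Q.card := by
  rw [removePoint, Finset.card_erase_add_one h]

/-- Restriction to the configurations with `N` points, followed by multiplication with a matrix. -/
theorem isL2Bounded_restrict (hd : 0 < d) (N : ℕ) (A : SpinKer) :
    IsL2Bounded (fun F (Q : Config d) => kerAct (if Q.card = N then A else 0) (F Q))
      (‖kerAct‖ * ‖A‖) :=
  isL2Bounded_mul (Model.aestronglyMeasurable_card hd fun j => if j = N then A else 0)
    fun Q => by split_ifs <;> simp

theorem cardWeight_smul_restrict (N : ℕ) (Q : Config d) (v : Spin) :
    cardWeight Q • kerAct (if Q.card = N then ((N + 1 : ℕ) : ℂ) • Model.spinOne else 0) v =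
      if Q.card = N then v else 0 := by
  split_ifs with h
  · rw [map_smul, smul_apply, kerAct_spinOne, smul_smul, cardWeight, h,
      inv_mul_cancel₀ (by exact_mod_cast Nat.succ_ne_zero N), one_smul]
  · simp

theorem kerAct_smul_spinFlip_spinOne (a : ℝ) (v : Spin) :
    kerAct ((a : ℂ) • spinFlip Model.spinOne) v = (a : ℂ) • matAct sigma1 v := by
  rw [map_smul, smul_apply, matAct_sigma1]

theorem exists_isC (hd : 0 < d) {lam : Mom d → ℂ} (hlc : Continuous lam)
    (hlam : MemLp lam 2 volume) (α : ℝ) (n : ℕ) :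
    ∃ C : sectorGt d n →L[ℂ] sectorEq d n, IsC α lam n C := by
  have h1 := isL2Bounded_restrict hd n ((α : ℂ) • spinFlip Model.spinOne)
  have h2 := isL2Bounded_annihilate hd hlc hlam
  have h3 := isL2Bounded_restrict hd (n + 1) (((n + 1 + 1 : ℕ) : ℂ) • Model.spinOne)
  have key : ∀ F : SBSpace d, (h1.toCLM ∘L h2.toCLM ∘L h3.toCLM) F =ᵐ[lebesguePoisson d] fun Q =>
      if Q.card = n then (α : ℂ) • matAct sigma1 (annihilateAct lam F Q) else 0 := fun F => by
    have e : (fun Q => cardWeight Q • h3.toCLM F Q) =ᵐ[lebesguePoisson d]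
        fun Q => if Q.card = n + 1 then F Q else 0 := by
      filter_upwards [h3.toCLM_ae F] with Q hQ
      rw [hQ, cardWeight_smul_restrict]
    filter_upwards [h1.toCLM_ae (h2.toCLM (h3.toCLM F)), h2.toCLM_ae (h3.toCLM F),
      annihilateAct_congr_ae hd lam e] with Q q1 q2 q3
    simp only [ContinuousLinearMap.comp_apply]
    rw [q1, q2, q3]
    split_ifs with h
    · rw [kerAct_smul_spinFlip_spinOne]
      congr 2
      refine integral_congr_ae ((ae_notMem hd Q).mono fun p hp => ?_)
      simp only
      rw [if_pos (by rw [card_addPoint hp, h])]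
    · simp
  refine ⟨((h1.toCLM ∘L h2.toCLM ∘L h3.toCLM) ∘L (sectorGt d n).subtypeL).codRestrict _
    fun F => ?_, fun F => key F⟩
  rw [Model.mem_sectorEq_iff]
  filter_upwards [key F] with Q hQ hn
  exact hQ.trans (if_neg hn)

theorem exists_isCStar (hd : 0 < d) {lam : Mom d → ℂ} (hlc : Continuous lam)
    (hlam : MemLp lam 2 volume) (α : ℝ) (n : ℕ) :
    ∃ Cs : sectorEq d n →L[ℂ] sectorGt d n, IsCStar α lam n Cs := by
  have h1 := isL2Bounded_restrict hd (n + 1) ((α : ℂ) • spinFlip Model.spinOne)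
  have h2 := isL2Bounded_create hd hlc hlam
  have h3 := isL2Bounded_restrict hd n (((n + 1 : ℕ) : ℂ) • Model.spinOne)
  have key : ∀ F : SBSpace d, (h1.toCLM ∘L h2.toCLM ∘L h3.toCLM) F =ᵐ[lebesguePoisson d] fun Q =>
      if Q.card = n + 1 then (α : ℂ) • matAct sigma1 (createAct lam F Q) else 0 := fun F => by
    have e : (fun Q => cardWeight Q • h3.toCLM F Q) =ᵐ[lebesguePoisson d]
        fun Q => if Q.card = n then F Q else 0 := by
      filter_upwards [h3.toCLM_ae F] with Q hQ
      rw [hQ, cardWeight_smul_restrict]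
    filter_upwards [h1.toCLM_ae (h2.toCLM (h3.toCLM F)), h2.toCLM_ae (h3.toCLM F),
      createAct_congr_ae hd lam e] with Q q1 q2 q3
    simp only [ContinuousLinearMap.comp_apply]
    rw [q1, q2, q3]
    split_ifs with h
    · rw [kerAct_smul_spinFlip_spinOne]
      congr 2
      refine Finset.sum_congr rfl fun q hq => ?_
      simp only
      rw [if_pos (by have := card_removePoint hq; omega)]
    · simp
  refine ⟨((h1.toCLM ∘L h2.toCLM ∘L h3.toCLM) ∘L (sectorEq d n).subtypeL).codRestrict _
    fun F => ?_, fun F => key F⟩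
  rw [Model.mem_sectorGt_iff]
  filter_upwards [key F] with Q hQ hn
  exact hQ.trans (if_neg fun h => hn (by omega))

end Couplings

/-! ### Kernels as functions of configurations -/

/-- Kernels `γ m z S k` with a finite set `S` of outgoing momenta and `m` incoming momenta `k`. -/
abbrev ConfigKer (d : ℕ) : Type := (m : ℕ) → ℂ → Config d → (Fin m → Mom d) → SpinKer

namespace Model

variable {d : ℕ} {K : Model d} {m : ℕ}

/-- The kernel `γ` is given in the coordinates of the outgoing momenta by `G`. -/
def Represents (γ : ConfigKer d) (G : (l m : ℕ) → KerArg d l m → SpinKer) : Prop :=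
  ∀ (l m : ℕ) (z : ℂ) (x : Fin l → Mom d) (k : Fin m → Mom d), Function.Injective x →
    γ m z (ofTuple x) k = G l m (z, x, k)

/-- The configuration form of `createPart`. -/
noncomputable def confCreate (γ : ConfigKer d) : ConfigKer d :=
  fun m z S k => ∑ q ∈ S, γ m z (removePoint S q) k

/-- The configuration form of `tailPart`. -/
noncomputable def confTail (K : Model d) (γ : ConfigKer d) : ConfigKer d
  | 0, _, _, _ => 0
  | m + 1, z, S, k => γ m (z - (K.ω (k 0) : ℂ)) S (Fin.tail k)

/-- The configuration form of the contractions. -/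
noncomputable def confContract (K : Model d) (γ : ConfigKer d) : ConfigKer d :=
  fun m z S k => ∫ q, γ m z (addPoint S q) k ∂K.coupling

/-- The configuration form of `fieldPart`. -/
noncomputable def confField (K : Model d) (γ : ConfigKer d) : ConfigKer d :=
  fun m z S k => confCreate γ m z S k + K.confContract γ m z S k + K.confTail γ m z S k

/-- The configuration form of `ker`. -/
noncomputable def confKer (K : Model d) : ℕ → ConfigKer d
  | 0 => fun m z S _ =>
      if S.card = 1 ∧ m = 0 then
        K.α • spinResolvent K.ε ((energy K.ω S : ℂ) - z) (spinFlip spinOne) else 0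
  | j + 1 => fun m z S k =>
      if S.card ≤ m then 0 else
        -K.α • spinResolvent K.ε ((energy K.ω S : ℂ) - z)
          (spinFlip (K.confField (K.confKer j) m z S k))

/-- The configuration form of `effKer`. -/
noncomputable def confEff (K : Model d) (j : ℕ) : ConfigKer d :=
  fun m z S k => K.α • spinFlip (K.confField (K.confKer j) m z S k)

theorem coupling_absolutelyContinuous : K.coupling ≪ volume :=
  withDensity_absolutelyContinuous _ _

theorem ofTuple_zero (x : Fin 0 → Mom d) : ofTuple x = ∅ := by
  simp [ofTuple]

theorem cons_injective_of_notMem {l : ℕ} {x : Fin l → Mom d} (hx : Function.Injective x)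
    {q : Mom d} (hq : q ∉ ofTuple x) : Function.Injective (Fin.cons q x : Fin (l + 1) → Mom d) :=
  Fin.cons_injective_iff.2 ⟨fun ⟨i, hi⟩ => hq (mem_ofTuple.2 ⟨i, hi⟩), hx⟩

theorem Represents.addPoint {γ : ConfigKer d} {G : (l m : ℕ) → KerArg d l m → SpinKer}
    (h : Represents γ G) {l : ℕ} {x : Fin l → Mom d} (hx : Function.Injective x) {q : Mom d}
    (hq : q ∉ ofTuple x) (z : ℂ) (k : Fin m → Mom d) :
    γ m z (addPoint (ofTuple x) q) k = G (l + 1) m (consArg q (z, x, k)) := by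
  rw [← ofTuple_cons]
  exact h _ _ _ _ _ (cons_injective_of_notMem hx hq)

theorem Represents.confField (hd : 0 < d) {γ : ConfigKer d}
    {G : (l m : ℕ) → KerArg d l m → SpinKer} (h : Represents γ G) :
    Represents (K.confField γ) (K.fieldPart G) := by
  intro l m z x k hx
  have h1 : confCreate γ m z (ofTuple x) k = createPart G l m (z, x, k) := by
    cases l with
    | zero => rw [confCreate, ofTuple_zero]; rfl
    | succ l =>
      rw [confCreate, sum_ofTuple hx]
      refine Finset.sum_congr rfl fun i _ => ?_
      rw [removePoint_ofTuple hx]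
      exact h _ _ _ _ _ (hx.comp (Fin.succAbove_right_injective))
  have h2 : K.confContract γ m z (ofTuple x) k =
      ∫ q, G (l + 1) m (consArg q (z, x, k)) ∂K.coupling :=
    integral_congr_ae (coupling_absolutelyContinuous.ae_le
      ((ae_notMem hd (ofTuple x)).mono fun q hq => h.addPoint hx hq z k))
  have h3 : K.confTail γ m z (ofTuple x) k = K.tailPart G l m (z, x, k) := by
    cases m with
    | zero => rfl
    | succ m => exact h _ _ _ _ _ hx
  rw [Model.confField, h1, h2, h3, fieldPart]

theorem ofReal_energy_sub (l : ℕ) (z : ℂ) {x : Fin l → Mom d} (hx : Function.Injective x)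
    (k : Fin m → Mom d) : (energy K.ω (ofTuple x) : ℂ) - z = K.excess (z, x, k) := by
  rw [energy, sum_ofTuple hx]; rfl

theorem represents_confKer (hd : 0 < d) (j : ℕ) : Represents (K.confKer j) (K.ker j) := by
  induction j with
  | zero =>
    intro l m z x k hx
    simp only [confKer, ker, card_ofTuple hx, ofReal_energy_sub l z hx k]
  | succ j ih =>
    intro l m z x k hx
    simp only [confKer, ker, card_ofTuple hx, ofReal_energy_sub l z hx k,
      (ih.confField hd) l m z x k hx]

theorem represents_confEff (hd : 0 < d) (j : ℕ) {x : Fin m → Mom d} (hx : Function.Injective x)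
    (z : ℂ) (k : Fin m → Mom d) : K.confEff j m z (ofTuple x) k = K.effKer j m (z, x, k) := by
  rw [confEff, effKer, (represents_confKer hd j).confField hd m m z x k hx]

/-- Kernels which are continuous and bounded in coordinates. -/
def Admissible (K : Model d) (γ : ConfigKer d) : Prop :=
  ∃ G : (l m : ℕ) → KerArg d l m → SpinKer, Represents γ G ∧
    ∀ l m, ∃ A B, K.KernelBound (G l m) A B

theorem admissible_confKer (hd : 0 < d) (j : ℕ) : K.Admissible (K.confKer j) :=
  ⟨K.ker j, represents_confKer hd j, fun l m => ⟨_, _, kernelBound_ker j l m⟩⟩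

/-- The regularity of a kernel in the incoming momenta. -/
theorem Admissible.exists_bound {γ : ConfigKer d} (hγ : K.Admissible γ) (m : ℕ) (S : Config d) :
    ∃ A : ℝ, 0 ≤ A ∧ ∀ z ∈ halfPlane K.ε K.κ K.η m,
      Continuous (fun k : Fin m → Mom d => γ m z S k) ∧ ∀ k, ‖γ m z S k‖ ≤ A := by
  obtain ⟨G, hG, hb⟩ := hγ
  obtain ⟨x, hx, hxS⟩ := exists_ofTuple_eq S
  obtain ⟨A, B, h⟩ := hb S.card m
  have e : ∀ z k, γ m z S k = G S.card m (z, x, k) := fun z k => by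
    conv_lhs => rw [← hxS]
    exact hG _ _ _ _ _ hx
  refine ⟨|A|, abs_nonneg A, fun z hz => ⟨?_, fun k => ?_⟩⟩
  · simp only [e]
    exact h.continuousOn.comp_continuous (by fun_prop) fun k => hz
  · rw [e]
    exact (h.norm_le (p := (z, x, k)) hz).trans (le_abs_self A)

/-- The regularity of a kernel in an outgoing momentum and the incoming momenta. -/
theorem Admissible.exists_bound_addPoint {γ : ConfigKer d} (hγ : K.Admissible γ) (m : ℕ)
    (S : Config d) {z : ℂ} (hz : z ∈ halfPlane K.ε K.κ K.η m) :
    ∃ (A : ℝ) (g : Mom d × (Fin m → Mom d) → SpinKer), 0 ≤ A ∧ Continuous g ∧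
      (∀ r, ‖g r‖ ≤ A) ∧ ∀ q ∉ S, ∀ k, γ m z (addPoint S q) k = g (q, k) := by
  obtain ⟨G, hG, hb⟩ := hγ
  obtain ⟨x, hx, hxS⟩ := exists_ofTuple_eq S
  obtain ⟨A, B, h⟩ := hb (S.card + 1) m
  refine ⟨|A|, fun r => G (S.card + 1) m (consArg r.1 (z, x, r.2)), abs_nonneg A, ?_, fun r => ?_,
    fun q hq k => ?_⟩
  · exact h.continuousOn.comp_continuous (continuous_consArg.comp
      (f := fun r : Mom d × (Fin m → Mom d) => (r.1, ((z, x, r.2) : KerArg d S.card m)))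
      (by fun_prop)) fun k => hz
  · exact (h.norm_le (p := consArg r.1 (z, x, r.2)) hz).trans (le_abs_self A)
  · conv_lhs => rw [← hxS]
    exact hG.addPoint hx (by rwa [hxS]) z k

/-- The regularity of a kernel in the incoming momenta and a shift of the spectral parameter. -/
theorem Admissible.exists_bound_tail {γ : ConfigKer d} (hγ : K.Admissible γ) (m : ℕ)
    (S : Config d) {z : ℂ} (hz : z ∈ halfPlane K.ε K.κ K.η m) :
    ∃ A : ℝ, 0 ≤ A ∧ Continuous (fun k : Fin m → Mom d => K.confTail γ m z S k) ∧
      ∀ k, ‖K.confTail γ m z S k‖ ≤ A := by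
  cases m with
  | zero => exact ⟨0, le_rfl, continuous_const, fun k => by simp [confTail]⟩
  | succ m =>
    obtain ⟨G, hG, hb⟩ := hγ
    obtain ⟨x, hx, hxS⟩ := exists_ofTuple_eq S
    obtain ⟨A, B, h⟩ := hb S.card m
    have e : ∀ k, K.confTail γ (m + 1) z S k = G S.card m (K.tailArg (z, x, k)) := fun k => by
      conv_lhs => rw [← hxS]
      exact hG _ _ _ _ _ hx
    have hm : ∀ k : Fin (m + 1) → Mom d, K.tailArg (z, x, k) ∈ K.dom S.card m := fun k =>
      tailArg_mem (p := (z, x, k)) hz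
    refine ⟨|A|, abs_nonneg A, ?_, fun k => ?_⟩
    · simp only [e]
      refine h.continuousOn.comp_continuous ?_ hm
      have := continuous_ω (K := K)
      unfold tailArg
      have ht : Continuous fun k : Fin (m + 1) → Mom d => Fin.tail k :=
        continuous_pi fun i => continuous_apply _
      have hω : Continuous fun k : Fin (m + 1) → Mom d => (K.ω (k 0) : ℂ) :=
        Complex.continuous_ofReal.comp (this.comp (continuous_apply 0))
      exact (continuous_const.sub hω).prodMk (continuous_const.prodMk ht)
    · rw [e]
      exact (h.norm_le (hm k)).trans (le_abs_self A)

end Model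

/-! ### Normally ordered operators -/

namespace Model

variable {d : ℕ} {K : Model d} {m : ℕ}

/-- The function `f` with spectators `T`, multiplied with the form factors of the incoming
momenta. -/
noncomputable def absorb (K : Model d) (f : Config d → Spin) (T : Config d) (m : ℕ)
    (k : Fin m → Mom d) : Spin :=
  (∏ i, conj (K.lam (k i))) • f (addTuple T k)

/-- The contribution of the spectators `T` to the operator of kernel `γ` at the configuration
`Q`. -/
noncomputable def normalTerm (K : Model d) (γ : ConfigKer d) (f : Config d → Spin) (z : ℂ)
    (Q T : Config d) (m : ℕ) : Spin :=
  (∏ q ∈ remove Q T, K.lam q) • ∫ k : Fin m → Mom d,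
    kerAct (γ m (z - (energy K.ω T : ℂ)) (remove Q T) k) (K.absorb f T m k)

/-- The operator of kernel `γ` on functions of `n` momenta: a sum over the spectators. -/
noncomputable def normalAct (K : Model d) (n : ℕ) (γ : ConfigKer d) (f : Config d → Spin) (z : ℂ)
    (Q : Config d) : Spin :=
  ∑ T ∈ Q.powerset, if T.card ≤ n then K.normalTerm γ f z Q T (n - T.card) else 0

/-- The configurations at which the operators of admissible kernels can be evaluated on `f`. -/
def IsGood (K : Model d) (f : Config d → Spin) (Q : Config d) : Prop :=
  ∀ T ⊆ Q, ∀ m, Integrable (K.absorb f T m)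

theorem memLp_prod_conj (m : ℕ) :
    MemLp (fun k : Fin m → Mom d => ∏ i, conj (K.lam (k i))) 2 volume := by
  have hc : Continuous fun k : Fin m → Mom d => ∏ i, conj (K.lam (k i)) :=
    continuous_finsetProd _ fun i _ =>
      Complex.continuous_conj.comp (K.lam_continuous.comp (continuous_apply i))
  refine (memLp_two_iff_integrable_sq_norm hc.aestronglyMeasurable).2 ?_
  have h : Integrable (fun k : Fin m → Mom d => ∏ i, ‖K.lam (k i)‖ ^ 2) :=
    Integrable.fintype_prod (f := fun _ q => ‖K.lam q‖ ^ 2) fun _ => K.integrable_norm_lam_sq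
  refine h.congr (Eventually.of_forall fun k => ?_)
  simp only [norm_prod, RCLike.norm_conj, Finset.prod_pow]

theorem ae_isGood (hd : 0 < d) {f : Config d → Spin} (hf : MemLp f 2 (lebesguePoisson d)) :
    ∀ᵐ Q ∂(lebesguePoisson d), K.IsGood f Q := by
  have key : ∀ᵐ T ∂(lebesguePoisson d), ∀ m, Integrable (K.absorb f T m) volume := by
    refine ae_all_iff.2 fun m => ?_
    filter_upwards [ae_memLp_addTuple hd hf m] with T hT
    have h : MemLp ((fun k : Fin m → Mom d => ∏ i, conj (K.lam (k i))) •
        fun k : Fin m → Mom d => f (addTuple T k)) 1 volume := hT.smul (memLp_prod_conj m)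
    exact memLp_one_iff_integrable.1 h
  filter_upwards [ae_subset hd key] with Q hQ
  exact hQ

theorem integrable_kerAct {X : Type*} [MeasurableSpace X] {μ : Measure X} {a : X → SpinKer}
    {g : X → Spin} (ha : AEStronglyMeasurable a μ) {A : ℝ} (hA : ∀ᵐ x ∂μ, ‖a x‖ ≤ A)
    (hg : Integrable g μ) : Integrable (fun x => kerAct (a x) (g x)) μ := by
  refine (hg.norm.const_mul (‖kerAct‖ * A)).mono' (kerAct.aestronglyMeasurable_comp₂ ha hg.1) ?_
  filter_upwards [hA] with x hx
  refine (norm_kerAct_le _ _).trans ?_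
  have := norm_nonneg kerAct
  gcongr

theorem Admissible.integrable {γ : ConfigKer d} (hγ : K.Admissible γ) {z : ℂ}
    (hz : z ∈ halfPlane K.ε K.κ K.η m) (S : Config d) {g : (Fin m → Mom d) → Spin}
    (hg : Integrable g) : Integrable fun k => kerAct (γ m z S k) (g k) := by
  obtain ⟨A, -, h⟩ := hγ.exists_bound m S
  exact integrable_kerAct (h z hz).1.aestronglyMeasurable
    (Eventually.of_forall (h z hz).2) hg

theorem Admissible.integrable_tail {γ : ConfigKer d} (hγ : K.Admissible γ) {z : ℂ}
    (hz : z ∈ halfPlane K.ε K.κ K.η m) (S : Config d) {g : (Fin m → Mom d) → Spin}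
    (hg : Integrable g) : Integrable fun k => kerAct (K.confTail γ m z S k) (g k) := by
  obtain ⟨A, -, h1, h2⟩ := hγ.exists_bound_tail m S hz
  exact integrable_kerAct h1.aestronglyMeasurable (Eventually.of_forall h2) hg

theorem integrable_coupling_of_bounded {a : Mom d → SpinKer} (ha : Continuous a) {A : ℝ}
    (hA : ∀ q, ‖a q‖ ≤ A) : Integrable a K.coupling :=
  (integrable_const A).mono' ha.aestronglyMeasurable (Eventually.of_forall hA)

/-- The contraction of an outgoing momentum with the annihilated one. -/
theorem Admissible.contract (hd : 0 < d) {γ : ConfigKer d} (hγ : K.Admissible γ) {z : ℂ}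
    (hz : z ∈ halfPlane K.ε K.κ K.η m) (S : Config d) {g : (Fin m → Mom d) → Spin}
    (hg : Integrable g) :
    Integrable (fun q => (‖K.lam q‖ ^ 2 : ℝ) • ∫ k, kerAct (γ m z (addPoint S q) k) (g k)) ∧
      Integrable (fun k => kerAct (K.confContract γ m z S k) (g k)) ∧
      ∫ q, (‖K.lam q‖ ^ 2 : ℝ) • ∫ k, kerAct (γ m z (addPoint S q) k) (g k) =
        ∫ k, kerAct (K.confContract γ m z S k) (g k) := by
  obtain ⟨A, G, hA0, hGc, hGA, hG⟩ := hγ.exists_bound_addPoint m S hz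
  have hprod : Integrable (fun r : Mom d × (Fin m → Mom d) =>
      kerAct (G r) ((‖K.lam r.1‖ ^ 2 : ℝ) • g r.2)) (volume.prod volume) :=
    integrable_kerAct hGc.aestronglyMeasurable (Eventually.of_forall hGA)
      (K.integrable_norm_lam_sq.smul_prod hg)
  have e1 : (fun q => (‖K.lam q‖ ^ 2 : ℝ) • ∫ k, kerAct (γ m z (addPoint S q) k) (g k))
      =ᵐ[volume] fun q => ∫ k, kerAct (G (q, k)) ((‖K.lam q‖ ^ 2 : ℝ) • g k) := by
    filter_upwards [ae_notMem hd S] with q hq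
    rw [← integral_smul]
    refine integral_congr_ae (Eventually.of_forall fun k => ?_)
    simp only
    rw [hG q hq k, ContinuousLinearMap.map_smul_of_tower]
  have e2 : (fun k => kerAct (K.confContract γ m z S k) (g k)) =
      fun k => ∫ q, kerAct (G (q, k)) ((‖K.lam q‖ ^ 2 : ℝ) • g k) := by
    funext k
    have hi : Integrable (fun q => G (q, k)) K.coupling :=
      integrable_coupling_of_bounded (hGc.comp (by fun_prop)) fun q => hGA _
    have h1 : K.confContract γ m z S k = ∫ q, G (q, k) ∂K.coupling :=
      integral_congr_ae (coupling_absolutelyContinuous.ae_le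
        ((ae_notMem hd S).mono fun q hq => hG q hq k))
    have h2 := (kerAct.flip (g k)).integral_comp_comm hi
    rw [ContinuousLinearMap.flip_apply] at h2
    rw [h1, ← h2, integral_coupling]
    refine integral_congr_ae (Eventually.of_forall fun q => ?_)
    simp only [ContinuousLinearMap.flip_apply]
    rw [ContinuousLinearMap.map_smul_of_tower]
  refine ⟨(integrable_congr e1).2 hprod.integral_prod_left, ?_, ?_⟩
  · rw [e2]; exact hprod.integral_prod_right
  · rw [integral_congr_ae e1, e2]
    exact integral_integral_swap hprod

/-- Integration over the incoming momenta, the first one separately. -/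
theorem integral_cons {h : (Fin (m + 1) → Mom d) → Spin} (hh : Integrable h) :
    Integrable (fun q : Mom d => ∫ k : Fin m → Mom d, h (Fin.cons q k)) ∧
      ∫ q : Mom d, ∫ k : Fin m → Mom d, h (Fin.cons q k) = ∫ k, h k := by
  have hmp := measurePreserving_cons (d := d) (n := m)
  have hi : Integrable (fun r : Mom d × (Fin m → Mom d) =>
      h (Fin.cons r.1 r.2 : Fin (m + 1) → Mom d)) (volume.prod volume) :=
    hmp.integrable_comp_of_integrable hh
  refine ⟨hi.integral_prod_left, ?_⟩
  rw [integral_integral hi, ← hmp.map_eq, integral_map hmp.aemeasurable]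
  rw [hmp.map_eq]
  exact hh.1

open scoped Classical in
theorem addTuple_addPoint (T : Config d) (p : Mom d) (k : Fin m → Mom d) :
    addTuple (addPoint T p) k = addTuple T (Fin.cons p k : Fin (m + 1) → Mom d) := by
  rw [addTuple, addTuple, ofTuple_cons, addPoint, addPoint, Finset.insert_union,
    Finset.union_insert]

theorem absorb_cons (f : Config d → Spin) (T : Config d) (p : Mom d) (k : Fin m → Mom d) :
    K.absorb f T (m + 1) (Fin.cons p k) = conj (K.lam p) • K.absorb f (addPoint T p) m k := by
  simp only [absorb, Fin.prod_univ_succ, Fin.cons_zero, Fin.cons_succ, addTuple_addPoint,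
    smul_smul]

open scoped Classical in
theorem energy_addPoint {T : Config d} {p : Mom d} (h : p ∉ T) :
    energy K.ω (addPoint T p) = K.ω p + energy K.ω T := by
  rw [energy, addPoint, Finset.sum_insert h, energy]

/-- The spectators shift the spectral parameter away from the threshold. -/
theorem sub_energy_mem {n : ℕ} {z : ℂ} (hz : z ∈ halfPlane K.ε K.κ K.η n) {T : Config d}
    (hT : T.card + m = n) : z - (energy K.ω T : ℂ) ∈ halfPlane K.ε K.κ K.η m := by
  have h1 : (T.card : ℝ) * K.κ ≤ energy K.ω T := by
    have := Finset.card_nsmul_le_sum T K.ω K.κ fun q _ => K.κ_le q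
    rwa [nsmul_eq_mul] at this
  rw [mem_halfPlane_iff] at hz ⊢
  refine hz.trans_le ?_
  subst hT
  simp only [gap, Complex.sub_re, Complex.ofReal_re]
  push_cast
  linarith

open scoped Classical in
/-- The creation part of the field operator. -/
theorem createAct_normalAct {n : ℕ} {z : ℂ} (hz : z ∈ halfPlane K.ε K.κ K.η n) {γ : ConfigKer d}
    (hγ : K.Admissible γ) {f : Config d → Spin} {Q : Config d} (hQ : K.IsGood f Q) :
    createAct K.lam (K.normalAct n γ f z) Q = K.normalAct n (confCreate γ) f z Q := by
  simp only [createAct, normalAct, Finset.smul_sum]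
  rw [Finset.sum_comm' (t' := Q.powerset) (s' := fun T => remove Q T) (by
    intro q T
    simp only [removePoint, remove, Finset.mem_powerset, Finset.mem_sdiff,
      Finset.subset_erase]
    tauto)]
  refine Finset.sum_congr rfl fun T hT => ?_
  split_ifs with hn
  · have hz' := sub_energy_mem (K := K) hz (m := n - T.card) (by omega : T.card + (n - T.card) = n)
    have hi := hQ T (Finset.mem_powerset.1 hT) (n - T.card)
    have e : ∀ q ∈ remove Q T, K.lam q • K.normalTerm γ f z (removePoint Q q) T (n - T.card) =
        (∏ q ∈ remove Q T, K.lam q) • ∫ k, kerAct (γ (n - T.card) (z - (energy K.ω T : ℂ))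
          (removePoint (remove Q T) q) k) (K.absorb f T (n - T.card) k) := fun q hq => by
      have e1 : remove (removePoint Q q) T = removePoint (remove Q T) q :=
        Finset.erase_sdiff_comm _ _ _
      rw [normalTerm, e1, smul_smul]
      congr 1
      exact Finset.mul_prod_erase _ _ hq
    rw [Finset.sum_congr rfl e, ← Finset.smul_sum, normalTerm,
      ← integral_finsetSum _ fun q _ => hγ.integrable hz' _ hi]
    congr 2
    funext k
    simp only [confCreate, map_sum, sum_apply]
  · simp

open scoped Classical in
/-- The annihilation part of the field operator: the annihilated momentum is either an outgoing
one or a spectator. -/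
theorem annihilateAct_normalAct (hd : 0 < d) {n : ℕ} {z : ℂ}
    (hz : z ∈ halfPlane K.ε K.κ K.η n) {γ : ConfigKer d}
    (hγ : K.Admissible γ) {f : Config d → Spin} {Q : Config d} (hQ : K.IsGood f Q) :
    annihilateAct K.lam (K.normalAct n γ f z) Q =
      K.normalAct n (K.confContract γ) f z Q + K.normalAct n (K.confTail γ) f z Q := by
  -- For an annihilated momentum `p`, the term `a T p` collects the case that `p` is an outgoing
  -- momentum, and `b T p` the case that `p` is a spectator in addition to those in `T`.
  set a : Config d → Mom d → Spin := fun T p => if T.card ≤ n then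
    (∏ q ∈ remove Q T, K.lam q) • (‖K.lam p‖ ^ 2 : ℝ) • ∫ k : Fin (n - T.card) → Mom d,
      kerAct (γ (n - T.card) (z - (energy K.ω T : ℂ)) (addPoint (remove Q T) p) k)
        (K.absorb f T (n - T.card) k) else 0 with ha
  set b : Config d → Mom d → Spin := fun T p => if T.card + 1 ≤ n then
    (∏ q ∈ remove Q T, K.lam q) • ∫ k : Fin (n - (T.card + 1)) → Mom d,
      kerAct (K.confTail γ (n - (T.card + 1) + 1) (z - (energy K.ω T : ℂ)) (remove Q T)
        (Fin.cons p k)) (K.absorb f T (n - (T.card + 1) + 1) (Fin.cons p k)) else 0 with hb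
  have hab : ∀ p ∉ Q, conj (K.lam p) • K.normalAct n γ f z (addPoint Q p) =
      ∑ T ∈ Q.powerset, (a T p + b T p) := by
    intro p hp
    rw [normalAct, addPoint, Finset.sum_powerset_insert hp, smul_add, Finset.smul_sum,
      Finset.smul_sum, ← Finset.sum_add_distrib]
    refine Finset.sum_congr rfl fun T hT => ?_
    have hTQ := Finset.mem_powerset.1 hT
    have hpT : p ∉ T := fun h => hp (hTQ h)
    congr 1
    · simp only [ha]
      split_ifs with hn
      · have e1 : remove (insert p Q) T = addPoint (remove Q T) p :=
          Finset.insert_sdiff_of_notMem _ hpT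
        have hp' : p ∉ remove Q T := fun h => hp (Finset.mem_sdiff.1 h).1
        rw [normalTerm, e1]
        conv_lhs =>
          enter [2, 1]
          rw [addPoint, Finset.prod_insert hp']
        rw [smul_smul, ← mul_assoc, mul_comm (conj (K.lam p)), Complex.mul_conj, mul_comm,
          mul_smul, Complex.normSq_eq_norm_sq, Complex.coe_smul]
      · simp
    · simp only [hb, Finset.card_insert_of_notMem hpT]
      split_ifs with hn
      · have e1 : remove (insert p Q) (insert p T) = remove Q T := by
          rw [remove, Finset.insert_sdiff_insert, remove, Finset.sdiff_insert_of_notMem hp]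
        rw [normalTerm, e1, smul_comm, ← integral_smul]
        congr 2
        funext k
        have e2 := energy_addPoint (K := K) hpT
        rw [addPoint] at e2
        have e3 : z - ((energy K.ω (insert p T) : ℝ) : ℂ) =
            z - (energy K.ω T : ℂ) - (K.ω p : ℂ) := by
          rw [e2]; push_cast; ring
        rw [absorb_cons, map_smul, addPoint, e3, confTail, Fin.cons_zero, Fin.tail_cons]
      · simp
  have haI : ∀ T ∈ Q.powerset, Integrable (a T) ∧ ∫ p, a T p =
      if T.card ≤ n then K.normalTerm (K.confContract γ) f z Q T (n - T.card) else 0 := by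
    intro T hT
    simp only [ha]
    split_ifs with hn
    · have hz' := sub_energy_mem (K := K) hz (by omega : T.card + (n - T.card) = n)
      obtain ⟨h1, -, h3⟩ := hγ.contract hd hz' (remove Q T)
        (hQ T (Finset.mem_powerset.1 hT) (n - T.card))
      refine ⟨h1.fun_smul _, ?_⟩
      rw [integral_smul, h3, normalTerm]
    · exact ⟨integrable_zero _ _ _, integral_zero _ _⟩
  have hbI : ∀ T ∈ Q.powerset, Integrable (b T) ∧ ∫ p, b T p =
      if T.card ≤ n then K.normalTerm (K.confTail γ) f z Q T (n - T.card) else 0 := by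
    intro T hT
    simp only [hb]
    by_cases hn : T.card + 1 ≤ n
    · simp only [if_pos hn]
      have hz' := sub_energy_mem (K := K) hz (by omega : T.card + (n - (T.card + 1) + 1) = n)
      obtain ⟨h1, h2⟩ := integral_cons (hγ.integrable_tail hz' (remove Q T)
        (hQ T (Finset.mem_powerset.1 hT) (n - (T.card + 1) + 1)))
      refine ⟨h1.fun_smul _, ?_⟩
      rw [integral_smul, h2, if_pos (by omega), normalTerm,
        show n - (T.card + 1) + 1 = n - T.card by omega]
    · simp only [if_neg hn]
      refine ⟨integrable_zero _ _ _, (integral_zero _ _).trans ?_⟩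
      split_ifs with h
      · rw [normalTerm, show n - T.card = 0 by omega]
        simp [confTail]
      · rfl
  rw [annihilateAct, integral_congr_ae ((ae_notMem hd Q).mono fun p hp => hab p hp),
    integral_finsetSum _ fun T hT => (haI T hT).1.fun_add (hbI T hT).1]
  rw [normalAct, normalAct, ← Finset.sum_add_distrib]
  refine Finset.sum_congr rfl fun T hT => ?_
  rw [integral_add (haI T hT).1 (hbI T hT).1, (haI T hT).2, (hbI T hT).2]

/-- Normal ordering of the field operator composed with the operator of kernel `γ`. -/
theorem field_normalAct (hd : 0 < d) {n : ℕ} {z : ℂ}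
    (hz : z ∈ halfPlane K.ε K.κ K.η n) {γ : ConfigKer d}
    (hγ : K.Admissible γ) {f : Config d → Spin} {Q : Config d} (hQ : K.IsGood f Q) :
    createAct K.lam (K.normalAct n γ f z) Q + annihilateAct K.lam (K.normalAct n γ f z) Q =
      K.normalAct n (K.confField γ) f z Q := by
  rw [createAct_normalAct hz hγ hQ, annihilateAct_normalAct hd hz hγ hQ, normalAct, normalAct,
    normalAct, normalAct, ← Finset.sum_add_distrib, ← Finset.sum_add_distrib]
  refine Finset.sum_congr rfl fun T hT => ?_
  split_ifs with hn
  · have hz' := sub_energy_mem (K := K) hz (by omega : T.card + (n - T.card) = n)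
    have hi := hQ T (Finset.mem_powerset.1 hT) (n - T.card)
    have i1 : Integrable fun k => kerAct (confCreate γ (n - T.card) (z - (energy K.ω T : ℂ))
        (remove Q T) k) (K.absorb f T (n - T.card) k) := by
      simp only [confCreate, map_sum, sum_apply]
      exact integrable_finsetSum _ fun q _ => hγ.integrable hz' _ hi
    have i2 := (hγ.contract hd hz' (remove Q T) hi).2.1
    have i3 := hγ.integrable_tail hz' (remove Q T) hi
    simp only [normalTerm]
    rw [← smul_add, ← smul_add, ← integral_add i2 i3, ← integral_add i1 (i2.fun_add i3)]
    congr 2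
    funext k
    simp only [confField, map_add, add_apply]
    abel
  · simp

end Model

/-! ### The terms of the Neumann series -/

namespace Model

variable {d : ℕ} {K : Model d} {m : ℕ}

theorem admissible_confField (hd : 0 < d) (j : ℕ) : K.Admissible (K.confField (K.confKer j)) := by
  have hα := K.α_nonneg
  have ht : ∀ m, 0 ≤ K.α * K.rate m := fun m => mul_nonneg hα (rate_pos m).le
  refine ⟨_, (represents_confKer hd j).confField hd, fun l m => ⟨_, _, KernelBound.fieldPart
    (A := (K.α * K.rate m) ^ (j + 1)) (B := (j + 1) * (K.α * K.rate m) ^ (j + 1))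
    (fun m' hm' l => ?_) (pow_nonneg (ht m) _)
    (mul_nonneg (by positivity) (pow_nonneg (ht m) _)) l⟩⟩
  have h : (K.α * K.rate m') ^ (j + 1) ≤ (K.α * K.rate m) ^ (j + 1) :=
    pow_le_pow_left₀ (ht m') (mul_le_mul_of_nonneg_left (rate_mono hm') hα) _
  exact (kernelBound_ker j l m').mono h (by gcongr)

theorem admissible_confEff (hd : 0 < d) (j : ℕ) : K.Admissible (K.confEff j) := by
  obtain ⟨G, hG, hb⟩ := admissible_confField (K := K) hd j
  refine ⟨fun l m p => K.α • spinFlip (G l m p), fun l m z x k hx => ?_, fun l m => ?_⟩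
  · rw [confEff, hG l m z x k hx]
  · obtain ⟨A, B, h⟩ := hb l m
    exact ⟨_, _, h.flip.real_smul K.α⟩

/-- The kernel of the identity. -/
noncomputable def confId : ConfigKer d := fun m _ S _ => if S.card = 0 ∧ m = 0 then spinOne else 0

theorem admissible_confId : K.Admissible confId := by
  refine ⟨fun l m _ => if l = 0 ∧ m = 0 then spinOne else 0, fun l m z x k hx => ?_,
    fun l m => ⟨_, _, kernelBound_const _⟩⟩
  rw [confId, card_ofTuple hx]

theorem confCreate_confId (z : ℂ) (S : Config d) (k : Fin m → Mom d) :
    confCreate confId m z S k = if S.card = 1 ∧ m = 0 then spinOne else 0 := by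
  rw [confCreate]
  split_ifs with h
  · obtain ⟨q, hq⟩ := Finset.card_eq_one.1 h.1
    have : (removePoint S q).card = 0 := by
      have := card_removePoint (Q := S) (q := q) (by simp [hq])
      omega
    subst hq
    rw [Finset.sum_singleton, confId, if_pos ⟨this, h.2⟩]
  · refine Finset.sum_eq_zero fun q hq => ?_
    have := card_removePoint hq
    rw [confId, if_neg (by omega)]

/-- A kernel without incoming and outgoing momenta acts by multiplication. -/
theorem normalTerm_self (γ : ConfigKer d) (f : Config d → Spin) (z : ℂ) (Q : Config d) :
    K.normalTerm γ f z Q Q 0 = kerAct (γ 0 (z - (energy K.ω Q : ℂ)) ∅ Fin.elim0) (f Q) := by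
  have e1 : remove Q Q = ∅ := by simp [remove]
  have e2 : ∀ k : Fin 0 → Mom d, K.absorb f Q 0 k = f Q := fun k => by
    simp [absorb, addTuple, ofTuple_zero]
  rw [normalTerm, e1]
  simp only [Finset.prod_empty, one_smul, e2]
  rw [integral_unique, show volume.real (Set.univ : Set (Fin 0 → Mom d)) = 1 by
    simp [measureReal_def, volume_pi], one_smul]
  exact congrArg (fun k => kerAct (γ 0 _ ∅ k) (f Q)) (Subsingleton.elim _ _)

theorem normalAct_confId {n : ℕ} (f : Config d → Spin) (z : ℂ) {Q : Config d} (hQ : Q.card = n) :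
    K.normalAct n confId f z Q = f Q := by
  rw [normalAct, Finset.sum_eq_single_of_mem Q (Finset.mem_powerset_self Q)]
  · rw [if_pos hQ.le, hQ, Nat.sub_self, normalTerm_self, confId, if_pos ⟨rfl, rfl⟩, kerAct_spinOne]
  · intro T hT hne
    have hlt : T.card < Q.card :=
      Finset.card_lt_card (Finset.ssubset_iff_subset_ne.2 ⟨Finset.mem_powerset.1 hT, hne⟩)
    rw [if_pos (by omega), normalTerm]
    have : ∀ k, (confId (n - T.card) (z - (energy K.ω T : ℂ)) (remove Q T) k : SpinKer) = 0 :=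
      fun k => if_neg (by omega)
    simp [this]

/-- Composition of a normally ordered operator with a multiplication operator. -/
theorem map_normalAct {n : ℕ} {z : ℂ} (hz : z ∈ halfPlane K.ε K.κ K.η n) {γ : ConfigKer d}
    (hγ : K.Admissible γ) {f : Config d → Spin} {Q : Config d} (hQ : K.IsGood f Q)
    (A : Spin →L[ℂ] Spin) (γ' : ConfigKer d)
    (h : ∀ T ⊆ Q, T.card ≤ n → ∀ (k : Fin (n - T.card) → Mom d) (v : Spin),
      A (kerAct (γ (n - T.card) (z - (energy K.ω T : ℂ)) (remove Q T) k) v) =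
        kerAct (γ' (n - T.card) (z - (energy K.ω T : ℂ)) (remove Q T) k) v) :
    A (K.normalAct n γ f z Q) = K.normalAct n γ' f z Q := by
  rw [normalAct, normalAct, map_sum]
  refine Finset.sum_congr rfl fun T hT => ?_
  split_ifs with hn
  · have hTQ := Finset.mem_powerset.1 hT
    have hz' := sub_energy_mem (K := K) hz (by omega : T.card + (n - T.card) = n)
    rw [normalTerm, normalTerm, map_smul,
      ← A.integral_comp_comm (hγ.integrable hz' _ (hQ T hTQ (n - T.card)))]
    simp only [h T hTQ hn]
  · exact map_zero A

theorem confKer_of_le (j : ℕ) {S : Config d} (h : S.card ≤ m) (z : ℂ) (k : Fin m → Mom d) :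
    K.confKer j m z S k = 0 := by
  cases j with
  | zero => rw [confKer]; exact if_neg (by omega)
  | succ j => rw [confKer]; exact if_pos h

theorem card_remove {Q T : Config d} (h : T ⊆ Q) : (remove Q T).card = Q.card - T.card :=
  Finset.card_sdiff_of_subset h

theorem energy_remove {Q T : Config d} (h : T ⊆ Q) :
    energy K.ω (remove Q T) = energy K.ω Q - energy K.ω T :=
  eq_sub_of_add_eq (Finset.sum_sdiff h)

/-- The terms of the Neumann series vanish below the threshold. -/
theorem normalAct_confKer_of_le {n : ℕ} (j : ℕ) (f : Config d → Spin) (z : ℂ) {Q : Config d}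
    (h : Q.card ≤ n) : K.normalAct n (K.confKer j) f z Q = 0 := by
  rw [normalAct]
  refine Finset.sum_eq_zero fun T hT => ?_
  have hTQ := Finset.mem_powerset.1 hT
  split_ifs with hn
  · rw [normalTerm]
    have : ∀ k, K.confKer j (n - T.card) (z - (energy K.ω T : ℂ)) (remove Q T) k = 0 := fun k =>
      confKer_of_le _ (by rw [card_remove hTQ]; omega) _ _
    simp [this]
  · rfl

theorem energy_remove_sub {Q T : Config d} (h : T ⊆ Q) (z : ℂ) :
    (energy K.ω (remove Q T) : ℂ) - (z - (energy K.ω T : ℂ)) = (energy K.ω Q : ℂ) - z := by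
  rw [energy_remove h]
  push_cast
  ring

/-- Left multiplication by the free resolvent after the spin flip. -/
theorem kerAct_freeResAt_flip {n : ℕ} (z : ℂ) {Q T : Config d} (hT : T ⊆ Q) (hn : n < Q.card)
    (A : SpinKer) (v : Spin) :
    kerAct (K.freeResAt n z Q) (matAct sigma1 (kerAct A v)) =
      kerAct (spinResolvent K.ε ((energy K.ω (remove Q T) : ℂ) - (z - (energy K.ω T : ℂ)))
        (spinFlip A)) v := by
  rw [energy_remove_sub hT, freeResAt, freeRes, if_pos hn, kerAct_spinResolvent _ _ (spinFlip A),
    kerAct_spinFlip]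

/-- The spin flip, followed by the free resolvent and the multiplication with a number. -/
noncomputable def stepCLM (K : Model d) (a : ℂ) (n : ℕ) (z : ℂ) (Q : Config d) :
    Spin →L[ℂ] Spin :=
  a • (kerAct (K.freeResAt n z Q)).comp (kerAct (spinFlip spinOne))

theorem stepCLM_apply (a : ℂ) (n : ℕ) (z : ℂ) (Q : Config d) (v : Spin) :
    K.stepCLM a n z Q v = a • kerAct (K.freeResAt n z Q) (matAct sigma1 v) := by
  rw [matAct_sigma1]; rfl

theorem stepCLM_of_le (a : ℂ) {n : ℕ} (z : ℂ) {Q : Config d} (h : ¬ n < Q.card) (v : Spin) :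
    K.stepCLM a n z Q v = 0 := by
  rw [stepCLM_apply, freeResAt, freeRes, if_neg h]
  simp

theorem kerAct_real_smul (a : ℝ) (A : SpinKer) (v : Spin) :
    kerAct (a • A) v = (a : ℂ) • kerAct A v := by
  rw [← Complex.coe_smul a A, map_smul, smul_apply]

theorem stepCLM_kerAct {n : ℕ} (a : ℝ) (z : ℂ) {Q T : Config d} (hT : T ⊆ Q) (hTn : T.card ≤ n)
    (A : SpinKer) (v : Spin) :
    K.stepCLM a n z Q (kerAct A v) = kerAct (if (remove Q T).card ≤ n - T.card then 0 else
      a • spinResolvent K.ε ((energy K.ω (remove Q T) : ℂ) - (z - (energy K.ω T : ℂ)))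
        (spinFlip A)) v := by
  have := Finset.card_le_card hT
  by_cases hn : n < Q.card
  · rw [if_neg (by rw [card_remove hT]; omega), stepCLM_apply, kerAct_freeResAt_flip z hT hn,
      kerAct_real_smul]
  · rw [if_pos (by rw [card_remove hT]; omega), stepCLM_of_le _ _ hn]
    simp

theorem stepCLM_normalAct_zero {n : ℕ} {z : ℂ} (hz : z ∈ halfPlane K.ε K.κ K.η n)
    {f : Config d → Spin} {Q : Config d} (hQ : K.IsGood f Q) :
    K.stepCLM K.α n z Q (createAct K.lam (K.normalAct n confId f z) Q) =
      K.normalAct n (K.confKer 0) f z Q := by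
  rw [createAct_normalAct hz admissible_confId hQ]
  have hadm : K.Admissible (confCreate (confId (d := d))) := by
    refine ⟨fun l m _ => if l = 1 ∧ m = 0 then spinOne else 0, fun l m z x k hx => ?_,
      fun l m => ⟨_, _, kernelBound_const _⟩⟩
    rw [confCreate_confId, card_ofTuple hx]
  refine map_normalAct hz hadm hQ _ _ fun T hT hTn k v => ?_
  rw [stepCLM_kerAct _ _ hT hTn, confCreate_confId, confKer]
  congr 2
  simp only
  by_cases h : (remove Q T).card = 1 ∧ n - T.card = 0
  · rw [if_neg (by omega), if_pos h, if_pos h]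
  · rw [if_neg h, if_neg h]
    simp [spinResolvent]

theorem stepCLM_normalAct_succ {n : ℕ} {z : ℂ} (hd : 0 < d) (hz : z ∈ halfPlane K.ε K.κ K.η n)
    {f : Config d → Spin} {Q : Config d} (hQ : K.IsGood f Q) (j : ℕ) :
    K.stepCLM (-K.α : ℝ) n z Q (K.normalAct n (K.confField (K.confKer j)) f z Q) =
      K.normalAct n (K.confKer (j + 1)) f z Q := by
  refine map_normalAct hz (admissible_confField hd j) hQ _ _ fun T hT hTn k v => ?_
  rw [stepCLM_kerAct _ _ hT hTn, confKer]

/-- The terms of the Neumann series are normally ordered operators. -/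
theorem neumann_term (hd : 0 < d) {n : ℕ} {z : ℂ} (hz : z ∈ halfPlane K.ε K.κ K.η n)
    {R₀ V : SBSpace d →L[ℂ] SBSpace d}
    (hR₀ : ∀ G, R₀ G =ᵐ[lebesguePoisson d] fun Q => kerAct (K.freeResAt n z Q) (G Q))
    (hV : ∀ G, V G =ᵐ[lebesguePoisson d] fun Q => if n < Q.card then
        matAct sigma1 (createAct K.lam (R₀ G) Q + annihilateAct K.lam (R₀ G) Q) else 0)
    {Cs : sectorEq d n →L[ℂ] sectorGt d n} (hCs : IsCStar K.α K.lam n Cs) (f : sectorEq d n)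
    (j : ℕ) :
    R₀ (((-(K.α : ℂ) • V) ^ j) (Cs f : SBSpace d)) =ᵐ[lebesguePoisson d]
      K.normalAct n (K.confKer j) (f : SBSpace d) z := by
  have hgood := ae_isGood (K := K) hd (Lp.memLp (f : SBSpace d))
  induction j with
  | zero =>
    have hf : (f : SBSpace d) =ᵐ[lebesguePoisson d]
        fun Q => if Q.card = n then (f : SBSpace d) Q else 0 := by
      filter_upwards [mem_sectorEq_iff.1 f.2] with Q hQ
      split_ifs with h
      · rfl
      · exact hQ h
    rw [pow_zero, one_apply_eq_self]
    filter_upwards [hR₀ (Cs f : SBSpace d), hCs f, hgood] with Q h1 h2 h3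
    rw [h1, h2]
    rw [← stepCLM_normalAct_zero hz h3]
    split_ifs with hn
    · rw [stepCLM_apply, map_smul]
      congr 3
      refine Finset.sum_congr rfl fun q hq => ?_
      rw [normalAct_confId]
      have := card_removePoint hq
      omega
    · rw [map_zero]
      by_cases hlt : n < Q.card
      · have : createAct K.lam (K.normalAct n confId (f : SBSpace d) z) Q = 0 := by
          rw [createAct_normalAct hz admissible_confId h3, normalAct]
          refine Finset.sum_eq_zero fun T hT => ?_
          have hTQ := Finset.mem_powerset.1 hT
          split_ifs with hTn
          · have : ∀ k, (confCreate confId (n - T.card) (z - (energy K.ω T : ℂ)) (remove Q T) k :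
                SpinKer) = 0 := fun k => by
              rw [confCreate_confId, if_neg (by rw [card_remove hTQ]; omega)]
            simp [normalTerm, this]
          · rfl
        rw [this, map_zero]
      · rw [stepCLM_of_le _ _ hlt]
  | succ j ih =>
    set G := ((-(K.α : ℂ) • V) ^ j) (Cs f : SBSpace d) with hG
    have e : ((-(K.α : ℂ) • V) ^ (j + 1)) (Cs f : SBSpace d) = -(K.α : ℂ) • V G := by
      rw [pow_succ', mul_apply_eq_comp]; rfl
    rw [e]
    filter_upwards [hR₀ (-(K.α : ℂ) • V G), Lp.coeFn_smul (-(K.α : ℂ)) (V G), hV G,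
      createAct_congr_ae hd K.lam ih, annihilateAct_congr_ae hd K.lam ih, hgood] with Q
      h1 h2 h3 h4 h5 h6
    rw [h1, h2, Pi.smul_apply, h3, h4, h5, field_normalAct hd hz (admissible_confKer hd j) h6,
      ← stepCLM_normalAct_succ hd hz h6 j]
    split_ifs with hn
    · rw [stepCLM_apply, map_smul]
      push_cast
      rfl
    · rw [stepCLM_of_le _ _ hn]
      simp

/-- The coupling operator applied to the terms of the Neumann series. -/
theorem couple_normalAct (hd : 0 < d) {n : ℕ} {z : ℂ} (hz : z ∈ halfPlane K.ε K.κ K.η n)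
    {f : Config d → Spin} {Q : Config d} (hQ : K.IsGood f Q) (hn : Q.card = n) (j : ℕ) :
    (K.α : ℂ) • matAct sigma1 (annihilateAct K.lam (K.normalAct n (K.confKer j) f z) Q) =
      K.normalAct n (K.confEff j) f z Q := by
  have h0 : createAct K.lam (K.normalAct n (K.confKer j) f z) Q = 0 := by
    refine Finset.sum_eq_zero fun q hq => ?_
    have := card_removePoint hq
    rw [normalAct_confKer_of_le j f z (by omega), smul_zero]
  have h1 := field_normalAct hd hz (admissible_confKer hd j) hQ
  rw [h0, zero_add] at h1
  rw [h1, ← kerAct_smul_spinFlip_spinOne]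
  refine map_normalAct hz (admissible_confField hd j) hQ _ _ fun T _ _ k v => ?_
  rw [kerAct_smul_spinFlip_spinOne, confEff, kerAct_real_smul, kerAct_spinFlip]

end Model

/-! ### The effective operator -/

/-- The sum of a series in `L²` agrees with its pointwise sum. -/
theorem eq_of_hasSum_Lp {X E : Type*} [MeasurableSpace X] [NormedAddCommGroup E] {μ : Measure X}
    {g : ℕ → Lp E 2 μ} {a : Lp E 2 μ} (h : HasSum g a) {P : X → Prop} {u : ℕ → X → E} {v : X → E}
    (hu : ∀ j, ∀ᵐ x ∂μ, P x → g j x = u j x)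
    (hv : ∀ᵐ x ∂μ, P x → HasSum (fun j => u j x) (v x)) : ∀ᵐ x ∂μ, P x → a x = v x := by
  obtain ⟨ns, hns, hae⟩ := (tendstoInMeasure_of_tendsto_Lp h.tendsto_sum_nat).exists_seq_tendsto_ae
  have hsum : ∀ᵐ x ∂μ, ∀ N, (∑ j ∈ Finset.range N, g j : Lp E 2 μ) x =
      ∑ j ∈ Finset.range N, g j x := ae_all_iff.2 fun N => by
    filter_upwards [Lp.coeFn_finsetSum (Finset.range N) g] with x hx
    rw [hx, Finset.sum_apply]
  filter_upwards [hae, hsum, ae_all_iff.2 hu, hv] with x h1 h2 h3 h4 hP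
  refine tendsto_nhds_unique h1 ?_
  refine ((h4 hP).tendsto_sum_nat.comp hns.tendsto_atTop).congr fun i => ?_
  rw [Function.comp_apply, h2]
  exact Finset.sum_congr rfl fun j _ => (h3 j hP).symm

namespace Model

variable {d : ℕ} {K : Model d} {m : ℕ}

/-- The kernels of the effective operator, without the factors `λ`. -/
noncomputable def confEffSum (K : Model d) : ConfigKer d :=
  fun m z S k => ∑' j, K.confEff j m z S k

/-- A geometric bound for the kernels of the terms of the effective operator. -/
noncomputable def effBound (K : Model d) (m j : ℕ) : ℝ := K.η * (K.α * K.rate m) ^ (j + 2)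

theorem summable_effBound {K : Model d} (h : K.α * K.rate m < 1) : Summable (K.effBound m) := by
  have h0 : 0 ≤ K.α * K.rate m := mul_nonneg K.α_nonneg (rate_pos m).le
  exact ((summable_nat_add_iff 2).2 (summable_geometric_of_lt_one h0 h)).mul_left _

theorem norm_confEff_le (hd : 0 < d) (j : ℕ) {S : Config d} (hS : S.card = m) {z : ℂ}
    (hz : z ∈ halfPlane K.ε K.κ K.η m) (k : Fin m → Mom d) :
    ‖K.confEff j m z S k‖ ≤ K.effBound m j := by
  subst hS
  obtain ⟨x, hx, hxS⟩ := exists_ofTuple_eq S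
  have h := represents_confEff (K := K) hd j hx z k
  rw [hxS] at h
  rw [h]
  exact (kernelBound_effKer j S.card).norm_le (p := (z, x, k)) hz

theorem hasSum_confEff (hd : 0 < d) {S : Config d} (hS : S.card = m) {z : ℂ}
    (hz : z ∈ halfPlane K.ε K.κ K.η m) (hα : K.α * K.rate m < 1) (k : Fin m → Mom d) :
    HasSum (fun j => K.confEff j m z S k) (K.confEffSum m z S k) :=
  (Summable.of_norm_bounded (summable_effBound hα)
    fun j => norm_confEff_le hd j hS hz k).hasSum

/-- The terms of the effective operator can be summed under the integral. -/
theorem hasSum_integral_confEff (hd : 0 < d) {S : Config d} (hS : S.card = m) {z : ℂ}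
    (hz : z ∈ halfPlane K.ε K.κ K.η m) (hα : K.α * K.rate m < 1) {g : (Fin m → Mom d) → Spin}
    (hg : Integrable g) :
    Integrable (fun k => kerAct (K.confEffSum m z S k) (g k)) ∧
    HasSum (fun j => ∫ k, kerAct (K.confEff j m z S k) (g k))
      (∫ k, kerAct (K.confEffSum m z S k) (g k)) := by
  have hi : ∀ j, Integrable fun k => kerAct (K.confEff j m z S k) (g k) := fun j =>
    (admissible_confEff hd j).integrable hz S hg
  have hk := norm_nonneg kerAct
  have hb : ∀ j k, ‖kerAct (K.confEff j m z S k) (g k)‖ ≤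
      K.effBound m j * (‖kerAct‖ * ‖g k‖) := fun j k => by
    refine (norm_kerAct_le _ _).trans ?_
    rw [mul_comm ‖kerAct‖, mul_assoc]
    exact mul_le_mul_of_nonneg_right (norm_confEff_le hd j hS hz k) (by positivity)
  have hs := summable_effBound hα
  have hlim : ∀ k, HasSum (fun j => kerAct (K.confEff j m z S k) (g k))
      (kerAct (K.confEffSum m z S k) (g k)) := fun k =>
    (kerAct.flip (g k)).hasSum (hasSum_confEff hd hS hz hα k)
  have hdom : Integrable fun k => ∑' j, K.effBound m j * (‖kerAct‖ * ‖g k‖) := by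
    simp only [tsum_mul_right]
    exact (hg.norm.const_mul _).const_mul _
  refine ⟨?_, hasSum_integral_of_dominated_convergence
    (fun j k => K.effBound m j * (‖kerAct‖ * ‖g k‖))
    (fun j => (hi j).1) (fun j => Eventually.of_forall (hb j))
    (Eventually.of_forall fun k => hs.mul_right _) hdom (Eventually.of_forall hlim)⟩
  refine hdom.mono' ?_ (Eventually.of_forall fun k => ?_)
  · exact aestronglyMeasurable_of_tendsto_ae atTop
      (fun N => (integrable_finsetSum (Finset.range N) fun j _ => hi j).1)
      (Eventually.of_forall fun k => (hlim k).tendsto_sum_nat)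
  · rw [← (hlim k).tsum_eq]
    exact tsum_of_norm_bounded (hs.mul_right _).hasSum fun j => hb j k

theorem rate_lt_one {n : ℕ} (hα : K.α * K.rate n < 1) (h : m ≤ n) : K.α * K.rate m < 1 :=
  (mul_le_mul_of_nonneg_left (rate_mono h) K.α_nonneg).trans_lt hα

theorem hasSum_normalAct (hd : 0 < d) {n : ℕ} {z : ℂ} (hz : z ∈ halfPlane K.ε K.κ K.η n)
    (hα : K.α * K.rate n < 1) {f : Config d → Spin} {Q : Config d} (hQ : K.IsGood f Q)
    (hn : Q.card = n) :
    HasSum (fun j => K.normalAct n (K.confEff j) f z Q) (K.normalAct n K.confEffSum f z Q) := by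
  unfold normalAct
  refine hasSum_sum fun T hT => ?_
  have hTQ := Finset.mem_powerset.1 hT
  have hTn : T.card ≤ n := (Finset.card_le_card hTQ).trans hn.le
  simp only [if_pos hTn]
  exact (hasSum_integral_confEff hd (by rw [card_remove hTQ, hn])
    (sub_energy_mem hz (by omega : T.card + (n - T.card) = n)) (rate_lt_one hα (by omega))
    (hQ T hTQ _)).2.const_smul _

/-- The resolvent, the coupling operators, and the effective operator as a normally ordered
operator. -/
theorem exists_effective (hd : 0 < d) {n : ℕ} {z : ℂ} (hz : z ∈ halfPlane K.ε K.κ K.η n)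
    (hα : K.α * K.rate n < 1) (hα' : K.α * K.fieldNorm n < 1) :
    ∃ (R : sectorGt d n →L[ℂ] sectorGt d n) (C : sectorGt d n →L[ℂ] sectorEq d n)
      (Cs : sectorEq d n →L[ℂ] sectorGt d n),
      IsResolventB K.ε K.α K.ω K.lam n z R ∧ IsC K.α K.lam n C ∧ IsCStar K.α K.lam n Cs ∧
      ∀ f : sectorEq d n, ∀ᵐ Q ∂(lebesguePoisson d), Q.card = n →
        (C (R (Cs f)) : SBSpace d) Q = K.normalAct n K.confEffSum (f : SBSpace d) z Q := by
  obtain ⟨R₀, V, hR₀, hV, hVn⟩ := exists_operators K hd hz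
  obtain ⟨R, hR, hRs⟩ := exists_resolvent hd hz hα' hR₀ hV hVn
  obtain ⟨C, hC⟩ := exists_isC hd K.lam_continuous K.lam_memLp K.α n
  obtain ⟨Cs, hCs⟩ := exists_isCStar hd K.lam_continuous K.lam_memLp K.α n
  refine ⟨R, C, Cs, hR, hC, hCs, fun f => ?_⟩
  have hmem : ∀ G, R₀ G ∈ sectorGt d n := fun G => by
    rw [mem_sectorGt_iff]
    filter_upwards [hR₀ G] with Q hQ hn
    rw [hQ, freeResAt, freeRes, if_neg hn]
    simp
  set Ψ : ℕ → sectorGt d n := fun j =>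
    ⟨R₀ (((-(K.α : ℂ) • V) ^ j) (Cs f : SBSpace d)), hmem _⟩ with hΨ
  have hsum : HasSum Ψ (R (Cs f)) :=
    (Topology.IsInducing.subtypeVal.hasSum_iff (g := (sectorGt d n).subtype) Ψ _).1 (hRs (Cs f))
  have hsum' : HasSum (fun j => (C (Ψ j) : SBSpace d)) (C (R (Cs f)) : SBSpace d) :=
    ((sectorEq d n).subtypeL ∘L C).hasSum hsum
  have hgood := ae_isGood (K := K) hd (Lp.memLp (f : SBSpace d))
  refine eq_of_hasSum_Lp hsum' (u := fun j => K.normalAct n (K.confEff j) (f : SBSpace d) z)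
    (fun j => ?_) ?_
  · filter_upwards [hC (Ψ j), hgood,
      annihilateAct_congr_ae hd K.lam (neumann_term hd hz hR₀ hV hCs f j)] with Q h1 h2 h3 hn
    rw [h1, if_pos hn, ← couple_normalAct hd hz h2 hn, ← h3]
  · filter_upwards [hgood] with Q hQ hn
    exact hasSum_normalAct hd hz hα hQ hn

/-- The kernels of the effective operator. -/
noncomputable def fullKernel (K : Model d) (m : ℕ) (z : ℂ) (Q₁ Q₂ : Config d)
    (k : Fin m → Mom d) : SpinKer :=
  ((∏ q ∈ Q₁, K.lam q) * ∏ i, conj (K.lam (k i))) •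
    K.confEffSum m (z - (energy K.ω Q₂ : ℂ)) Q₁ k

theorem kerAct_fullKernel (m : ℕ) (z : ℂ) (Q₁ Q₂ : Config d) (f : Config d → Spin)
    (k : Fin m → Mom d) :
    kerAct (K.fullKernel m z Q₁ Q₂ k) (f (addTuple Q₂ k)) = (∏ q ∈ Q₁, K.lam q) •
      kerAct (K.confEffSum m (z - (energy K.ω Q₂ : ℂ)) Q₁ k) (K.absorb f Q₂ m k) := by
  rw [fullKernel, absorb, map_smul, map_smul, smul_apply, smul_smul]

theorem remove_remove {Q Q₁ : Config d} (h : Q₁ ⊆ Q) : remove Q (remove Q Q₁) = Q₁ := by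
  rw [remove, remove, Finset.sdiff_sdiff_eq_self h]

theorem integrable_fullKernel (hd : 0 < d) {n : ℕ} {z : ℂ} (hz : z ∈ halfPlane K.ε K.κ K.η n)
    (hα : K.α * K.rate n < 1) {f : Config d → Spin} {Q : Config d} (hQ : K.IsGood f Q)
    (hn : Q.card = n) {Q₁ : Config d} (h₁ : Q₁ ∈ Q.powersetCard m) :
    Integrable fun k : Fin m → Mom d =>
      kerAct (K.fullKernel m z Q₁ (remove Q Q₁) k) (f (addTuple (remove Q Q₁) k)) := by
  obtain ⟨hs, hc⟩ := Finset.mem_powersetCard.1 h₁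
  have hle := Finset.card_le_card hs
  have hcr := card_remove hs
  simp only [kerAct_fullKernel]
  exact ((hasSum_integral_confEff hd hc (sub_energy_mem hz (by omega))
    (rate_lt_one hα (by omega)) (hQ (remove Q Q₁) Finset.sdiff_subset m)).1).fun_smul _

/-- The normally ordered operator as a multiplication operator and a sum of integral operators. -/
theorem normalAct_confEffSum {n : ℕ} (f : Config d → Spin) (z : ℂ) {Q : Config d}
    (hn : Q.card = n) :
    K.normalAct n K.confEffSum f z Q =
      kerAct (K.confEffSum 0 (z - (energy K.ω Q : ℂ)) ∅ Fin.elim0) (f Q) +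
      ∑ m ∈ Finset.Icc 1 n, ∑ Q₁ ∈ Q.powersetCard m, ∫ k : Fin m → Mom d,
        kerAct (K.fullKernel m z Q₁ (remove Q Q₁) k) (f (addTuple (remove Q Q₁) k)) := by
  have h1 : K.normalAct n K.confEffSum f z Q =
      ∑ Q₁ ∈ Q.powerset, K.normalTerm K.confEffSum f z Q (remove Q Q₁) Q₁.card := by
    rw [normalAct]
    refine Finset.sum_nbij' (fun T => remove Q T) (fun T => remove Q T) ?_ ?_ ?_ ?_ ?_
    · intro T _; exact Finset.mem_powerset.2 Finset.sdiff_subset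
    · intro T _; exact Finset.mem_powerset.2 Finset.sdiff_subset
    · intro T hT; exact remove_remove (Finset.mem_powerset.1 hT)
    · intro T hT; exact remove_remove (Finset.mem_powerset.1 hT)
    · intro T hT
      have hTQ := Finset.mem_powerset.1 hT
      have := Finset.card_le_card hTQ
      rw [if_pos (by omega), remove_remove hTQ, card_remove hTQ, hn]
  rw [h1, Finset.sum_powerset, hn, Finset.sum_range_eq_add_Ico _ (by omega),
    Finset.powersetCard_zero, Finset.sum_singleton, Finset.card_empty]
  congr 1
  · rw [show remove Q ∅ = Q by simp [remove], normalTerm_self]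
  · refine Finset.sum_congr (by ext; simp only [Finset.mem_Ico, Finset.mem_Icc]; omega) fun m hm =>
      Finset.sum_congr rfl fun Q₁ hQ₁ => ?_
    obtain ⟨hs, hc⟩ := Finset.mem_powersetCard.1 hQ₁
    subst hc
    simp only [kerAct_fullKernel]
    rw [normalTerm, remove_remove hs, integral_smul]

end Model

/-! ### Bounds for the kernels of the effective operator -/

namespace Model

variable {d : ℕ} {K : Model d} {m : ℕ}

/-- The kernels of the effective operator in coordinates, without the factors `λ`. -/
noncomputable def effSum (K : Model d) (m : ℕ) (p : KerArg d m m) : SpinKer :=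
  ∑' j, K.effKer j m p

theorem confEffSum_ofTuple (hd : 0 < d) {x : Fin m → Mom d} (hx : Function.Injective x) (z : ℂ)
    (k : Fin m → Mom d) : K.confEffSum m z (ofTuple x) k = K.effSum m (z, x, k) :=
  tsum_congr fun j => represents_confEff hd j hx z k

/-- A term with `m ≥ 1` external momenta contains at least `m + 1` powers of the coupling constant;
exactly `m + 1` occur only in the leading term for `m = 1`. -/
theorem kernelBound_effKer_geometric (hρ : K.α * K.rate m ≤ 1 / 4) (j : ℕ) :
    K.KernelBound (K.effKer j m)
      ((if j = 0 then K.η * (K.α / K.η) ^ (m + 1) else 0) +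
        K.η * 4 ^ m * (K.α * K.rate m) ^ (m + 2) * (1 / 2) ^ j)
      ((if j = 0 then K.η * (K.α / K.η) ^ (m + 1) else 0) +
        K.η * 4 ^ m * (K.α * K.rate m) ^ (m + 2) * (1 / 2) ^ j) := by
  have hα := K.α_nonneg
  have hη := K.η_pos
  set t := K.α * K.rate m with ht
  have ht0 : 0 ≤ t := mul_nonneg hα (rate_pos m).le
  have hlead : 0 ≤ (if j = 0 then K.η * (K.α / K.η) ^ (m + 1) else 0 : ℝ) := by
    split_ifs <;> positivity
  have htail : 0 ≤ K.η * 4 ^ m * t ^ (m + 2) * (1 / 2) ^ j := by positivity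
  by_cases hj : m ≤ j
  · obtain ⟨i, rfl⟩ := Nat.exists_eq_add_of_le hj
    have h2 : ((m + i : ℕ) + 1 : ℝ) ≤ 2 ^ (m + i) := by
      exact_mod_cast Nat.lt_two_pow_self
    have h3 : (((m + i : ℕ) : ℝ) + 1) * t ^ (m + i + 2) ≤
        4 ^ m * t ^ (m + 2) * (1 / 2) ^ (m + i) :=
      calc (((m + i : ℕ) : ℝ) + 1) * t ^ (m + i + 2)
          = (((m + i : ℕ) : ℝ) + 1) * t ^ (m + 2) * t ^ i := by ring
        _ ≤ 2 ^ (m + i) * t ^ (m + 2) * (1 / 4) ^ i := by gcongr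
        _ = 4 ^ m * t ^ (m + 2) * (1 / 2) ^ (m + i) := by
            have e4 : (4 : ℝ) ^ m = 2 ^ m * 2 ^ m := by rw [← mul_pow]; norm_num
            have e5 : (1 / 4 : ℝ) ^ i = (1 / 2) ^ i * (1 / 2) ^ i := by rw [← mul_pow]; norm_num
            rw [e4, e5, pow_add (2 : ℝ) m i, pow_add (1 / 2 : ℝ) m i]
            have : (2 : ℝ) ^ i * (1 / 2) ^ i = 1 := by rw [← mul_pow]; norm_num
            have h' : (2 : ℝ) ^ m * (1 / 2) ^ m = 1 := by rw [← mul_pow]; norm_num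
            linear_combination (2 ^ m * t ^ m * t ^ 2 * (1 / 2) ^ i) * this -
              (2 ^ m * t ^ m * t ^ 2 * (1 / 2) ^ i) * h'
    have h4 : K.η * (((m + i : ℕ) + 1) * t ^ (m + i + 2)) ≤
        K.η * 4 ^ m * t ^ (m + 2) * (1 / 2) ^ (m + i) := by
      calc _ ≤ K.η * (4 ^ m * t ^ (m + 2) * (1 / 2) ^ (m + i)) := by gcongr
        _ = _ := by ring
    have h5 : K.η * t ^ (m + i + 2) ≤ K.η * (((m + i : ℕ) + 1) * t ^ (m + i + 2)) := by
      gcongr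
      exact le_mul_of_one_le_left (by positivity) (by
        have : (0 : ℝ) ≤ ((m + i : ℕ) : ℝ) := Nat.cast_nonneg _
        linarith)
    exact (kernelBound_effKer (m + i) m).mono (by linarith) (by linarith)
  · by_cases h : j = 0 ∧ m = 1
    · obtain ⟨rfl, rfl⟩ := h
      have e : K.α ^ 2 / K.η = K.η * (K.α / K.η) ^ (1 + 1) := by rw [div_pow]; field_simp; ring
      refine kernelBound_effKer_zero_one.mono ?_ ?_ <;>
      · rw [if_pos rfl, ← e]
        exact le_add_of_nonneg_right htail
    · have : K.effKer j m = fun _ => 0 := by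
        funext p
        exact effKer_of_lt j p (by omega)
      rw [this]
      exact (kernelBound_const 0).mono (by rw [norm_zero]; positivity) (by positivity)

/-- The bound for the kernels of the effective operator. -/
noncomputable def effSize (K : Model d) (m : ℕ) : ℝ :=
  K.η * (K.α / K.η) ^ (m + 1) + K.η * 4 ^ m * (K.α * K.rate m) ^ (m + 2) * 2

theorem kernelBound_effSum (hρ : K.α * K.rate m ≤ 1 / 4) :
    K.KernelBound (K.effSum m) (K.effSize m) (K.effSize m) := by
  have hα := K.α_nonneg
  have hη := K.η_pos
  have ht0 : 0 ≤ K.α * K.rate m := mul_nonneg hα (rate_pos m).le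
  have hs : HasSum (fun j : ℕ => (if j = 0 then K.η * (K.α / K.η) ^ (m + 1) else 0) +
      K.η * 4 ^ m * (K.α * K.rate m) ^ (m + 2) * (1 / 2) ^ j) (K.effSize m) :=
    (hasSum_ite_eq 0 _).add (hasSum_geometric_two.mul_left _)
  have h := kernelBound_tsum (K := K) (fun j => kernelBound_effKer_geometric hρ j) hs.summable
    (fun j => by
      have : 0 ≤ (if j = 0 then K.η * (K.α / K.η) ^ (m + 1) else 0 : ℝ) := by
        split_ifs <;> positivity
      positivity) hs.summable
  rw [hs.tsum_eq] at h
  exact h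

/-- For small coupling the leading term dominates. -/
theorem effSize_le (h : K.α * (4 * 4 ^ m * K.rate m ^ (m + 2) * K.η ^ (m + 1)) ≤ 1) :
    K.effSize m ≤ 2 * K.η * (K.α / K.η) ^ (m + 1) := by
  have hα := K.α_nonneg
  have hη := K.η_pos
  have h0 : 0 ≤ (K.α / K.η) ^ (m + 1) := by positivity
  have h1 : 4 ^ m * (K.α * K.rate m) ^ (m + 2) * 2 ≤ (K.α / K.η) ^ (m + 1) :=
    calc 4 ^ m * (K.α * K.rate m) ^ (m + 2) * 2
        = (K.α * (4 * 4 ^ m * K.rate m ^ (m + 2) * K.η ^ (m + 1))) / 2 * (K.α / K.η) ^ (m + 1) := by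
          rw [div_pow, mul_pow, pow_succ K.α (m + 1)]
          field_simp
          ring
      _ ≤ 1 * (K.α / K.η) ^ (m + 1) := by
          gcongr
          linarith
      _ = _ := one_mul _
  unfold effSize
  nlinarith

/-- The multiplication term is proportional to the square of the norm of the form factor. -/
theorem norm_effSum_zero_le (hρ : K.α * K.rate 0 ≤ 1 / 4)
    (h : K.α * (4 * K.rate 0 ^ 2 * K.η) ≤ 1) {z : ℂ} (hz : z ∈ halfPlane K.ε K.κ K.η 0)
    (x k : Fin 0 → Mom d) : ‖K.effSum 0 (z, x, k)‖ ≤ 2 * (K.α ^ 2 / K.η) * K.mass := by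
  have hα := K.α_nonneg
  have hη := K.η_pos
  have hM := K.mass_nonneg
  set t := K.α * K.rate 0 with ht
  have ht0 : 0 ≤ t := mul_nonneg hα (rate_pos 0).le
  have hker : ∀ j, ∀ p ∈ K.dom 1 0, ‖K.ker j 1 0 p‖ ≤
      (if j = 0 then K.α / K.η else 0) + 2 * t ^ 2 * (1 / 2) ^ j := by
    intro j p hp
    cases j with
    | zero =>
      rw [if_pos rfl]
      have := kernelBound_ker_zero.norm_le hp
      have : 0 ≤ 2 * t ^ 2 * (1 / 2) ^ 0 := by positivity
      linarith
    | succ j =>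
      rw [if_neg (Nat.succ_ne_zero j), zero_add]
      refine ((kernelBound_ker (j + 1) 1 0).norm_le hp).trans ?_
      rw [← ht]
      calc t ^ (j + 1 + 1) = t ^ 2 * t ^ j := by ring
        _ ≤ t ^ 2 * (1 / 2) ^ j := by
            gcongr
            linarith
        _ = _ := by rw [pow_succ]; ring
  have hs : HasSum (fun j : ℕ => (if j = 0 then K.α / K.η else 0) + 2 * t ^ 2 * (1 / 2) ^ j)
      (K.α / K.η + 2 * t ^ 2 * 2) := (hasSum_ite_eq 0 _).add (hasSum_geometric_two.mul_left _)
  have heff : ∀ j, ‖K.effKer j 0 (z, x, k)‖ ≤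
      ((if j = 0 then K.α / K.η else 0) + 2 * t ^ 2 * (1 / 2) ^ j) * (K.α * K.mass) := by
    intro j
    have e : K.effKer j 0 (z, x, k) =
        K.α • spinFlip (∫ q, K.ker j 1 0 (consArg q (z, x, k)) ∂K.coupling) := by
      rw [effKer, fieldPart, createPart_ker_self]
      simp [tailPart]
    rw [e, norm_smul, norm_spinFlip, Real.norm_of_nonneg hα]
    have := norm_integral_le_of_norm_le_const (μ := K.coupling)
      (Eventually.of_forall fun q => hker j (consArg q (z, x, k)) hz)
    rw [coupling_real_univ] at this
    calc _ ≤ K.α * (((if j = 0 then K.α / K.η else 0) + 2 * t ^ 2 * (1 / 2) ^ j) * K.mass) := by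
          gcongr
      _ = _ := by ring
  refine (tsum_of_norm_bounded (hs.mul_right _) heff).trans ?_
  have h1 : 2 * t ^ 2 * 2 ≤ K.α / K.η := by
    rw [le_div_iff₀ hη, ht]
    calc _ = K.α * (K.α * (4 * K.rate 0 ^ 2 * K.η)) := by ring
      _ ≤ K.α * 1 := by gcongr
      _ = _ := mul_one _
  calc _ ≤ (K.α / K.η + K.α / K.η) * (K.α * K.mass) := by gcongr
    _ = _ := by ring

/-! ### Analyticity -/

theorem KernelBound.differentiableOn {l : ℕ} {G : KerArg d l m → SpinKer} {A B : ℝ}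
    (h : K.KernelBound G A B) (x : Fin l → Mom d) (k : Fin m → Mom d) :
    DifferentiableOn ℂ (fun z => G (z, x, k)) (halfPlane K.ε K.κ K.η m) := by
  obtain ⟨G', hG⟩ := h
  intro z hz
  have hp : ((z, x, k) : KerArg d l m) ∈ K.dom l m := hz
  have h1 : HasFDerivAt (fun ζ : ℂ => ((ζ, x, k) : KerArg d l m))
      (ContinuousLinearMap.inl ℝ ℂ ((Fin l → Mom d) × (Fin m → Mom d))) z :=
    hasFDerivAt_prodMk_left z (x, k)
  have h2 := (hG.hasFDerivAt _ hp).comp z h1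
  refine (hasFDerivAt_of_restrictScalars ℝ h2 (f' := ContinuousLinearMap.toSpanSingleton ℂ
    (G' (z, x, k) (1, 0, 0))) ?_).differentiableAt.differentiableWithinAt
  ext1 ζ
  change ζ • G' (z, x, k) (1, 0, 0) = G' (z, x, k) (ζ, 0, 0)
  exact (hG.complex _ hp ζ).symm

theorem analyticOnNhd_fullKernel (hd : 0 < d) {n : ℕ} (hρ : K.α * K.rate m ≤ 1 / 4)
    {Q₁ Q₂ : Config d} (h₁ : Q₁.card = m) (h₂ : Q₂.card + m = n) (k : Fin m → Mom d) :
    AnalyticOnNhd ℂ (fun z => K.fullKernel m z Q₁ Q₂ k) (halfPlane K.ε K.κ K.η n) := by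
  subst h₁
  obtain ⟨x, hx, hxQ⟩ := exists_ofTuple_eq Q₁
  refine DifferentiableOn.analyticOnNhd ?_ (isOpen_halfPlane _ _ _ _)
  have e : ∀ z, K.fullKernel Q₁.card z Q₁ Q₂ k = ((∏ q ∈ Q₁, K.lam q) * ∏ i, conj (K.lam (k i))) •
      K.effSum Q₁.card (z - (energy K.ω Q₂ : ℂ), x, k) := fun z => by
    rw [fullKernel, ← confEffSum_ofTuple hd hx, hxQ]
  simp only [e]
  have hdiff : DifferentiableOn ℂ
      (fun z => K.effSum Q₁.card (z - (energy K.ω Q₂ : ℂ), x, k)) (halfPlane K.ε K.κ K.η n) :=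
    ((kernelBound_effSum hρ).differentiableOn x k).comp
      (g := fun z => K.effSum Q₁.card (z, x, k)) (f := fun z => z - (energy K.ω Q₂ : ℂ))
      (differentiableOn_id.sub_const _) fun z hz => sub_energy_mem hz h₂
  exact hdiff.fun_const_smul _

end Model

/-! ### First-order bounds in coordinates -/

/-- The product rule for a product of functions whose logarithmic derivatives are bounded. -/
theorem exists_hasFDerivAt_prod {ι E : Type*} [Fintype ι] [NormedAddCommGroup E] [NormedSpace ℝ E]
    {u : ι → E → ℂ} {u' : ι → E →L[ℝ] ℂ} {p : E} (hu : ∀ i, HasFDerivAt (u i) (u' i) p)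
    {b : ι → ℝ} {c : E → ι → ℝ} (hb : ∀ i, ‖u i p‖ ≤ b i) (hc : ∀ i v, ‖u' i v‖ ≤ b i * c v i) :
    ∃ D : E →L[ℝ] ℂ, HasFDerivAt (fun q => ∏ i, u i q) D p ∧
      ∀ v, ‖D v‖ ≤ (∏ i, b i) * ∑ i, c v i := by
  classical
  refine ⟨_, HasFDerivAt.finsetProd fun i _ => hu i, fun v => ?_⟩
  rw [sum_apply, Finset.mul_sum]
  refine norm_sum_le_of_le _ fun i _ => ?_
  rw [smul_apply, norm_smul, norm_prod]
  have h1 : ∏ j ∈ Finset.univ.erase i, ‖u j p‖ ≤ ∏ j ∈ Finset.univ.erase i, b j :=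
    Finset.prod_le_prod (fun _ _ => norm_nonneg _) fun j _ => hb j
  have h2 : 0 ≤ ∏ j ∈ Finset.univ.erase i, b j :=
    Finset.prod_nonneg fun j _ => (norm_nonneg _).trans (hb j)
  calc _ ≤ (∏ j ∈ Finset.univ.erase i, b j) * (b i * c v i) :=
        mul_le_mul h1 (hc i v) (norm_nonneg _) h2
    _ = _ := by rw [← mul_assoc, Finset.prod_erase_mul _ _ (Finset.mem_univ i)]

/-- The coordinates of the outgoing momenta, the spectators and the incoming momenta. -/
abbrev Coords (d l m : ℕ) : Type := (Fin m → Mom d) × (Fin l → Mom d) × (Fin m → Mom d)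

namespace Model

variable {d : ℕ} {K : Model d} {l m : ℕ}

/-- The product of the form factors of the external momenta. -/
noncomputable def formFactor (K : Model d) (p : Coords d l m) : ℂ :=
  (∏ i, K.lam (p.1 i)) * ∏ i, conj (K.lam (p.2.2 i))

/-- The sum of the lengths of the components of a tangent vector. -/
noncomputable def coordNorm (v : Coords d l m) : ℝ :=
  ∑ i, ‖v.1 i‖ + ∑ i, ‖v.2.1 i‖ + ∑ i, ‖v.2.2 i‖

/-- The `i`-th outgoing or incoming momentum. -/
noncomputable def externalCLM : Fin m ⊕ Fin m → Coords d l m →L[ℝ] Mom d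
  | .inl i => (ContinuousLinearMap.proj i).comp (ContinuousLinearMap.fst ℝ (Fin m → Mom d) _)
  | .inr i => (ContinuousLinearMap.proj i).comp ((ContinuousLinearMap.snd ℝ (Fin l → Mom d) _).comp
      (ContinuousLinearMap.snd ℝ (Fin m → Mom d) _))

/-- The form factor of the `i`-th outgoing or incoming momentum. -/
noncomputable def externalFactor (K : Model d) : Fin m ⊕ Fin m → Mom d → ℂ
  | .inl _ => K.lam
  | .inr _ => fun q => conj (K.lam q)

theorem formFactor_eq (p : Coords d l m) :
    K.formFactor p = ∏ i, K.externalFactor i (externalCLM i p) := by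
  rw [Fintype.prod_sum_type]; rfl

theorem exists_hasFDerivAt_formFactor (hlam : ContDiff ℝ 1 K.lam) {h : Mom d → ℝ}
    (hle : ∀ q, ‖K.lam q‖ ≤ h q) {C : ℝ} (hderiv : ∀ q, ‖fderiv ℝ K.lam q‖ ≤ C * h q)
    (p : Coords d l m) :
    ‖K.formFactor p‖ ≤ (∏ i, h (p.1 i)) * ∏ i, h (p.2.2 i) ∧
    ∃ D : Coords d l m →L[ℝ] ℂ, HasFDerivAt K.formFactor D p ∧
      ∀ v, ‖D v‖ ≤ ((∏ i, h (p.1 i)) * ∏ i, h (p.2.2 i)) *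
        (C * (∑ i, ‖v.1 i‖ + ∑ i, ‖v.2.2 i‖)) := by
  have hl : ∀ q, HasFDerivAt K.lam (fderiv ℝ K.lam q) q := fun q =>
    (hlam.differentiable one_ne_zero q).hasFDerivAt
  have hconj : ∀ q, HasFDerivAt (fun q => conj (K.lam q))
      ((Complex.conjCLE : ℂ →L[ℝ] ℂ).comp (fderiv ℝ K.lam q)) q := fun q =>
    (Complex.conjCLE : ℂ →L[ℝ] ℂ).hasFDerivAt.comp q (hl q)
  have hex : ∀ i : Fin m ⊕ Fin m, ∃ u' : Coords d l m →L[ℝ] ℂ,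
      HasFDerivAt (fun p => K.externalFactor i (externalCLM i p)) u' p ∧
      ∀ v, ‖u' v‖ ≤ h (externalCLM i p) * (C * ‖externalCLM i v‖) := by
    intro i
    have hbd : ∀ v : Coords d l m, ‖fderiv ℝ K.lam (externalCLM i p) (externalCLM i v)‖ ≤
        h (externalCLM i p) * (C * ‖externalCLM i v‖) := fun v => by
      refine (ContinuousLinearMap.le_opNorm _ _).trans ?_
      refine (mul_le_mul_of_nonneg_right (hderiv _) (norm_nonneg _)).trans_eq ?_
      ring
    cases i with
    | inl i => exact ⟨_, (hl _).comp p (externalCLM (Sum.inl i)).hasFDerivAt, hbd⟩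
    | inr i =>
      refine ⟨_, (hconj _).comp p (externalCLM (Sum.inr i)).hasFDerivAt, fun v => ?_⟩
      refine le_trans (le_of_eq ?_) (hbd v)
      exact RCLike.norm_conj _
  choose u' hu' hub using hex
  have hb : ∀ i : Fin m ⊕ Fin m, ‖K.externalFactor i (externalCLM i p)‖ ≤ h (externalCLM i p) := by
    rintro (i | i)
    · exact hle _
    · exact (RCLike.norm_conj _).trans_le (hle _)
  have hH : ∏ i : Fin m ⊕ Fin m, h (externalCLM i p) = (∏ i, h (p.1 i)) * ∏ i, h (p.2.2 i) := by
    rw [Fintype.prod_sum_type]; rfl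
  obtain ⟨D, hD, hDv⟩ := exists_hasFDerivAt_prod hu' (c := fun v i => C * ‖externalCLM i v‖) hb hub
  refine ⟨?_, D, ?_, fun v => ?_⟩
  · rw [formFactor_eq, ← hH, norm_prod]
    exact Finset.prod_le_prod (fun _ _ => norm_nonneg _) fun i _ => hb i
  · have e : (K.formFactor : Coords d l m → ℂ) =
        fun p => ∏ i, K.externalFactor i (externalCLM i p) := funext formFactor_eq
    rw [e]
    exact hD
  · refine (hDv v).trans_eq ?_
    rw [hH, ← Finset.mul_sum, Fintype.sum_sum_type]
    rfl

/-- The argument of the kernel with the spectators absorbed in the spectral parameter. -/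
noncomputable def spectatorArg (K : Model d) (z : ℂ) (p : Coords d l m) : KerArg d m m :=
  (z - ((∑ i, K.ω (p.2.1 i) : ℝ) : ℂ), p.1, p.2.2)

/-- The `i`-th spectator. -/
noncomputable def spectatorCLM (i : Fin l) : Coords d l m →L[ℝ] Mom d :=
  (ContinuousLinearMap.proj i).comp ((ContinuousLinearMap.fst ℝ (Fin l → Mom d) _).comp
      (ContinuousLinearMap.snd ℝ (Fin m → Mom d) _))

theorem exists_hasFDerivAt_spectatorArg (z : ℂ) (p : Coords d l m) :
    ∃ D : Coords d l m →L[ℝ] KerArg d m m, HasFDerivAt (K.spectatorArg z) D p ∧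
      ∀ v, D v = (-((∑ i, fderiv ℝ K.ω (p.2.1 i) (v.2.1 i) : ℝ) : ℂ), v.1, v.2.2) := by
  have hω : ∀ i, HasFDerivAt K.ω (fderiv ℝ K.ω (p.2.1 i)) (spectatorCLM i p) := fun i =>
    (K.ω_contDiff.differentiable one_ne_zero _).hasFDerivAt
  have h1 := HasFDerivAt.fun_sum (u := Finset.univ) fun i _ =>
    (hω i).comp p (spectatorCLM (m := m) i).hasFDerivAt
  have h2 := (Complex.ofRealCLM.hasFDerivAt.comp p h1).const_sub z
  have h3 := h2.prodMk ((hasFDerivAt_fst (𝕜 := ℝ) (p := p)).prodMk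
    ((hasFDerivAt_snd (𝕜 := ℝ) (p := p.2)).comp p (hasFDerivAt_snd (𝕜 := ℝ) (p := p))))
  refine ⟨_, h3, fun v => ?_⟩
  simp [spectatorCLM]

theorem gap_spectatorArg {n : ℕ} (hn : l + m = n) (z : ℂ) (p : Coords d l m) :
    K.gap m (K.spectatorArg z p).1 = K.gap n z + ∑ i, (K.ω (p.2.1 i) - K.κ) := by
  subst hn
  simp only [gap, spectatorArg, Complex.sub_re, Complex.ofReal_re, Finset.sum_sub_distrib,
    Finset.sum_const, Finset.card_univ, Fintype.card_fin, nsmul_eq_mul]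
  push_cast
  ring

theorem spectatorArg_mem {n : ℕ} (hn : l + m = n) {z : ℂ} (hz : z ∈ halfPlane K.ε K.κ K.η n)
    (p : Coords d l m) : K.spectatorArg z p ∈ K.dom m m := by
  rw [mem_dom_iff, gap_spectatorArg hn]
  have := mem_halfPlane_iff.1 hz
  have := sum_excess_nonneg (K := K) p.2.1
  linarith

/-- The distance to the threshold grows with the energy of the spectators, which compensates the
gradient of the dispersion relation. -/
theorem dirNorm_spectatorArg_le {n : ℕ} (hn : l + m = n) {z : ℂ}
    (hz : z ∈ halfPlane K.ε K.κ K.η n) (p v : Coords d l m) :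
    K.dirNorm (K.spectatorArg z p)
      (-((∑ i, fderiv ℝ K.ω (p.2.1 i) (v.2.1 i) : ℝ) : ℂ), v.1, v.2.2) ≤ K.c * coordNorm v := by
  have hg := gap_pos (spectatorArg_mem hn hz p)
  have hc := K.c_nonneg
  have h1 : ‖-((∑ i, fderiv ℝ K.ω (p.2.1 i) (v.2.1 i) : ℝ) : ℂ)‖ ≤
      K.gap m (K.spectatorArg z p).1 * (K.c * ∑ i, ‖v.2.1 i‖) := by
    rw [norm_neg, Complex.norm_real, Finset.mul_sum, Finset.mul_sum]
    refine norm_sum_le_of_le _ fun i _ => (ContinuousLinearMap.le_opNorm _ _).trans ?_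
    have h2 : K.ω (p.2.1 i) - K.κ + K.η ≤ K.gap m (K.spectatorArg z p).1 := by
      have := Finset.single_le_sum (f := fun i => K.ω (p.2.1 i) - K.κ)
        (fun i _ => sub_nonneg.2 (K.κ_le _)) (Finset.mem_univ i)
      rw [gap_spectatorArg hn]
      have := mem_halfPlane_iff.1 hz
      linarith
    calc _ ≤ (K.c * K.gap m (K.spectatorArg z p).1) * ‖v.2.1 i‖ :=
          mul_le_mul_of_nonneg_right ((K.fderiv_ω_le _).trans
            (mul_le_mul_of_nonneg_left h2 hc)) (norm_nonneg _)
      _ = _ := by ring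
  have h3 := div_le_of_le_mul₀ hg.le (by positivity) (h1.trans_eq (mul_comm _ _))
  unfold dirNorm coordNorm
  simp only
  calc _ ≤ K.c * ∑ i, ‖v.2.1 i‖ + K.c * (∑ i, ‖v.1 i‖ + ∑ i, ‖v.2.2 i‖) := by gcongr
    _ = _ := by ring

/-- A kernel of the effective operator in coordinates. -/
noncomputable def coordKernel (K : Model d) (l m : ℕ) (z : ℂ) (p : Coords d l m) : SpinKer :=
  K.formFactor p • K.effSum m (K.spectatorArg z p)

theorem coordKernel_bound {n : ℕ} (hn : l + m = n) {z : ℂ}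
    (hz : z ∈ halfPlane K.ε K.κ K.η n) (hlam : ContDiff ℝ 1 K.lam) {h : Mom d → ℝ}
    (hpos : ∀ q, 0 ≤ h q) (hle : ∀ q, ‖K.lam q‖ ≤ h q) {C : ℝ} (hC : 0 ≤ C)
    (hderiv : ∀ q, ‖fderiv ℝ K.lam q‖ ≤ C * h q)
    {A B : ℝ} (hB : 0 ≤ B) (hS : K.KernelBound (K.effSum m) A B) (p : Coords d l m) :
    ‖K.coordKernel l m z p‖ ≤ ((∏ i, h (p.1 i)) * ∏ i, h (p.2.2 i)) * A ∧
    ∀ v, ‖fderiv ℝ (K.coordKernel l m z) p v‖ ≤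
      ((∏ i, h (p.1 i)) * ∏ i, h (p.2.2 i)) * (C * A + B * K.c) * coordNorm v := by
  obtain ⟨ha, D, hD, hDv⟩ := exists_hasFDerivAt_formFactor hlam hle hderiv p
  obtain ⟨L, hL, hLv⟩ := exists_hasFDerivAt_spectatorArg (K := K) z p
  have hmem := spectatorArg_mem (K := K) hn hz p
  set H := (∏ i, h (p.1 i)) * ∏ i, h (p.2.2 i) with hH
  have hH0 : 0 ≤ H := mul_nonneg (Finset.prod_nonneg fun _ _ => hpos _)
    (Finset.prod_nonneg fun _ _ => hpos _)
  have hA := hS.norm_le hmem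
  have hA0 : 0 ≤ A := (norm_nonneg _).trans hA
  obtain ⟨G', hG⟩ := hS
  refine ⟨?_, fun v => ?_⟩
  · rw [coordKernel, norm_smul]
    exact mul_le_mul ha hA (norm_nonneg _) hH0
  · have hd1 := hD.smul ((hG.hasFDerivAt _ hmem).comp p hL)
    have e : fderiv ℝ (K.coordKernel l m z) p v =
        K.formFactor p • G' (K.spectatorArg z p) (L v) + D v • K.effSum m (K.spectatorArg z p) := by
      have hd2 : HasFDerivAt (K.coordKernel l m z) _ p := hd1
      rw [hd2.fderiv]
      rfl
    have h1 : ‖G' (K.spectatorArg z p) (L v)‖ ≤ B * (K.c * coordNorm v) := by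
      refine (hG.deriv_le _ hmem _).trans (mul_le_mul_of_nonneg_left ?_ hB)
      rw [hLv]
      exact dirNorm_spectatorArg_le hn hz p v
    have h2 : ‖D v‖ ≤ H * (C * coordNorm v) := by
      refine (hDv v).trans ?_
      have : 0 ≤ ∑ i, ‖v.2.1 i‖ := by positivity
      unfold coordNorm
      gcongr
      linarith
    have h0 : 0 ≤ coordNorm v := by unfold coordNorm; positivity
    rw [e]
    refine (norm_add_le _ _).trans ?_
    rw [norm_smul, norm_smul]
    calc _ ≤ H * (B * (K.c * coordNorm v)) + H * (C * coordNorm v) * A := by gcongr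
      _ = _ := by ring

theorem contDiff_coordKernel {n : ℕ} (hn : l + m = n) {z : ℂ}
    (hz : z ∈ halfPlane K.ε K.κ K.η n) (hlam : ContDiff ℝ 1 K.lam)
    {A B : ℝ} (hS : K.KernelBound (K.effSum m) A B) : ContDiff ℝ 1 (K.coordKernel l m z) := by
  have h1 : ContDiff ℝ 1 (K.formFactor : Coords d l m → ℂ) := by
    have e : (K.formFactor : Coords d l m → ℂ) =
        fun p => ∏ i, K.externalFactor i (externalCLM i p) := funext formFactor_eq
    rw [e]
    refine contDiff_prod fun i _ => ?_
    cases i with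
    | inl i => exact hlam.comp (externalCLM (Sum.inl i)).contDiff
    | inr i =>
      exact ((Complex.conjCLE : ℂ →L[ℝ] ℂ).contDiff.comp hlam).comp
        (externalCLM (Sum.inr i)).contDiff
  have h2 : ContDiff ℝ 1 (K.spectatorArg z : Coords d l m → KerArg d m m) := by
    have h3 : ContDiff ℝ 1 fun p : Coords d l m => ∑ i, K.ω (p.2.1 i) :=
      ContDiff.sum fun i _ => K.ω_contDiff.comp (spectatorCLM (m := m) i).contDiff
    exact (contDiff_const.sub (Complex.ofRealCLM.contDiff.comp h3)).prodMk
      (contDiff_fst.prodMk (contDiff_snd.comp contDiff_snd))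
  exact h1.smul (hS.contDiffOn.comp_contDiff h2 fun p => spectatorArg_mem hn hz p)

theorem fullKernel_ofTuple (hd : 0 < d) (z : ℂ) {p : Coords d l m}
    (h1 : Function.Injective p.1) (h2 : Function.Injective p.2.1) :
    K.fullKernel m z (ofTuple p.1) (ofTuple p.2.1) p.2.2 = K.coordKernel l m z p := by
  rw [fullKernel, coordKernel, formFactor, prod_ofTuple h1, confEffSum_ofTuple hd h1, spectatorArg,
    energy, sum_ofTuple h2]

theorem isOpen_injective (l : ℕ) : IsOpen {x : Fin l → Mom d | Function.Injective x} := by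
  have : {x : Fin l → Mom d | Function.Injective x} =
      ⋂ i : Fin l, ⋂ j : Fin l, {x | x i = x j → i = j} := by
    ext x; simp [Function.Injective]
  rw [this]
  refine isOpen_iInter_of_finite fun i => isOpen_iInter_of_finite fun j => ?_
  by_cases h : i = j
  · simp [h]
  · simp only [h, imp_false]
    exact (isClosed_eq (continuous_apply i) (continuous_apply j)).isOpen_compl

theorem isOpen_injective_coords (l m : ℕ) :
    IsOpen {p : Coords d l m | Function.Injective p.1 ∧ Function.Injective p.2.1} :=
  ((isOpen_injective m).preimage continuous_fst).inter
    ((isOpen_injective l).preimage (continuous_fst.comp continuous_snd))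

theorem sum_norm_single (i : Fin l) (j : Fin d) :
    ∑ i', ‖(Pi.single i (EuclideanSpace.single j (1 : ℝ)) : Fin l → Mom d) i'‖ = 1 := by
  rw [Finset.sum_eq_single_of_mem i (Finset.mem_univ i)]
  · simp
  · intro i' _ hi
    simp [Pi.single_eq_of_ne hi]

end Model

/-! ### Smallness of the coupling constant -/

/-- A continuous function vanishing at infinity is bounded. -/
theorem exists_bound_of_tendsto_cocompact {E : Type*} [TopologicalSpace E] [Nonempty E]
    {g : E → ℝ} (hg : Continuous g) (h : Tendsto g (cocompact E) (𝓝 0)) :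
    ∃ C : ℝ, 0 ≤ C ∧ ∀ q, g q ≤ C := by
  obtain ⟨C, hC⟩ := ZeroAtInftyContinuousMap.bounded
    (⟨⟨g, hg⟩, h⟩ : ZeroAtInftyContinuousMap E ℝ)
  obtain ⟨q₀⟩ := ‹Nonempty E›
  have hd : ∀ q, |g q - g q₀| ≤ C := fun q => hC q q₀
  refine ⟨|g q₀| + C, add_nonneg (abs_nonneg _) ((abs_nonneg _).trans (hd q₀)), fun q => ?_⟩
  have h1 := (le_abs_self _).trans (hd q)
  have h2 := le_abs_self (g q₀)
  linarith

namespace Model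

variable {d : ℕ} {K : Model d} {m : ℕ}

/-- Smallness of the coupling constant in the presence of `m` bosons means `α * sizeBound m < 1`.
The summands after the first give, in this order, the convergence of the kernel series, that of the
operator series, and the control of the higher order terms by `(α / η) ^ (m + 1)`. -/
noncomputable def sizeBound (K : Model d) (m : ℕ) : ℝ :=
  1 + 4 * K.rate m + K.fieldNorm m + 4 * 4 ^ m * K.rate m ^ (m + 2) * K.η ^ (m + 1)

theorem fieldNorm_nonneg (K : Model d) (n : ℕ) : 0 ≤ K.fieldNorm n := by
  have := norm_nonneg kerAct
  have := (rate_pos (K := K) n).le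
  have : 0 ≤ (eLpNorm K.lam 2 volume).toReal := ENNReal.toReal_nonneg
  unfold fieldNorm
  positivity

theorem sizeBound_pos (K : Model d) (m : ℕ) : 0 < K.sizeBound m := by
  have := K.fieldNorm_nonneg m
  have := rate_pos (K := K) m
  have := K.η_pos
  unfold sizeBound
  positivity

theorem small_of_mul_sizeBound (h : K.α * K.sizeBound m < 1) :
    K.α * K.rate m ≤ 1 / 4 ∧ K.α * K.fieldNorm m < 1 ∧
      K.α * (4 * 4 ^ m * K.rate m ^ (m + 2) * K.η ^ (m + 1)) ≤ 1 := by
  have hα := K.α_nonneg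
  have h1 := mul_nonneg hα (K.fieldNorm_nonneg m)
  have h2 := mul_nonneg hα (rate_pos (K := K) m).le
  have h3 : 0 ≤ K.α * (4 * 4 ^ m * K.rate m ^ (m + 2) * K.η ^ (m + 1)) := by
    have := (rate_pos (K := K) m).le
    have := K.η_pos
    positivity
  have e : K.α * K.sizeBound m = K.α + 4 * (K.α * K.rate m) + K.α * K.fieldNorm m +
      K.α * (4 * 4 ^ m * K.rate m ^ (m + 2) * K.η ^ (m + 1)) := by
    unfold sizeBound; ring
  rw [e] at h
  refine ⟨?_, ?_, ?_⟩ <;> linarith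

theorem fullKernel_zero (z : ℂ) (Q : Config d) :
    K.fullKernel 0 z ∅ Q Fin.elim0 = K.confEffSum 0 (z - (energy K.ω Q : ℂ)) ∅ Fin.elim0 := by
  simp [fullKernel]

theorem norm_fullKernel_zero_le (hd : 0 < d) {n : ℕ} {z : ℂ} (hz : z ∈ halfPlane K.ε K.κ K.η n)
    (hα : K.α * K.sizeBound 0 < 1) {Q : Config d} (hQ : Q.card = n) :
    ‖K.fullKernel 0 z ∅ Q Fin.elim0‖ ≤ 2 * (K.α ^ 2 / K.η) * K.mass := by
  obtain ⟨h1, -, h3⟩ := small_of_mul_sizeBound hα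
  have h := confEffSum_ofTuple (K := K) hd (m := 0) (x := Fin.elim0)
    (fun i => Fin.elim0 i) (z - (energy K.ω Q : ℂ)) Fin.elim0
  rw [ofTuple_zero] at h
  rw [fullKernel_zero, h]
  refine norm_effSum_zero_le h1 (by simpa using h3) (sub_energy_mem hz (by omega)) _ _

theorem contDiffOn_fullKernel_zero (hd : 0 < d) {n : ℕ} {z : ℂ}
    (hz : z ∈ halfPlane K.ε K.κ K.η n) (hα : K.α * K.sizeBound 0 < 1)
    (hlam : ContDiff ℝ 1 K.lam) :
    ContDiffOn ℝ 1 (fun x : Fin n → Mom d => K.fullKernel 0 z ∅ (ofTuple x) Fin.elim0)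
      {x | Function.Injective x} := by
  have h := (contDiff_coordKernel (K := K) (m := 0) (add_zero n) hz hlam
    (kernelBound_effSum (small_of_mul_sizeBound hα).1)).comp
      (contDiff_prodMk_right (𝕜 := ℝ) (n := 1) (Fin.elim0 : Fin 0 → Mom d) |>.comp
        (contDiff_prodMk_left (𝕜 := ℝ) (n := 1) (E := Fin n → Mom d) (Fin.elim0 : Fin 0 → Mom d)))
  refine h.contDiffOn.congr fun x hx => ?_
  have := fullKernel_ofTuple (K := K) hd z (p := (((Fin.elim0 : Fin 0 → Mom d), x,
    (Fin.elim0 : Fin 0 → Mom d)) : Coords d n 0)) (fun i => Fin.elim0 i) hx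
  rw [ofTuple_zero] at this
  exact this

theorem contDiffOn_fullKernel (hd : 0 < d) {l n : ℕ} (hn : l + m = n) {z : ℂ}
    (hz : z ∈ halfPlane K.ε K.κ K.η n) (hα : K.α * K.sizeBound m < 1)
    (hlam : ContDiff ℝ 1 K.lam) :
    ContDiffOn ℝ 1 (fun p : Coords d l m => K.fullKernel m z (ofTuple p.1) (ofTuple p.2.1) p.2.2)
      {p | Function.Injective p.1 ∧ Function.Injective p.2.1} :=
  (contDiff_coordKernel hn hz hlam
    (kernelBound_effSum (small_of_mul_sizeBound hα).1)).contDiffOn.congr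
      fun _ hp => fullKernel_ofTuple hd z hp.1 hp.2

theorem fullKernel_bound (hd : 0 < d) {l n : ℕ} (hn : l + m = n) {z : ℂ}
    (hz : z ∈ halfPlane K.ε K.κ K.η n) (hα : K.α * K.sizeBound m < 1)
    (hlam : ContDiff ℝ 1 K.lam) {h : Mom d → ℝ} (hpos : ∀ q, 0 ≤ h q)
    (hle : ∀ q, ‖K.lam q‖ ≤ h q) {C : ℝ} (hC : 0 ≤ C)
    (hderiv : ∀ q, ‖fderiv ℝ K.lam q‖ ≤ C * h q) {C' : ℝ} (hC'η : 2 * K.η ≤ C')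
    (hC' : 2 * (C * K.η + K.η * K.c) ≤ C') {p : Coords d l m}
    (h1 : Function.Injective p.1) (h2 : Function.Injective p.2.1) :
    ‖K.fullKernel m z (ofTuple p.1) (ofTuple p.2.1) p.2.2‖ ≤
      C' * (2 * K.α / K.η) ^ (m + 1) * (∏ q ∈ ofTuple p.1, h q) * ∏ i, h (p.2.2 i) ∧
    ∀ v, coordNorm v = 1 →
      ‖fderiv ℝ (fun p : Coords d l m =>
          K.fullKernel m z (ofTuple p.1) (ofTuple p.2.1) p.2.2) p v‖ ≤
        C' * (2 * K.α / K.η) ^ (m + 1) * (∏ q ∈ ofTuple p.1, h q) * ∏ i, h (p.2.2 i) := by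
  obtain ⟨hρ, -, hs⟩ := small_of_mul_sizeBound hα
  have hα0 := K.α_nonneg
  have hη := K.η_pos
  have hc := K.c_nonneg
  have hS := (kernelBound_effSum hρ).mono (effSize_le hs) (effSize_le hs)
  set X := (K.α / K.η) ^ (m + 1) with hX
  have hX0 : 0 ≤ X := by positivity
  obtain ⟨b1, b2⟩ := coordKernel_bound hn hz hlam hpos hle hC hderiv (by positivity) hS p
  rw [prod_ofTuple h1]
  set H := (∏ i, h (p.1 i)) * ∏ i, h (p.2.2 i) with hH
  have hH0 : 0 ≤ H := mul_nonneg (Finset.prod_nonneg fun _ _ => hpos _)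
    (Finset.prod_nonneg fun _ _ => hpos _)
  have hgoal : ∀ a ≤ C', H * (a * X) ≤
      C' * (2 * K.α / K.η) ^ (m + 1) * (∏ i, h (p.1 i)) * ∏ i, h (p.2.2 i) := by
    intro a ha
    have hC0 : 0 ≤ C' := le_trans (by positivity) hC'η
    have h3 : X ≤ (2 * K.α / K.η) ^ (m + 1) := by
      rw [hX]
      refine pow_le_pow_left₀ (by positivity) ?_ _
      gcongr
      linarith
    calc H * (a * X) ≤ H * (C' * (2 * K.α / K.η) ^ (m + 1)) := by gcongr
      _ = _ := by rw [hH]; ring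
  refine ⟨?_, fun v hv => ?_⟩
  · rw [fullKernel_ofTuple hd z h1 h2]
    refine b1.trans (le_trans (le_of_eq ?_) (hgoal _ hC'η))
    ring
  · have he : (fun p : Coords d l m => K.fullKernel m z (ofTuple p.1) (ofTuple p.2.1) p.2.2)
        =ᶠ[𝓝 p] K.coordKernel l m z := by
      filter_upwards [(isOpen_injective_coords l m).mem_nhds ⟨h1, h2⟩] with r hr
      exact fullKernel_ofTuple hd z hr.1 hr.2
    rw [he.fderiv_eq]
    refine (b2 v).trans (le_trans (le_of_eq ?_) (hgoal _ hC'))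
    rw [hv]
    ring

theorem coordNorm_single_fst {l : ℕ} (i : Fin m) (j : Fin d) :
    coordNorm ((Pi.single i (EuclideanSpace.single j (1 : ℝ)), 0, 0) : Coords d l m) = 1 := by
  simp only [coordNorm, sum_norm_single]
  simp

theorem coordNorm_single_mid {l : ℕ} (i : Fin l) (j : Fin d) :
    coordNorm ((0, Pi.single i (EuclideanSpace.single j (1 : ℝ)), 0) : Coords d l m) = 1 := by
  simp only [coordNorm, sum_norm_single]
  simp

theorem coordNorm_single_snd {l : ℕ} (i : Fin m) (j : Fin d) :
    coordNorm ((0, 0, Pi.single i (EuclideanSpace.single j (1 : ℝ))) : Coords d l m) = 1 := by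
  simp only [coordNorm, sum_norm_single]
  simp

end Model

theorem mainTheorem3
    (d : ℕ) (hd : 0 < d) (ε : ℝ) (hε : 0 < ε)
    (ω : Mom d → ℝ) (hω_pos : ∀ q, 0 < ω q) (hω_smooth : ContDiff ℝ 1 ω)
    (hω_min : ∀ q, ω 0 ≤ ω q)
    (hω_lim : Tendsto (fun q => ‖fderiv ℝ ω q‖ / ω q) (cocompact (Mom d)) (𝓝 0))
    (lam : Mom d → ℂ) (hlam_smooth : ContDiff ℝ 1 lam)
    (h : Mom d → ℝ) (hh_pos : ∀ q, 0 < h q) (hh_le : ∀ q, h q ≤ 1) (hh_L2 : MemLp h 2 volume)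
    (hlam_le : ∀ q, ‖lam q‖ ≤ h q)
    (hlam_deriv : ∃ C : ℝ, 0 < C ∧ ∀ q, ‖fderiv ℝ lam q‖ ≤ C * h q) :
    ∀ η₁ : ℝ, 0 < η₁ → ∃ C' : ℝ, 0 < C' ∧ ∀ η : ℝ, 0 < η → η ≤ η₁ →
    ∃ α₀ : ℕ → ℝ, (∀ n, 0 < α₀ n) ∧ Antitone α₀ ∧
    ∀ α : ℝ, 0 ≤ α →
    ∃ (M : ℕ → ℂ → Config d → SpinMat)
      (D : (n m : ℕ) → ℂ → Config d → Config d → (Fin m → Mom d) → SpinMat),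
    ∀ n : ℕ, α < α₀ n →
      -- the resolvent exists and the effective operator has the asserted representation
      (∀ z ∈ halfPlane ε (ω 0) η n,
        ∃ (R : sectorGt d n →L[ℂ] sectorGt d n)
          (C : sectorGt d n →L[ℂ] sectorEq d n) (Cs : sectorEq d n →L[ℂ] sectorGt d n),
          IsResolventB ε α ω lam n z R ∧ IsC α lam n C ∧ IsCStar α lam n Cs ∧
          ∀ f : sectorEq d n, ∀ᵐ Q ∂(lebesguePoisson d), Q.card = n →
            (∀ m ∈ Finset.Icc 1 n, ∀ Q₁ ∈ Q.powersetCard m,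
              Integrable (fun k : Fin m → Mom d =>
                matAct (D n m z Q₁ (remove Q Q₁) k)
                  ((f : SBSpace d) (addTuple (remove Q Q₁) k)))) ∧
            (C (R (Cs f)) : SBSpace d) Q =
              matAct (M n z Q) ((f : SBSpace d) Q) +
              ∑ m ∈ Finset.Icc 1 n, ∑ Q₁ ∈ Q.powersetCard m,
                ∫ k : Fin m → Mom d,
                  matAct (D n m z Q₁ (remove Q Q₁) k)
                    ((f : SBSpace d) (addTuple (remove Q Q₁) k))) ∧
      -- the multiplication term
      (∀ Q : Config d, Q.card = n →
        AnalyticOnNhd ℂ (fun z => M n z Q) (halfPlane ε (ω 0) η n) ∧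
        ∀ z ∈ halfPlane ε (ω 0) η n,
          M n z Q = M 0 (z - (energy ω Q : ℂ)) ∅ ∧
          ‖M n z Q‖ ≤ 2 * C' * (α ^ 2 / η) * ∫ q, ‖lam q‖ ^ 2) ∧
      (∀ z ∈ halfPlane ε (ω 0) η n,
        ContDiffOn ℝ 1 (fun x : Fin n → Mom d => M n z (ofTuple x))
          {x | Function.Injective x}) ∧
      -- the kernels
      (∀ m ∈ Finset.Icc 1 n,
        (∀ Q₁ Q₂ : Config d, Q₁.card = m → Q₂.card = n - m → ∀ k : Fin m → Mom d,
          AnalyticOnNhd ℂ (fun z => D n m z Q₁ Q₂ k) (halfPlane ε (ω 0) η n) ∧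
          ∀ z ∈ halfPlane ε (ω 0) η n,
            D n m z Q₁ Q₂ k = D m m (z - (energy ω Q₂ : ℂ)) Q₁ ∅ k) ∧
        ∀ z ∈ halfPlane ε (ω 0) η n,
          ContDiffOn ℝ 1 (inCoordinates (n - m) (D n m z))
            {p | Function.Injective p.1 ∧ Function.Injective p.2.1} ∧
          ∀ p : (Fin m → Mom d) × (Fin (n - m) → Mom d) × (Fin m → Mom d),
            Function.Injective p.1 → Function.Injective p.2.1 →
            FirstOrderBound (inCoordinates (n - m) (D n m z)) p
              (C' * (2 * α / η) ^ (m + 1) * (∏ q ∈ ofTuple p.1, h q) * ∏ i, h (p.2.2 i))) := by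
  intro η₁ hη₁
  obtain ⟨Cl, hCl, hderiv⟩ := hlam_deriv
  have hκ := hω_pos 0
  obtain ⟨Cω, hCω, hωd⟩ : ∃ C : ℝ, 0 ≤ C ∧ ∀ q, ‖fderiv ℝ ω q‖ / ω q ≤ C :=
    exists_bound_of_tendsto_cocompact
      ((hω_smooth.continuous_fderiv one_ne_zero).norm.div hω_smooth.continuous
        fun q => (hω_pos q).ne') hω_lim
  have hlam2 : MemLp lam 2 volume :=
    hh_L2.of_le hlam_smooth.continuous.aestronglyMeasurable (Eventually.of_forall fun q =>
      (hlam_le q).trans (le_abs_self _))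
  -- the relative gradient of `ω` is bounded by `C₁ / η`
  set C₁ := Cω * (η₁ + ω 0) with hC₁
  have hC₁0 : 0 ≤ C₁ := by positivity
  -- values of the kernels need `2 η ≤ C'`, and their derivatives `2 (Cl η + C₁) ≤ C'`
  set C' := 2 * (Cl * η₁ + C₁) + 2 * η₁ + 1 with hC'
  have hC'pos : 0 < C' := by positivity
  refine ⟨C', hC'pos, fun η hη hηle => ?_⟩
  have hgrad : ∀ q, ‖fderiv ℝ ω q‖ ≤ C₁ / η * (ω q - ω 0 + η) := by
    intro q
    have h1 := (div_le_iff₀ (hω_pos q)).1 (hωd q)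
    have h2 := hω_min q
    have h3 : ω q * η ≤ (η₁ + ω 0) * (ω q - ω 0 + η) := by
      nlinarith [mul_nonneg (sub_nonneg.2 h2) (sub_nonneg.2 hηle),
        mul_nonneg (sub_nonneg.2 h2) hκ.le,
        mul_nonneg hη.le (sub_nonneg.2 hηle)]
    refine h1.trans ?_
    rw [div_mul_eq_mul_div, le_div_iff₀ hη, hC₁, mul_assoc, mul_assoc]
    exact mul_le_mul_of_nonneg_left h3 hCω
  set K : (α : ℝ) → 0 ≤ α → Model d := fun α hα =>
    { ε := ε, α := α, κ := ω 0, η := η, c := C₁ / η, ω := ω, lam := lam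
      ε_pos := hε, α_nonneg := hα, κ_pos := hκ, η_pos := hη, c_nonneg := by positivity
      ω_contDiff := hω_smooth, κ_le := hω_min, fderiv_ω_le := hgrad
      lam_continuous := hlam_smooth.continuous, lam_memLp := hlam2 } with hK
  -- the thresholds do not depend on the coupling constant of the model
  set s : ℕ → ℝ := (K 0 le_rfl).sizeBound with hs
  have hs0 : ∀ m, 0 < s m := (K 0 le_rfl).sizeBound_pos
  have hne : ∀ n : ℕ, (Finset.range (n + 1)).Nonempty := fun n => Finset.nonempty_range_add_one
  refine ⟨fun n => (Finset.range (n + 1)).inf' (hne n) fun m => (s m)⁻¹, fun n => ?_,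
    fun n n' h => ?_, fun α hα => ?_⟩
  · exact (Finset.lt_inf'_iff _).2 fun m _ => inv_pos.2 (hs0 m)
  · exact Finset.inf'_mono _ (Finset.range_mono (by omega)) (hne n)
  refine ⟨fun _ z Q => Matrix.of ((K α hα).fullKernel 0 z ∅ Q Fin.elim0),
    fun _ m z Q₁ Q₂ k => Matrix.of ((K α hα).fullKernel m z Q₁ Q₂ k), fun n hn => ?_⟩
  have hsmall : ∀ m ≤ n, (K α hα).α * (K α hα).sizeBound m < 1 := by
    intro m hm
    have h1 : α < (s m)⁻¹ :=
      (Finset.lt_inf'_iff _).1 hn m (Finset.mem_range.2 (Nat.lt_succ_of_le hm))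
    have h2 := mul_lt_mul_of_pos_right h1 (hs0 m)
    rwa [inv_mul_cancel₀ (hs0 m).ne'] at h2
  have hρ : ∀ m ≤ n, (K α hα).α * (K α hα).rate m ≤ 1 / 4 := fun m hm =>
    (Model.small_of_mul_sizeBound (hsmall m hm)).1
  have hρ' : (K α hα).α * (K α hα).rate n < 1 := (hρ n le_rfl).trans_lt (by norm_num)
  refine ⟨fun z hz => ?_, fun Q hQ => ⟨?_, fun z hz => ⟨?_, ?_⟩⟩, fun z hz => ?_, fun m hm =>
    ⟨fun Q₁ Q₂ h₁ h₂ k => ⟨?_, fun z hz => ?_⟩, fun z hz => ⟨?_, fun p hp₁ hp₂ => ?_⟩⟩⟩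
  · have hz' : z ∈ halfPlane (K α hα).ε (K α hα).κ (K α hα).η n := hz
    obtain ⟨R, C, Cs, hR, hC, hCs, hf⟩ := Model.exists_effective hd hz'
      hρ' (Model.small_of_mul_sizeBound (hsmall n le_rfl)).2.1
    refine ⟨R, C, Cs, hR, hC, hCs, fun f => ?_⟩
    filter_upwards [hf f, Model.ae_isGood (K := K α hα) hd (Lp.memLp (f : SBSpace d))]
      with Q h1 h2 hQ
    refine ⟨fun m _ Q₁ hQ₁ => ?_, ?_⟩
    · exact Model.integrable_fullKernel hd hz' hρ' h2 hQ hQ₁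
    · rw [h1 hQ, Model.normalAct_confEffSum _ _ hQ, ← Model.fullKernel_zero]
      rfl
  · exact Model.analyticOnNhd_fullKernel (K := K α hα) hd (hρ 0 (Nat.zero_le n)) Finset.card_empty
      (by omega) Fin.elim0
  · simp only [Model.fullKernel, energy, Finset.sum_empty, Complex.ofReal_zero, sub_zero]
    rfl
  · have h1 := Model.norm_fullKernel_zero_le (K := K α hα) hd hz (hsmall 0 (Nat.zero_le n)) hQ
    have h2 : (1 : ℝ) ≤ C' := by
      have : 0 ≤ Cl * η₁ := by positivity
      linarith
    have h3 : 0 ≤ 2 * (α ^ 2 / η) * ∫ q, ‖lam q‖ ^ 2 :=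
      mul_nonneg (by positivity) (integral_nonneg fun q => by positivity)
    refine (h1.trans (le_mul_of_one_le_right h3 h2)).trans_eq ?_
    change 2 * (α ^ 2 / η) * (∫ q, ‖lam q‖ ^ 2) * C' = _
    ring
  · exact Model.contDiffOn_fullKernel_zero (K := K α hα) hd hz (hsmall 0 (Nat.zero_le n))
      hlam_smooth
  · have := (Finset.mem_Icc.1 hm).2
    exact Model.analyticOnNhd_fullKernel (K := K α hα) hd (hρ m this) h₁ (by omega) k
  · simp only [Model.fullKernel, energy, Finset.sum_empty, Complex.ofReal_zero, sub_zero]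
    rfl
  · have := (Finset.mem_Icc.1 hm).2
    exact Model.contDiffOn_fullKernel (K := K α hα) hd (Nat.sub_add_cancel this) hz (hsmall m this)
      hlam_smooth
  · have hmn := (Finset.mem_Icc.1 hm).2
    have hCl' : Cl * η ≤ Cl * η₁ := mul_le_mul_of_nonneg_left hηle hCl.le
    have hCη : 2 * η ≤ C' := by
      have : 0 ≤ Cl * η₁ := by positivity
      linarith
    have hCη' : 2 * (Cl * η + η * (C₁ / η)) ≤ C' := by
      rw [mul_div_cancel₀ _ hη.ne']
      linarith
    obtain ⟨b1, b2⟩ := Model.fullKernel_bound (K := K α hα) hd (Nat.sub_add_cancel hmn) hz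
      (hsmall m hmn) hlam_smooth (fun q => (hh_pos q).le) hlam_le hCl.le hderiv (C' := C')
      hCη hCη' hp₁ hp₂
    exact ⟨b1, fun i j => b2 _ (Model.coordNorm_single_fst i j),
      fun i j => b2 _ (Model.coordNorm_single_mid i j),
      fun i j => b2 _ (Model.coordNorm_single_snd i j)⟩
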